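/- **Setting.** Let $\psi_1=1$, $\psi_{2k}(t)=\sqrt2\cos(2\pi kt)$, $\psi_{2k+1}(t)=\sqrt2\sin(2\pi kt)$ $(k\ge1)$ be the trigonometric basis of the real space $L^2[0,1]$, write $[f]_j=\langle f,\psi_j\rangle$, and for $p>0$ let $b^p_1=1$, $b^p_{2k}=b^p_{2k+1}=k^{2p}$. For $\rho>0$ let $\mathcal W_p^\rho=\{f\in L^2[0,1]:\sum_j b_j^p[f]_j^2\le\rho\}$. Let $\sigma>0$, $\rho>0$, $d\ge1$, $\eta\ge1$, let $k\ge4$ and $0\le s\le p$ be integers ($p>0$ real), and let $\upsilon=(\upsilon_j)_{j\ge1}$ be a strictly positive non-increasing summable sequence. One observes $n$ independent copies $(Y_i,X_i)$ of $(Y,X)$, where $Y=\int_0^1\beta(t)X(t)\,dt+\sigma\epsilon$, and * $X$ is a centered random element of $L^2[0,1]$ with $E\|X\|^2<\infty$ and strictly positive covariance operator $\Gamma$; with $[\Gamma]_D=(\langle\Gamma\psi_l,\psi_j\rangle)_{1\le j,l\le D}$ and $[X]_D=([X]_1,\dots,[X]_D)^t$ one has $E\bigl|[X]_j/\langle\Gamma\psi_j,\psi_j\rangle^{1/2}\bigr|^{4k}\le\eta$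 for all $j\ge1$ and $E\bigl|([\Gamma]_D^{-1/2}[X]_D)_j\bigr|^{4k}\le\eta$ for all $1\le j\le D$; * $\epsilon$ is a real random variable with $E\epsilon=0$, $E\epsilon^2=1$, $E|\epsilon|^{4k}\le\eta$, uncorrelated with $X$, i.e. $E[\epsilon X]=0$; * (link condition) $d^{-2}\sum_j\upsilon_j^2[f]_j^2\le\|\Gamma f\|^2\le d^2\sum_j\upsilon_j^2[f]_j^2$ for all $f\in L^2[0,1]$. With $e_j(t)=e^{2i\pi jt}$, $\hat g=\frac1n\sum_iY_iX_i$ and $\hat\Gamma f=\frac1n\sum_i\bigl(\int_0^1X_if\bigr)X_i$, let $[\hat\Gamma]_{\underline m}=(\langle\hat\Gamma e_l,e_j\rangle)_{-m\le j,l\le m}$ and $[\hat g]_{\underline m}=(\langle\hat g,e_j\rangle)_{-m\le j\le m}$. For a dimension parameter $m$ and a threshold $\gamma$ the estimator of the $s$-th weak derivative $\beta^{(s)}$ is $$\hat\beta^{(s)}=\sum_{j=-m}^m(2i\pi j)^s\bigl([\hat\Gamma]_{\underline m}^{-1}[\hat g]_{\underline m}\bigr)_j\,e_j$$ if $[\hat\Gamma]_{\underline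 m}$ is nonsingular and $\|[\hat\Gamma]_{\underline m}^{-1}\|\le\gamma$ (operator norm), and $\hat\beta^{(s)}=0$ otherwise. Write $a_n\sim b_n$ if each of the two sequences is, for all large $n$, at most a constant times the other. **Proposition.** Every $\beta\in\mathcal W_p^\rho$ has an $s$-th weak derivative $\beta^{(s)}\in L^2[0,1]$. Take $\gamma=n$. (i) Polynomial case: let $\upsilon_1=1$, $\upsilon_j=j^{-2a}$ $(j\ge2)$ with $a>1/2$, let $k\ge2+8/(2p+2a-1)$ and $m=m_n\sim n^{1/(2p+2a+1)}$. Then there are $C$ and $N$ such that for all $n\ge N$ $$\sup_{\beta\in\mathcal W_p^\rho}E\|\hat\beta^{(s)}-\beta^{(s)}\|^2\le C\,n^{-(2p-2s)/(2p+2a+1)}.$$ (ii) Exponential case: let $\upsilon_1=1$, $\upsilon_j=\exp(-j^{2a})$ $(j\ge2)$ with $a>0$, and let $m=m_n\sim(\log n)^{1/(2a)}$ be such that $m_n^{2p+1}\exp\bigl((2m_n+1)^{2a}\bigr)=O(n)$ (which holds, for instance, if $(2m_n+1)^{2a}\le c\log n$ for some $c<1$ and all large $n$). Then there are $C$ and $N$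 such that for all $n\ge N$ $$\sup_{\beta\in\mathcal W_p^\rho}E\|\hat\beta^{(s)}-\beta^{(s)}\|^2\le C\,(\log n)^{-(p-s)/a}.$$ In both cases $C$ and $N$ depend only on $p,s,a,k,\rho,\sigma,d,\eta$ and the sequence $(m_n)$, and not on the law of $(X,\epsilon)$ otherwise. -/

import Mathlib

open MeasureTheory ProbabilityTheory Filter Asymptotics
open scoped ENNReal

universe u

noncomputable section

namespace FunctionalLinearModel

/-! ### The space `L²[0,1]`, the trigonometric basis and weighted norms -/

/-- The real Hilbert space `L²[0,1]`. -/
abbrev L2 : Type := Lp ℝ 2 (volume.restrict (Set.Icc (0 : ℝ) 1))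

instance : MeasurableSpace L2 := borel L2

instance : BorelSpace L2 := ⟨rfl⟩

/-- The frequency of the `(j+1)`-st trigonometric function: `0, 1, 1, 2, 2, 3, 3, …`. -/
def freq (j : ℕ) : ℕ := (j + 1) / 2

/-- The trigonometric functions `1, √2 cos(2πt), √2 sin(2πt), √2 cos(4πt), √2 sin(4πt), …`.
All sequences indexed by `1, 2, 3, …` in the literature are indexed by `0, 1, 2, …` here,
so that `trigFun j` is `ψ_{j+1}`. -/
def trigFun (j : ℕ) (t : ℝ) : ℝ :=
  if j = 0 then 1
  else if j % 2 = 1 then Real.sqrt 2 * Real.cos (2 * Real.pi * (freq j : ℝ) * t)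
  else Real.sqrt 2 * Real.sin (2 * Real.pi * (freq j : ℝ) * t)

lemma continuous_trigFun (j : ℕ) : Continuous (trigFun j) := by
  unfold trigFun
  split_ifs <;> fun_prop

lemma abs_trigFun_le (j : ℕ) (t : ℝ) : ‖trigFun j t‖ ≤ Real.sqrt 2 := by
  have h1 : (1 : ℝ) ≤ Real.sqrt 2 := by
    rw [Real.one_le_sqrt]; norm_num
  unfold trigFun
  split_ifs
  · simp [h1]
  · rw [norm_mul, Real.norm_of_nonneg (Real.sqrt_nonneg 2)]
    exact mul_le_of_le_one_right (Real.sqrt_nonneg 2) (Real.abs_cos_le_one _)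
  · rw [norm_mul, Real.norm_of_nonneg (Real.sqrt_nonneg 2)]
    exact mul_le_of_le_one_right (Real.sqrt_nonneg 2) (Real.abs_sin_le_one _)

lemma memLp_trigFun (j : ℕ) :
    MemLp (trigFun j) 2 (volume.restrict (Set.Icc (0 : ℝ) 1)) :=
  MemLp.of_bound (continuous_trigFun j).aestronglyMeasurable (Real.sqrt 2)
    (Filter.Eventually.of_forall (abs_trigFun_le j))

/-- The trigonometric basis as elements of `L²[0,1]`. -/
def ψ (j : ℕ) : L2 := (memLp_trigFun j).toLp (trigFun j)

/-- The coordinate `⟨f, ψ_j⟩`. -/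
def coord (f : L2) (j : ℕ) : ℝ := inner ℝ f (ψ j)

/-- The Sobolev weights `b^p`: weight `1` for the constant function and `k^{2p}` for the cosine and
the sine of frequency `k ≥ 1`. -/
def sobolevWeight (p : ℝ) (j : ℕ) : ℝ :=
  if j = 0 then 1 else (freq j : ℝ) ^ (2 * p)

/-- The Sobolev ellipsoid `W_p^ρ = {f : ∑_j b_j^p ⟨f, ψ_j⟩² ≤ ρ}`. -/
def ellipsoid (p ρ : ℝ) : Set L2 :=
  {f | Summable (fun j => sobolevWeight p j * coord f j ^ 2) ∧
    ∑' j, sobolevWeight p j * coord f j ^ 2 ≤ ρ}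

/-- `υ_1 = 1` and `υ_j = j^{-2a}` for `j ≥ 2` (index shifted by one). -/
def polyWeight (a : ℝ) (j : ℕ) : ℝ :=
  if j = 0 then 1 else ((j : ℝ) + 1) ^ (-(2 * a))

/-- `υ_1 = 1` and `υ_j = exp(-j^{2a})` for `j ≥ 2` (index shifted by one). -/
def expWeight (a : ℝ) (j : ℕ) : ℝ :=
  if j = 0 then 1 else Real.exp (-(((j : ℝ) + 1) ^ (2 * a)))

/-- The link condition `‖f‖²_{υ²} / d² ≤ ‖Γ f‖² ≤ d² ‖f‖²_{υ²}` for all `f ∈ L²[0,1]`. (The series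
converge, since the weights used here are bounded. It is only imposed on covariance operators of
square integrable random functions, which are self-adjoint and nuclear.) -/
def LinkCondition (υ : ℕ → ℝ) (d : ℝ) (Γ : L2 →L[ℝ] L2) : Prop :=
  ∀ f : L2, (∑' j, υ j ^ 2 * coord f j ^ 2) / d ^ 2 ≤ ‖Γ f‖ ^ 2 ∧
    ‖Γ f‖ ^ 2 ≤ d ^ 2 * ∑' j, υ j ^ 2 * coord f j ^ 2

/-- `g` is the `s`-th weak derivative of `f` on `(0,1)`. -/
def IsWeakDeriv (s : ℕ) (f g : L2) : Prop :=
  ∀ φ : ℝ → ℝ, ContDiff ℝ (⊤ : ℕ∞) φ → HasCompactSupport φ → tsupport φ ⊆ Set.Ioo 0 1 →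
    ∫ t in Set.Icc (0 : ℝ) 1, f t * iteratedDeriv s φ t =
      (-1) ^ s * ∫ t in Set.Icc (0 : ℝ) 1, g t * φ t

/-! ### The regressor, the error term and the sample -/

section Model

variable {Ω : Type u} [MeasurableSpace Ω] (P : Measure Ω)

/-- The covariance operator `Γ f = E[⟨X, f⟩ X]` of a centered random function `X`. -/
def covOp (X : Ω → L2) : L2 →L[ℝ] L2 := covarianceOperator (P.map X)

/-- The entry `⟨Γ ψ_l, ψ_j⟩` of the (infinite) matrix of the covariance operator. -/
def covEntry (X : Ω → L2) (j l : ℕ) : ℝ := coord (covOp P X (ψ l)) j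

/-- The upper `D × D` matrix `[Γ]_D` of the covariance operator. -/
def covMatrix (X : Ω → L2) (D : ℕ) : Matrix (Fin D) (Fin D) ℝ :=
  Matrix.of fun j l => covEntry P X j l

open scoped MatrixOrder in
/-- The whitened random vector `[Γ]_D^{-1/2} [X]_D`. -/
def whitened (X : Ω → L2) (D : ℕ) (ω : Ω) : Fin D → ℝ :=
  Matrix.mulVec (CFC.sqrt (covMatrix P X D)⁻¹) (fun j => coord (X ω) j)

/-- The class `𝒳^q_η` of centered random functions with finite second moment, strictly positive
covariance operator, and `q`-th moments of the standardized coordinates bounded by `η`. -/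
structure RegressorClass (q : ℕ) (η : ℝ) (X : Ω → L2) : Prop where
  aemeasurable : AEMeasurable X P
  memLp : MemLp X 2 P
  centered : ∫ ω, X ω ∂P = 0
  pos : ∀ f : L2, f ≠ 0 → 0 < inner ℝ (covOp P X f) f
  moment_coord : ∀ j : ℕ,
    ∫⁻ ω, ‖coord (X ω) j / Real.sqrt (covEntry P X j j)‖ₑ ^ q ∂P ≤ ENNReal.ofReal η
  moment_whitened : ∀ (D : ℕ) (j : Fin D),
    ∫⁻ ω, ‖whitened P X D ω j‖ₑ ^ q ∂P ≤ ENNReal.ofReal η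

/-- The class `ℰ^q_η` of centered error terms with variance one and `q`-th moment at most `η`. -/
structure ErrorClass (q : ℕ) (η : ℝ) (ε : Ω → ℝ) : Prop where
  aemeasurable : AEMeasurable ε P
  memLp : MemLp ε 2 P
  centered : ∫ ω, ε ω ∂P = 0
  variance_one : ∫ ω, ε ω ^ 2 ∂P = 1
  moment : ∫⁻ ω, ‖ε ω‖ₑ ^ q ∂P ≤ ENNReal.ofReal η

/-- The assumptions on the generic pair `(X, ε)`: moment conditions of order `4k`,
`X` and `ε` are uncorrelated, and the covariance operator of `X` satisfies the link condition. -/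
structure ModelAssumptions (υ : ℕ → ℝ) (d η : ℝ) (k : ℕ) (X : Ω → L2) (ε : Ω → ℝ) : Prop where
  regressor : RegressorClass P (4 * k) η X
  error : ErrorClass P (4 * k) η ε
  uncorrelated : ∫ ω, ε ω • X ω ∂P = 0
  link : LinkCondition υ d (covOp P X)

/-- `(X_i, ε_i)`, `i < n`, are independent copies of `(X₀, ε₀)`. -/
structure IsSample (X₀ : Ω → L2) (ε₀ : Ω → ℝ) {n : ℕ} (X : Fin n → Ω → L2)
    (ε : Fin n → Ω → ℝ) : Prop where
  indep : iIndepFun (fun i ω => (X i ω, ε i ω)) P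
  identDistrib : ∀ i, IdentDistrib (fun ω => (X i ω, ε i ω)) (fun ω => (X₀ ω, ε₀ ω)) P P

end Model

/-! ### The thresholded projection estimator of the `s`-th derivative -/

/-- The exponential function `e_j(t) = exp(2 i π j t)`. -/
def expFun (j : ℤ) (t : ℝ) : ℂ := Complex.exp (2 * Real.pi * Complex.I * j * t)

/-- The Fourier coefficient `⟨x, e_j⟩ = ∫₀¹ x(t) exp(-2 i π j t) dt`. -/
def fourierCoord (x : L2) (j : ℤ) : ℂ :=
  ∫ t in Set.Icc (0 : ℝ) 1, (x t : ℂ) * expFun (-j) t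

/-- The frequencies `-m, …, m`. -/
abbrev Freq (m : ℕ) : Type := ↥(Finset.Icc (-(m : ℤ)) (m : ℤ))

/-- The `(2m+1) × (2m+1)` matrix with entries `⟨Γ̂ e_l, e_j⟩`, where
`Γ̂ f = n⁻¹ ∑_i (∫ X_i f) X_i` is the empirical covariance operator; since `X_i` is real,
`∫ X_i e_l` is the conjugate of the `l`-th Fourier coefficient of `X_i`. -/
def empCov {n : ℕ} (m : ℕ) (x : Fin n → L2) : Matrix (Freq m) (Freq m) ℂ :=
  Matrix.of fun j l =>
    (n : ℂ)⁻¹ * ∑ i, (starRingEnd ℂ) (fourierCoord (x i) l) * fourierCoord (x i) j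

/-- The vector with entries `⟨ĝ, e_j⟩`, where `ĝ = n⁻¹ ∑_i Y_i X_i`. -/
def empCross {n : ℕ} (m : ℕ) (x : Fin n → L2) (y : Fin n → ℝ) : Freq m → ℂ :=
  fun j => (n : ℂ)⁻¹ * ∑ i, (y i : ℂ) * fourierCoord (x i) j

/-- The operator norm (with respect to the Euclidean norm) of a complex square matrix. -/
def opNorm {ι : Type} [Fintype ι] [DecidableEq ι] (A : Matrix ι ι ℂ) : ℝ :=
  ‖Matrix.toEuclideanCLM (n := ι) (𝕜 := ℂ) A‖

open Classical in
/-- The estimator `β̂^{(s)}` with dimension parameter `m` and threshold `γ`: the Fourier coefficients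
`[Γ̂]⁻¹ [ĝ]` multiplied by `(2 i π j)^s`, if `[Γ̂]` is nonsingular and `‖[Γ̂]⁻¹‖ ≤ γ`, and zero
otherwise. -/
def derivEstimator {n : ℕ} (s m : ℕ) (γ : ℝ) (x : Fin n → L2) (y : Fin n → ℝ) (t : ℝ) : ℂ :=
  if IsUnit (empCov m x).det ∧ opNorm (empCov m x)⁻¹ ≤ γ then
    ∑ j : Freq m, (2 * Complex.I * Real.pi * ((j : ℤ) : ℂ)) ^ s *
      ((empCov m x)⁻¹.mulVec (empCross m x y)) j * expFun j t
  else 0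

/-- The risk `E ∫₀¹ |β̂^{(s)}(t) - g(t)|² dt` of the estimator with dimension `m` and threshold `γ`,
based on the sample `(Y_i, X_i)` with `Y_i = ⟨β, X_i⟩ + σ ε_i`. -/
def derivRisk {Ω : Type u} [MeasurableSpace Ω] (P : Measure Ω) {n : ℕ} (s m : ℕ) (γ σ : ℝ)
    (X : Fin n → Ω → L2) (ε : Fin n → Ω → ℝ) (β g : L2) : ℝ≥0∞ :=
  ∫⁻ ω, (∫⁻ t in Set.Icc (0 : ℝ) 1,
    ‖derivEstimator s m γ (fun i => X i ω) (fun i => inner ℝ β (X i ω) + σ * ε i ω) t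
      - ((g t : ℝ) : ℂ)‖ₑ ^ 2) ∂P

/-- With dimension `m n` and threshold `γ = n`, the `L²`-risk of `β̂^{(s)}` is at most a constant
times `r n` for all large `n`, uniformly over all slope functions in `W_p^ρ` (each of which has an
`s`-th weak derivative `g` in `L²[0,1]`) and over all admissible laws of `(X, ε)`. -/
def UniformDerivRate (υ : ℕ → ℝ) (p ρ σ d η : ℝ) (s k : ℕ) (m : ℕ → ℕ) (r : ℕ → ℝ) : Prop :=
  ∃ C : ℝ, 0 < C ∧ ∃ N : ℕ, ∀ β ∈ ellipsoid p ρ, ∃ g : L2, IsWeakDeriv s β g ∧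
    ∀ n : ℕ, N ≤ n →
      ∀ (Ω : Type u) [MeasurableSpace Ω] (P : Measure Ω) [IsProbabilityMeasure P]
        (X₀ : Ω → L2) (ε₀ : Ω → ℝ) (X : Fin n → Ω → L2) (ε : Fin n → Ω → ℝ),
        ModelAssumptions P υ d η k X₀ ε₀ → IsSample P X₀ ε₀ X ε →
          derivRisk P s (m n) (n : ℝ) σ X ε β g ≤ ENNReal.ofReal (C * r n)

end FunctionalLinearModel

end

open FunctionalLinearModel

noncomputable section

namespace FunctionalLinearModel

/-! ### The trigonometric system and the complex exponentials -/

/-! The exponentials of frequency at most m arise from the first D = 2m+1 real trigonometric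
functions by a unitary change of basis, so everything can be computed in real coordinates. Let M =
[Γ]_D, R = M^(-1/2), let G be the empirical counterpart of M, and let b be the Galerkin solution,
for which Γ(β - b) is orthogonal to the first D basis functions. When the threshold is met, the
coordinates u of the undifferentiated estimator satisfy u - b = G⁻¹z with the residual z = [ĝ] - Gb.
The loss thus splits into the approximation error of b, a stochastic error, and the tail of β.

Approximation. The link condition compares Γ² with a diagonal operator. Since the square root is
operator monotone (`inner_le_inner_of_norm_le`), it bounds Γ itself below by υ_D/d on the first D
coordinates, while ‖Γr‖ ≤ d υ_D ‖r‖ for r orthogonal to them. The factors υ_D cancel, so b is as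
good as the orthogonal projection up to a power of d (`LinkCondition.sum_galerkin_sub_sq_le`).

Stochastic error. Put T = |Rz|² and F = ‖RGR - 1‖² in Frobenius norm. If F ≤ 1/4, then RGR ≥ 1/2,
the threshold condition holds and |u - b|² ≤ 4dT/υ_D. If F > 1/4, either the threshold gives |u -
b|² ≤ n²|z|², or the estimator is zero and the loss is the norm of the derivative of β. Powers of
4F, which exceed 1 there, replace the indicator of this bad event
(`lintegral_derivEstimator_sub_sq_le`).

Moments. T and F are sums of D and D² squared averages of i.i.d. centered scores: Galerkin
orthogonality and the lack of correlation center those of T, whitening those of F. An elementary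
moment inequality (`integral_average_even_pow_le`) gives E T = O(D/n), E T^k = O((D/n)^k) and E F^k
= O((D²/n)^k). Scores are products of variables with 4k moments, hence have 2k.

Rates. The risk is of order m^(2s-2p) once m^(2p+1) = O(n υ_D) and m^(2p+2k-1) n² = O(n^k)
(`uniformDerivRate_of_bounds`): the first balances variance and bias, the second makes the bad event
negligible. Both weight sequences reduce to checking these two conditions. -/

/-- The coefficients with respect to `e_j` of the function with coefficients `v` in the real
trigonometric basis. -/
def ftrans (v : ℕ → ℂ) (j : ℤ) : ℂ :=
  if j = 0 then v 0
  else (v (2 * j.natAbs - 1) - (j.sign : ℂ) * Complex.I * v (2 * j.natAbs)) / (Real.sqrt 2 : ℂ)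

lemma ftrans_zero (v : ℕ → ℂ) : ftrans v 0 = v 0 := by simp [ftrans]

lemma ftrans_pos (v : ℕ → ℂ) (m : ℕ) :
    ftrans v ((m : ℤ) + 1) = (v (2 * m + 1) - Complex.I * v (2 * m + 2)) / (Real.sqrt 2 : ℂ) := by
  have h0 : ((m : ℤ) + 1) ≠ 0 := by omega
  have h1 : ((m : ℤ) + 1).natAbs = m + 1 := by omega
  have h2 : ((m : ℤ) + 1).sign = 1 := Int.sign_eq_one_of_pos (by omega)
  simp [ftrans, h0, h1, h2, mul_add]

lemma ftrans_neg (v : ℕ → ℂ) (m : ℕ) :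
    ftrans v (-((m : ℤ) + 1)) =
      (v (2 * m + 1) + Complex.I * v (2 * m + 2)) / (Real.sqrt 2 : ℂ) := by
  have h0 : (-((m : ℤ) + 1)) ≠ 0 := by omega
  have h1 : (-((m : ℤ) + 1)).natAbs = m + 1 := by omega
  have h2 : (-((m : ℤ) + 1)).sign = -1 := Int.sign_eq_neg_one_of_neg (by omega)
  simp only [ftrans, h0, h1, h2, mul_add, if_false]
  push_cast
  ring_nf

/-- Peels off the frequency pair ±(m+1), matching one cosine and one sine; this drives the
inductions comparing the two bases. -/
lemma sum_Icc_neg_succ {M : Type*} [AddCommMonoid M] (f : ℤ → M) (m : ℕ) :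
    ∑ j ∈ Finset.Icc (-((m + 1 : ℕ) : ℤ)) ((m + 1 : ℕ) : ℤ), f j =
      ∑ j ∈ Finset.Icc (-(m : ℤ)) (m : ℤ), f j + (f ((m : ℤ) + 1) + f (-((m : ℤ) + 1))) := by
  have h : Finset.Icc (-((m + 1 : ℕ) : ℤ)) ((m + 1 : ℕ) : ℤ) =
      insert ((m : ℤ) + 1) (insert (-((m : ℤ) + 1)) (Finset.Icc (-(m : ℤ)) (m : ℤ))) := by
    ext x
    simp only [Finset.mem_Icc, Finset.mem_insert]
    omega
  rw [h, Finset.sum_insert (by simp; omega), Finset.sum_insert (by simp)]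
  rw [← add_assoc, add_comm]

lemma sqrt_two_mul_self : (Real.sqrt 2 : ℂ) * (Real.sqrt 2 : ℂ) = 2 := by
  rw [← Complex.ofReal_mul, Real.mul_self_sqrt (by norm_num)]
  norm_num

lemma sqrt_two_ne_zero : (Real.sqrt 2 : ℂ) ≠ 0 := by
  intro h
  have := sqrt_two_mul_self
  simp [h] at this

/-- On each frequency the passage from cosine and sine coefficients to those of e_{±j} is a unitary
2×2 transformation. The truncated change of basis is therefore unitary. -/
lemma sum_conj_ftrans_mul (v w : ℕ → ℂ) (m : ℕ) :
    ∑ j ∈ Finset.Icc (-(m : ℤ)) (m : ℤ), (starRingEnd ℂ) (ftrans v j) * ftrans w j =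
      ∑ l ∈ Finset.range (2 * m + 1), (starRingEnd ℂ) (v l) * w l := by
  induction m with
  | zero => simp [ftrans_zero]
  | succ m ih =>
    rw [sum_Icc_neg_succ, ih, show 2 * (m + 1) + 1 = (2 * m + 1) + 1 + 1 by ring,
      Finset.sum_range_succ _ (2 * m + 1 + 1), Finset.sum_range_succ _ (2 * m + 1), add_assoc]
    congr 1
    simp only [ftrans_pos, ftrans_neg, map_div₀, map_sub, map_add, map_mul, Complex.conj_I,
      Complex.conj_ofReal]
    have h2 := sqrt_two_ne_zero
    have h3 := sqrt_two_mul_self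
    field_simp
    rw [pow_two, h3]
    linear_combination (-2 * ((starRingEnd ℂ) (v (2 * m + 1 + 1)) * w (2 * m + 1 + 1))) *
      Complex.I_mul_I

lemma expFun_eq (j : ℤ) (t : ℝ) :
    expFun j t = Real.cos (2 * Real.pi * j * t) + Real.sin (2 * Real.pi * j * t) * Complex.I := by
  rw [expFun, Complex.ofReal_cos, Complex.ofReal_sin, ← Complex.exp_mul_I]
  congr 1
  push_cast
  ring

lemma trigFun_zero (t : ℝ) : trigFun 0 t = 1 := by simp [trigFun]

lemma freq_odd (m : ℕ) : freq (2 * m + 1) = m + 1 := by unfold freq; omega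

lemma freq_even (m : ℕ) : freq (2 * m + 2) = m + 1 := by unfold freq; omega

lemma trigFun_odd (m : ℕ) (t : ℝ) :
    trigFun (2 * m + 1) t = Real.sqrt 2 * Real.cos (2 * Real.pi * ((m : ℝ) + 1) * t) := by
  simp [trigFun, freq_odd, Nat.add_mod]

lemma trigFun_even (m : ℕ) (t : ℝ) :
    trigFun (2 * m + 2) t = Real.sqrt 2 * Real.sin (2 * Real.pi * ((m : ℝ) + 1) * t) := by
  simp [trigFun, freq_even]

lemma expFun_pos (m : ℕ) (t : ℝ) :
    expFun ((m : ℤ) + 1) t =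
      (trigFun (2 * m + 1) t + Complex.I * trigFun (2 * m + 2) t) / (Real.sqrt 2 : ℂ) := by
  rw [expFun_eq, trigFun_odd, trigFun_even]
  have h2 := sqrt_two_ne_zero
  push_cast
  field_simp

lemma expFun_neg (m : ℕ) (t : ℝ) :
    expFun (-((m : ℤ) + 1)) t =
      (trigFun (2 * m + 1) t - Complex.I * trigFun (2 * m + 2) t) / (Real.sqrt 2 : ℂ) := by
  rw [expFun_eq, trigFun_odd, trigFun_even]
  have h2 := sqrt_two_ne_zero
  have e : (2 * Real.pi * ((-((m : ℤ) + 1) : ℤ) : ℝ) * t) = -(2 * Real.pi * ((m : ℝ) + 1) * t) := by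
    push_cast; ring
  rw [e, Real.cos_neg, Real.sin_neg]
  push_cast
  field_simp
  ring

lemma expFun_zero (t : ℝ) : expFun 0 t = 1 := by simp [expFun]

/-- Synthesis from the coefficients with respect to the exponentials agrees with synthesis from
the real coordinates. -/
lemma sum_ftrans_mul_expFun (v : ℕ → ℂ) (m : ℕ) (t : ℝ) :
    ∑ j ∈ Finset.Icc (-(m : ℤ)) (m : ℤ), ftrans v j * expFun j t =
      ∑ l ∈ Finset.range (2 * m + 1), v l * (trigFun l t : ℂ) := by
  induction m with
  | zero => simp [ftrans_zero, expFun_zero, trigFun_zero]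
  | succ m ih =>
    rw [sum_Icc_neg_succ, ih, show 2 * (m + 1) + 1 = (2 * m + 1) + 1 + 1 by ring,
      Finset.sum_range_succ _ (2 * m + 1 + 1), Finset.sum_range_succ _ (2 * m + 1), add_assoc]
    congr 1
    rw [ftrans_pos, ftrans_neg, expFun_pos, expFun_neg]
    have h2 := sqrt_two_ne_zero
    have h3 := sqrt_two_mul_self
    field_simp
    rw [pow_two, h3]
    linear_combination (-2 * (v (2 * m + 1 + 1) * (trigFun (2 * m + 1 + 1) t : ℂ))) *
      Complex.I_mul_I

lemma coord_eq_integral (f : L2) (l : ℕ) :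
    coord f l = ∫ t in Set.Icc (0 : ℝ) 1, f t * trigFun l t := by
  rw [coord, MeasureTheory.L2.inner_def]
  refine integral_congr_ae ?_
  filter_upwards [(memLp_trigFun l).coeFn_toLp] with t ht
  rw [ψ, ht]
  simp [mul_comm]

lemma memLp_coe (f : L2) : MemLp (fun t => f t) 2 (volume.restrict (Set.Icc (0 : ℝ) 1)) :=
  Lp.memLp f

lemma integrable_coe_mul_trigFun (f : L2) (l : ℕ) :
    Integrable (fun t => f t * trigFun l t) (volume.restrict (Set.Icc (0 : ℝ) 1)) :=
  MemLp.integrable_mul (memLp_coe f) (memLp_trigFun l)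

lemma integral_ofReal_mul_trigFun (f : L2) (l : ℕ) :
    ∫ t in Set.Icc (0 : ℝ) 1, (f t : ℂ) * (trigFun l t : ℂ) = (coord f l : ℂ) := by
  rw [coord_eq_integral, ← integral_complex_ofReal]
  simp

lemma integrable_ofReal_mul_trigFun (f : L2) (l : ℕ) :
    Integrable (fun t => (f t : ℂ) * (trigFun l t : ℂ))
      (volume.restrict (Set.Icc (0 : ℝ) 1)) := by
  simpa using (integrable_coe_mul_trigFun f l).ofReal (𝕜 := ℂ)

lemma int_cases_pos_neg (j : ℤ) :
    j = 0 ∨ (∃ m : ℕ, j = (m : ℤ) + 1) ∨ ∃ m : ℕ, j = -((m : ℤ) + 1) := by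
  rcases lt_trichotomy j 0 with h | h | h
  · exact Or.inr (Or.inr ⟨(-j - 1).toNat, by omega⟩)
  · exact Or.inl h
  · exact Or.inr (Or.inl ⟨(j - 1).toNat, by omega⟩)

lemma fourierCoord_eq_ftrans (x : L2) (j : ℤ) :
    fourierCoord x j = ftrans (fun l => (coord x l : ℂ)) j := by
  have key : ∀ (m : ℕ) (c : ℂ), ∫ t in Set.Icc (0 : ℝ) 1,
      (x t : ℂ) * (((trigFun (2 * m + 1) t : ℂ) + c * trigFun (2 * m + 2) t) / (Real.sqrt 2 : ℂ)) =
      (coord x (2 * m + 1) + c * coord x (2 * m + 2)) / (Real.sqrt 2 : ℂ) := by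
    intro m c
    rw [← integral_ofReal_mul_trigFun, ← integral_ofReal_mul_trigFun, ← integral_const_mul,
      ← integral_add (integrable_ofReal_mul_trigFun _ _)
        ((integrable_ofReal_mul_trigFun _ _).const_mul _), ← integral_div]
    refine integral_congr_ae (Eventually.of_forall fun t => ?_)
    simp only
    ring
  rcases int_cases_pos_neg j with rfl | ⟨m, rfl⟩ | ⟨m, rfl⟩
  · rw [ftrans_zero, fourierCoord, ← integral_ofReal_mul_trigFun]
    simp [expFun_zero, trigFun_zero]
  · rw [ftrans_pos, fourierCoord]
    simp_rw [expFun_neg]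
    have := key m (-Complex.I)
    simpa [sub_eq_add_neg] using this
  · rw [ftrans_neg, fourierCoord, neg_neg]
    simp_rw [expFun_pos]
    exact key m Complex.I

lemma fourierCoeffOn_eq_fourierCoord (x : L2) (j : ℤ) :
    fourierCoeffOn (zero_lt_one' ℝ) (fun t => (x t : ℂ)) j = fourierCoord x j := by
  rw [fourierCoeffOn_eq_integral, fourierCoord, intervalIntegral.integral_of_le zero_le_one,
    ← integral_Icc_eq_integral_Ioc]
  simp only [sub_zero, div_one, one_smul]
  refine integral_congr_ae (Eventually.of_forall fun t => ?_)
  simp only [smul_eq_mul, fourier_coe_apply, expFun]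
  rw [mul_comm]
  congr 2
  push_cast
  ring_nf

lemma norm_sq_eq_integral (x : L2) :
    ‖x‖ ^ 2 = ∫ t in Set.Icc (0 : ℝ) 1, x t ^ 2 := by
  rw [← real_inner_self_eq_norm_sq, MeasureTheory.L2.inner_def]
  refine integral_congr_ae (Eventually.of_forall fun t => ?_)
  simp [pow_two]

lemma hasSum_normSq_fourierCoord (x : L2) :
    HasSum (fun j : ℤ => ‖fourierCoord x j‖ ^ 2) (‖x‖ ^ 2) := by
  have hL2 : MemLp (fun t => (x t : ℂ)) 2 (volume.restrict (Set.Ioc (0 : ℝ) 1)) :=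
    ((memLp_coe x).ofReal (K := ℂ)).mono_measure
      (Measure.restrict_mono Set.Ioc_subset_Icc_self le_rfl)
  have h := hasSum_sq_fourierCoeffOn (zero_lt_one' ℝ) hL2
  simp_rw [fourierCoeffOn_eq_fourierCoord] at h
  convert h using 1
  rw [norm_sq_eq_integral, intervalIntegral.integral_of_le zero_le_one,
    ← integral_Icc_eq_integral_Ioc]
  simp

lemma sum_normSq_ftrans (v : ℕ → ℂ) (m : ℕ) :
    ∑ j ∈ Finset.Icc (-(m : ℤ)) (m : ℤ), ‖ftrans v j‖ ^ 2 =
      ∑ l ∈ Finset.range (2 * m + 1), ‖v l‖ ^ 2 := by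
  have h := sum_conj_ftrans_mul v v m
  simp_rw [Complex.conj_mul'] at h
  exact_mod_cast h

/-- Parseval for complex Fourier series, summed over symmetric frequency ranges, gives the partial
sums of odd length by unitarity. The terms are nonnegative, so this subsequence determines the whole
series. -/
lemma hasSum_coord_sq (x : L2) : HasSum (fun l => coord x l ^ 2) (‖x‖ ^ 2) := by
  have h := hasSum_normSq_fourierCoord x
  have hIcc : Tendsto (fun m : ℕ => Finset.Icc (-(m : ℤ)) (m : ℤ)) atTop atTop := by
    refine tendsto_atTop_finset_of_monotone (fun a b hab => ?_) (fun j => ⟨j.natAbs, ?_⟩)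
    · exact Finset.Icc_subset_Icc (by omega) (by omega)
    · simp only [Finset.mem_Icc]; omega
  have h1 := h.comp hIcc
  have h2 : ∀ m : ℕ, ∑ j ∈ Finset.Icc (-(m : ℤ)) (m : ℤ), ‖fourierCoord x j‖ ^ 2 =
      ∑ l ∈ Finset.range (2 * m + 1), coord x l ^ 2 := by
    intro m
    simp_rw [fourierCoord_eq_ftrans]
    rw [sum_normSq_ftrans]
    simp
  have h3 : Tendsto (fun m : ℕ => ∑ l ∈ Finset.range (2 * m + 1), coord x l ^ 2) atTop
      (nhds (‖x‖ ^ 2)) := by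
    refine h1.congr fun m => ?_
    exact h2 m
  have hs : Summable (fun l => coord x l ^ 2) := by
    refine summable_of_sum_range_le (c := ‖x‖ ^ 2) (fun _ => sq_nonneg _) fun n => ?_
    calc ∑ l ∈ Finset.range n, coord x l ^ 2
        ≤ ∑ l ∈ Finset.range (2 * n + 1), coord x l ^ 2 :=
          Finset.sum_le_sum_of_subset_of_nonneg
            (Finset.range_subset_range.2 (by omega)) fun _ _ _ => sq_nonneg _
      _ ≤ ‖x‖ ^ 2 := by rw [← h2]; exact sum_le_hasSum _ (fun _ _ => sq_nonneg _) h
  have h4 := hs.hasSum.tendsto_sum_nat.comp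
    (tendsto_atTop_mono (fun m : ℕ => (by omega : m ≤ 2 * m + 1)) tendsto_id)
  rw [← tendsto_nhds_unique h4 h3]
  exact hs.hasSum

/-! ### Orthonormality and completeness of the real trigonometric system. -/

lemma integral_cos_sq_freq (m : ℕ) :
    ∫ t in (0 : ℝ)..1, Real.cos (2 * Real.pi * ((m : ℝ) + 1) * t) ^ 2 = 1 / 2 := by
  have hc : (2 * Real.pi * ((m : ℝ) + 1)) ≠ 0 := by positivity
  rw [intervalIntegral.integral_comp_mul_left (fun u => Real.cos u ^ 2) hc, integral_cos_sq]
  have hs : Real.sin (2 * Real.pi * ((m : ℝ) + 1)) = 0 := by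
    have := Real.sin_nat_mul_pi (2 * (m + 1))
    rw [← this]; push_cast; ring_nf
  simp only [mul_zero, mul_one, hs, Real.sin_zero, smul_eq_mul]
  field_simp
  simp

lemma integral_sin_sq_freq (m : ℕ) :
    ∫ t in (0 : ℝ)..1, Real.sin (2 * Real.pi * ((m : ℝ) + 1) * t) ^ 2 = 1 / 2 := by
  have h : ∀ t : ℝ, Real.sin (2 * Real.pi * ((m : ℝ) + 1) * t) ^ 2 =
      1 - Real.cos (2 * Real.pi * ((m : ℝ) + 1) * t) ^ 2 := fun t => Real.sin_sq _
  simp_rw [h]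
  rw [intervalIntegral.integral_sub (by simp)
    (Continuous.intervalIntegrable (by fun_prop) _ _), integral_cos_sq_freq]
  norm_num

lemma integral_trigFun_sq (l : ℕ) : ∫ t in (0 : ℝ)..1, trigFun l t ^ 2 = 1 := by
  have h2 : (Real.sqrt 2) ^ 2 = 2 := Real.sq_sqrt (by norm_num)
  rcases l.eq_zero_or_pos with rfl | hl
  · simp [trigFun_zero]
  · rcases Nat.even_or_odd' l with ⟨m, rfl | rfl⟩
    · obtain ⟨m, rfl⟩ : ∃ k, m = k + 1 := ⟨m - 1, by omega⟩
      simp_rw [show 2 * (m + 1) = 2 * m + 2 by ring, trigFun_even, mul_pow, h2]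
      rw [intervalIntegral.integral_const_mul, integral_sin_sq_freq]; norm_num
    · simp_rw [trigFun_odd, mul_pow, h2]
      rw [intervalIntegral.integral_const_mul, integral_cos_sq_freq]; norm_num

lemma norm_ψ_sq (l : ℕ) : ‖ψ l‖ ^ 2 = 1 := by
  have h := integral_trigFun_sq l
  rw [intervalIntegral.integral_of_le zero_le_one, ← integral_Icc_eq_integral_Ioc] at h
  rw [norm_sq_eq_integral]
  refine (integral_congr_ae ?_).trans h
  filter_upwards [(memLp_trigFun l).coeFn_toLp] with t ht
  rw [ψ, ht]

/-- Only the norms have to be computed. Parseval applied to ψ_i has total 1, and the term of index i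
already equals 1, so all other inner products vanish. -/
lemma orthonormal_ψ : Orthonormal ℝ ψ := by
  rw [orthonormal_iff_ite]
  intro i j
  have h1 : ∀ l, inner ℝ (ψ l) (ψ l) = (1 : ℝ) := fun l => by
    rw [real_inner_self_eq_norm_sq, norm_ψ_sq]
  split_ifs with hij
  · rw [hij, h1]
  · have h := hasSum_coord_sq (ψ i)
    have h2 := sum_le_hasSum {i, j} (fun _ _ => sq_nonneg _) h
    rw [Finset.sum_pair hij, norm_ψ_sq] at h2
    simp only [coord, h1] at h2
    nlinarith [sq_nonneg (inner ℝ (ψ i) (ψ j) : ℝ)]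

/-- The trigonometric basis as a Hilbert basis. -/
def trigBasis : HilbertBasis ℕ ℝ L2 :=
  HilbertBasis.mkOfOrthogonalEqBot orthonormal_ψ (by
    rw [Submodule.eq_bot_iff]
    intro x hx
    have h0 : ∀ l, coord x l = 0 := fun l => by
      rw [coord, real_inner_comm]
      exact hx _ (Submodule.subset_span ⟨l, rfl⟩)
    have h := hasSum_coord_sq x
    simp only [h0] at h
    have h' : ‖x‖ ^ 2 = 0 :=
      h.unique (by simp)
    simpa using h')

lemma trigBasis_apply (l : ℕ) : trigBasis l = ψ l := by
  rw [trigBasis, HilbertBasis.coe_mkOfOrthogonalEqBot]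

lemma hasSum_coord_mul (x y : L2) : HasSum (fun l => coord x l * coord y l) (inner ℝ x y) := by
  have h := trigBasis.hasSum_inner_mul_inner x y
  simp_rw [trigBasis_apply] at h
  simpa [coord, real_inner_comm] using h

/-- Riesz–Fischer; it produces the weak derivative from its formal coordinates. -/
lemma exists_coord_eq {w : ℕ → ℝ} (hw : Summable fun l => w l ^ 2) :
    ∃ g : L2, ∀ l, coord g l = w l := by
  have hm : Memℓp w 2 := memℓp_gen (by simpa using hw)
  refine ⟨trigBasis.repr.symm ⟨w, hm⟩, fun l => ?_⟩
  have := trigBasis.repr_apply_apply (trigBasis.repr.symm ⟨w, hm⟩) l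
  rw [trigBasis_apply] at this
  rw [coord, real_inner_comm, ← this]
  simp

lemma coord_sub (x y : L2) (l : ℕ) : coord (x - y) l = coord x l - coord y l :=
  inner_sub_left _ _ _

lemma coord_smul (c : ℝ) (x : L2) (l : ℕ) : coord (c • x) l = c * coord x l :=
  real_inner_smul_left _ _ _

lemma coord_sum {ι : Type*} (s : Finset ι) (f : ι → L2) (l : ℕ) :
    coord (∑ i ∈ s, f i) l = ∑ i ∈ s, coord (f i) l :=
  sum_inner _ _ _

lemma coord_ψ (i l : ℕ) : coord (ψ i) l = if i = l then 1 else 0 :=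
  orthonormal_iff_ite.1 orthonormal_ψ i l

lemma continuous_coord (l : ℕ) : Continuous fun x : L2 => coord x l := by
  unfold coord
  fun_prop

lemma measurable_coord (l : ℕ) : Measurable fun x : L2 => coord x l :=
  (continuous_coord l).measurable

/-! ### Differentiation in the trigonometric basis -/

/-- The index of the trigonometric function to which `ψ_l'` is proportional. -/
def conjIdx (l : ℕ) : ℕ := if l = 0 then 0 else if l % 2 = 1 then l + 1 else l - 1

/-- The factor with which the coordinate `conjIdx l` enters the `l`-th coordinate of the
derivative. -/
def derivFactor (l : ℕ) : ℝ :=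
  if l % 2 = 1 then 2 * Real.pi * (freq l : ℝ) else -(2 * Real.pi * (freq l : ℝ))

/-- Differentiation on coordinate sequences with respect to the trigonometric basis. -/
def trigDeriv (v : ℕ → ℝ) (l : ℕ) : ℝ := derivFactor l * v (conjIdx l)

lemma conjIdx_odd (m : ℕ) : conjIdx (2 * m + 1) = 2 * m + 2 := by
  unfold conjIdx; split_ifs <;> omega

lemma conjIdx_even (m : ℕ) : conjIdx (2 * m + 2) = 2 * m + 1 := by
  unfold conjIdx; split_ifs <;> omega

lemma nat_cases_trig (l : ℕ) : l = 0 ∨ (∃ m, l = 2 * m + 1) ∨ ∃ m, l = 2 * m + 2 := by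
  rcases l.eq_zero_or_pos with h | h
  · exact Or.inl h
  · rcases Nat.even_or_odd' l with ⟨m, hm | hm⟩
    · exact Or.inr (Or.inr ⟨m - 1, by omega⟩)
    · exact Or.inr (Or.inl ⟨m, hm⟩)

lemma conjIdx_involutive : Function.Involutive conjIdx := by
  intro l
  rcases nat_cases_trig l with rfl | ⟨m, rfl⟩ | ⟨m, rfl⟩
  · rfl
  · rw [conjIdx_odd, conjIdx_even]
  · rw [conjIdx_even, conjIdx_odd]

lemma derivFactor_zero : derivFactor 0 = 0 := by simp [derivFactor, freq]

lemma derivFactor_odd (m : ℕ) : derivFactor (2 * m + 1) = 2 * Real.pi * ((m : ℝ) + 1) := by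
  simp [derivFactor, freq_odd, Nat.add_mod]

lemma derivFactor_even (m : ℕ) : derivFactor (2 * m + 2) = -(2 * Real.pi * ((m : ℝ) + 1)) := by
  simp [derivFactor, freq_even]

lemma derivFactor_conjIdx (l : ℕ) : derivFactor (conjIdx l) = -derivFactor l := by
  rcases nat_cases_trig l with rfl | ⟨m, rfl⟩ | ⟨m, rfl⟩
  · simp [conjIdx, derivFactor_zero]
  · rw [conjIdx_odd, derivFactor_even, derivFactor_odd]
  · rw [conjIdx_even, derivFactor_even, derivFactor_odd, neg_neg]

lemma derivFactor_sq (l : ℕ) : derivFactor l ^ 2 = (2 * Real.pi * (freq l : ℝ)) ^ 2 := by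
  unfold derivFactor; split_ifs <;> ring

lemma conjIdx_lt_iff (l m : ℕ) : conjIdx l < 2 * m + 1 ↔ l < 2 * m + 1 := by
  rcases nat_cases_trig l with rfl | ⟨k, rfl⟩ | ⟨k, rfl⟩
  · rfl
  · rw [conjIdx_odd]; omega
  · rw [conjIdx_even]; omega

/-- The sign is opposite to that in `trigDeriv`, because differentiation is skew-adjoint: a factor
moving onto the coordinates changes sign. -/
lemma hasDerivAt_trigFun (l : ℕ) (t : ℝ) :
    HasDerivAt (trigFun l) (-derivFactor l * trigFun (conjIdx l) t) t := by
  rcases nat_cases_trig l with rfl | ⟨m, rfl⟩ | ⟨m, rfl⟩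
  · rw [derivFactor_zero, neg_zero, zero_mul]
    have : trigFun 0 = fun _ => (1 : ℝ) := funext trigFun_zero
    rw [this]
    exact hasDerivAt_const _ _
  · have h : trigFun (2 * m + 1) =
        fun t => Real.sqrt 2 * Real.cos (2 * Real.pi * ((m : ℝ) + 1) * t) :=
      funext (trigFun_odd m)
    rw [h, conjIdx_odd, trigFun_even, derivFactor_odd]
    have h1 := ((((hasDerivAt_id t).const_mul (2 * Real.pi * ((m : ℝ) + 1))).cos).const_mul
      (Real.sqrt 2))
    simp only [id, mul_one] at h1
    refine h1.congr_deriv ?_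
    ring
  · have h : trigFun (2 * m + 2) =
        fun t => Real.sqrt 2 * Real.sin (2 * Real.pi * ((m : ℝ) + 1) * t) :=
      funext (trigFun_even m)
    rw [h, conjIdx_even, trigFun_odd, derivFactor_even]
    have h1 := ((((hasDerivAt_id t).const_mul (2 * Real.pi * ((m : ℝ) + 1))).sin).const_mul
      (Real.sqrt 2))
    simp only [id, mul_one] at h1
    refine h1.congr_deriv ?_
    ring

lemma memLp_of_hasCompactSupport {φ : ℝ → ℝ} (hφ : Continuous φ) (hc : HasCompactSupport φ) :
    MemLp φ 2 (volume.restrict (Set.Icc (0 : ℝ) 1)) :=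
  (hφ.memLp_of_hasCompactSupport hc).restrict _

lemma inner_toLp (f : L2) {φ : ℝ → ℝ} (hφ : MemLp φ 2 (volume.restrict (Set.Icc (0 : ℝ) 1))) :
    inner ℝ f (hφ.toLp φ) = ∫ t in Set.Icc (0 : ℝ) 1, f t * φ t := by
  rw [MeasureTheory.L2.inner_def]
  refine integral_congr_ae ?_
  filter_upwards [hφ.coeFn_toLp] with t ht
  rw [ht]
  simp [mul_comm]

lemma coord_toLp {φ : ℝ → ℝ} (hφ : MemLp φ 2 (volume.restrict (Set.Icc (0 : ℝ) 1))) (l : ℕ) :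
    coord (hφ.toLp φ) l = ∫ t in (0 : ℝ)..1, trigFun l t * φ t := by
  rw [coord_eq_integral, intervalIntegral.integral_of_le zero_le_one,
    ← integral_Icc_eq_integral_Ioc]
  refine integral_congr_ae ?_
  filter_upwards [hφ.coeFn_toLp] with t ht
  rw [ht, mul_comm]

/-- Integration by parts against ψ_l. The boundary terms vanish because the support of φ lies in the
open interval, so periodicity plays no role. -/
lemma coord_deriv {φ : ℝ → ℝ} (hφ : ContDiff ℝ (⊤ : ℕ∞) φ) (hs : tsupport φ ⊆ Set.Ioo 0 1)
    (h0 : MemLp φ 2 (volume.restrict (Set.Icc (0 : ℝ) 1)))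
    (h1 : MemLp (deriv φ) 2 (volume.restrict (Set.Icc (0 : ℝ) 1))) (l : ℕ) :
    coord (h1.toLp (deriv φ)) l = trigDeriv (coord (h0.toLp φ)) l := by
  have hd : Differentiable ℝ φ := hφ.differentiable (by simp)
  have hc' : Continuous (deriv φ) := hφ.continuous_deriv (by exact_mod_cast le_top)
  have z0 : φ 0 = 0 := by
    by_contra h
    have := hs (subset_tsupport φ h)
    simp at this
  have z1 : φ 1 = 0 := by
    by_contra h
    have := hs (subset_tsupport φ h)
    simp at this
  rw [trigDeriv, coord_toLp, coord_toLp,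
    intervalIntegral.integral_mul_deriv_eq_deriv_mul (u := trigFun l) (v := φ)
      (u' := fun t => -derivFactor l * trigFun (conjIdx l) t) (v' := deriv φ)
      (fun t _ => hasDerivAt_trigFun l t) (fun t _ => (hd t).hasDerivAt)
      (Continuous.intervalIntegrable (continuous_const.mul (continuous_trigFun _)) _ _)
      (hc'.intervalIntegrable _ _), z0, z1]
  simp_rw [mul_assoc]
  rw [intervalIntegral.integral_const_mul]
  ring

/-- Skew-adjointness is a reindexing by the involution `conjIdx`, under which the factor changes
sign. Reindexing preserves `tsum` even for divergent series, so no summability is needed. -/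
lemma tsum_mul_trigDeriv (v w : ℕ → ℝ) :
    ∑' l, v l * trigDeriv w l = -∑' l, trigDeriv v l * w l := by
  rw [← tsum_neg, ← (conjIdx_involutive.toPerm).tsum_eq (fun l => v l * trigDeriv w l)]
  refine tsum_congr fun l => ?_
  simp only [Function.Involutive.coe_toPerm, trigDeriv, conjIdx_involutive l, derivFactor_conjIdx]
  ring

lemma integral_mul_deriv_eq_neg {g g' : L2} (hg : ∀ l, coord g' l = trigDeriv (coord g) l)
    {φ : ℝ → ℝ} (hφ : ContDiff ℝ (⊤ : ℕ∞) φ) (hc : HasCompactSupport φ)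
    (hs : tsupport φ ⊆ Set.Ioo 0 1) :
    ∫ t in Set.Icc (0 : ℝ) 1, g t * deriv φ t = -∫ t in Set.Icc (0 : ℝ) 1, g' t * φ t := by
  have h0 := memLp_of_hasCompactSupport hφ.continuous hc
  have h1 := memLp_of_hasCompactSupport (hφ.continuous_deriv (by exact_mod_cast le_top)) hc.deriv
  rw [← inner_toLp g h1, ← inner_toLp g' h0, ← (hasSum_coord_mul _ _).tsum_eq,
    ← (hasSum_coord_mul _ _).tsum_eq]
  simp_rw [coord_deriv hφ hs h0 h1, hg]
  exact tsum_mul_trigDeriv _ _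

lemma isWeakDeriv_zero (f : L2) : IsWeakDeriv 0 f f := by
  intro φ _ _ _
  simp

/-- The derivative of a test function is again a test function, so the s-th order identity applies
to it and one integration by parts remains. -/
lemma IsWeakDeriv.succ {s : ℕ} {f g g' : L2} (h : IsWeakDeriv s f g)
    (hg : ∀ l, coord g' l = trigDeriv (coord g) l) : IsWeakDeriv (s + 1) f g' := by
  intro φ hφ hc hs
  have hφ' : ContDiff ℝ (⊤ : ℕ∞) (deriv φ) := (contDiff_infty_iff_deriv.1 hφ).2
  rw [iteratedDeriv_succ', h (deriv φ) hφ' hc.deriv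
    ((tsupport_deriv_subset).trans hs), integral_mul_deriv_eq_neg hg hφ hc hs, pow_succ]
  ring

lemma iterate_trigDeriv_sq (v : ℕ → ℝ) (s l : ℕ) :
    (trigDeriv^[s] v) l ^ 2 = (derivFactor l ^ 2) ^ s * v (conjIdx^[s] l) ^ 2 := by
  induction s generalizing v with
  | zero => simp
  | succ s ih =>
    rw [Function.iterate_succ_apply, ih, Function.iterate_succ_apply', trigDeriv]
    have : derivFactor (conjIdx^[s] l) ^ 2 = derivFactor l ^ 2 := by
      clear ih
      induction s with
      | zero => rfl
      | succ s ih => rw [Function.iterate_succ_apply', derivFactor_conjIdx, neg_sq, ih]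
    rw [mul_pow, this]
    ring

/-- The `s`-th iterate of `conjIdx` as a permutation. -/
def conjPerm (s : ℕ) : Equiv.Perm ℕ := conjIdx_involutive.toPerm ^ s

lemma conjPerm_apply (s l : ℕ) : conjPerm s l = conjIdx^[s] l := by
  rw [conjPerm, ← Equiv.Perm.iterate_eq_pow]
  rfl

lemma derivFactor_sq_conjPerm (s l : ℕ) :
    derivFactor (conjPerm s l) ^ 2 = derivFactor l ^ 2 := by
  rw [conjPerm_apply]
  induction s with
  | zero => rfl
  | succ s ih => rw [Function.iterate_succ_apply', derivFactor_conjIdx, neg_sq, ih]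

/-- Writes the squares as one sequence precomposed with a permutation, so that sums over l lose the
index swap. -/
lemma iterate_trigDeriv_sq' (v : ℕ → ℝ) (s l : ℕ) :
    (trigDeriv^[s] v) l ^ 2 =
      (fun l => (derivFactor l ^ 2) ^ s * v l ^ 2) (conjPerm s l) := by
  simp only [derivFactor_sq_conjPerm]
  rw [conjPerm_apply, iterate_trigDeriv_sq]

lemma summable_iterate_trigDeriv_sq {v : ℕ → ℝ} {s : ℕ}
    (h : Summable fun l => (derivFactor l ^ 2) ^ s * v l ^ 2) :
    Summable fun l => (trigDeriv^[s] v) l ^ 2 := by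
  simp_rw [iterate_trigDeriv_sq']
  exact h.comp_injective (conjPerm s).injective

lemma tsum_iterate_trigDeriv_sq (v : ℕ → ℝ) (s : ℕ) :
    ∑' l, (trigDeriv^[s] v) l ^ 2 = ∑' l, (derivFactor l ^ 2) ^ s * v l ^ 2 := by
  simp_rw [iterate_trigDeriv_sq']
  exact (conjPerm s).tsum_eq fun l => (derivFactor l ^ 2) ^ s * v l ^ 2

/-- A function whose coordinates decay fast enough has a weak derivative, with the coordinates
obtained by formal differentiation. -/
lemma exists_isWeakDeriv {f : L2} {s : ℕ}
    (h : ∀ i ≤ s, Summable fun l => (derivFactor l ^ 2) ^ i * coord f l ^ 2) :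
    ∃ g : L2, IsWeakDeriv s f g ∧ ∀ l, coord g l = (trigDeriv^[s] (coord f)) l := by
  induction s with
  | zero => exact ⟨f, isWeakDeriv_zero f, fun l => rfl⟩
  | succ s ih =>
    obtain ⟨g, hg, hc⟩ := ih fun i hi => h i (by omega)
    obtain ⟨g', hg'⟩ := exists_coord_eq (summable_iterate_trigDeriv_sq (h (s + 1) le_rfl))
    refine ⟨g', hg.succ fun l => ?_, hg'⟩
    rw [hg', Function.iterate_succ_apply']
    simp only [trigDeriv, hc]

/-- The exponentials diagonalize differentiation; this identifies the multipliers in the estimator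
with iterates of `trigDeriv`. -/
lemma ftrans_trigDeriv (v : ℕ → ℝ) (j : ℤ) :
    ftrans (fun l => ((trigDeriv v l : ℝ) : ℂ)) j =
      (2 * Complex.I * Real.pi * (j : ℂ)) * ftrans (fun l => (v l : ℂ)) j := by
  rcases int_cases_pos_neg j with rfl | ⟨m, rfl⟩ | ⟨m, rfl⟩
  · simp [ftrans_zero, trigDeriv, derivFactor_zero]
  · simp only [ftrans_pos, trigDeriv, derivFactor_odd, derivFactor_even, conjIdx_odd, conjIdx_even]
    push_cast
    have h2 := sqrt_two_ne_zero
    field_simp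
    linear_combination ((v (2 * m + 2) : ℂ)) * Complex.I_mul_I
  · simp only [ftrans_neg, trigDeriv, derivFactor_odd, derivFactor_even, conjIdx_odd, conjIdx_even]
    push_cast
    have h2 := sqrt_two_ne_zero
    field_simp
    linear_combination ((v (2 * m + 2) : ℂ)) * Complex.I_mul_I

lemma ftrans_iterate_trigDeriv (v : ℕ → ℝ) (s : ℕ) (j : ℤ) :
    ftrans (fun l => (((trigDeriv^[s] v) l : ℝ) : ℂ)) j =
      (2 * Complex.I * Real.pi * (j : ℂ)) ^ s * ftrans (fun l => (v l : ℂ)) j := by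
  induction s with
  | zero => simp
  | succ s ih =>
    simp_rw [Function.iterate_succ_apply']
    rw [ftrans_trigDeriv, ih, pow_succ]
    ring

lemma lintegral_enorm_sq_coe (f : L2) :
    ∫⁻ t in Set.Icc (0 : ℝ) 1, ‖((f t : ℝ) : ℂ)‖ₑ ^ 2 = ENNReal.ofReal (‖f‖ ^ 2) := by
  rw [norm_sq_eq_integral, ofReal_integral_eq_lintegral_ofReal (memLp_coe f).integrable_sq
    (Eventually.of_forall fun _ => sq_nonneg _)]
  refine lintegral_congr fun t => ?_
  rw [← ofReal_norm, ← ENNReal.ofReal_pow (norm_nonneg _)]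
  simp

/-- The squared `L²`-distance of a differentiated trigonometric polynomial to a function, in
coordinates. -/
lemma lintegral_sum_sub_sq {β g : L2} {s m : ℕ} (u : ℕ → ℝ) (hu : ∀ l, 2 * m + 1 ≤ l → u l = 0)
    (hg : ∀ l, coord g l = (trigDeriv^[s] (coord β)) l) :
    ∫⁻ t in Set.Icc (0 : ℝ) 1, ‖(∑ j ∈ Finset.Icc (-(m : ℤ)) (m : ℤ),
        (2 * Complex.I * Real.pi * (j : ℂ)) ^ s * ftrans (fun l => (u l : ℂ)) j * expFun j t)
        - ((g t : ℝ) : ℂ)‖ₑ ^ 2 =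
      ENNReal.ofReal (∑' l, (derivFactor l ^ 2) ^ s * (u l - coord β l) ^ 2) := by
  set G : L2 := ∑ l ∈ Finset.range (2 * m + 1), (trigDeriv^[s] u) l • ψ l with hG
  have hG0 : ∀ l, coord G l = (trigDeriv^[s] u) l := by
    intro l
    rw [hG, coord_sum]
    simp_rw [coord_smul, coord_ψ]
    by_cases hl : l < 2 * m + 1
    · simp [hl]
    · have hz : (trigDeriv^[s] u) l ^ 2 = 0 := by
        rw [iterate_trigDeriv_sq', conjPerm_apply]
        -- The range of indices below 2m+1 contains cosine and sine of each of its frequencies, so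
        -- it is stable under `conjIdx`.
        have : ∀ i, 2 * m + 1 ≤ conjIdx^[i] l := by
          intro i
          induction i with
          | zero => exact not_lt.1 hl
          | succ i ih =>
            rw [Function.iterate_succ_apply']
            exact not_lt.1 fun h => absurd ((conjIdx_lt_iff _ _).1 h) (not_lt.2 ih)
        simp [hu _ (this s)]
      rw [pow_eq_zero_iff two_ne_zero] at hz
      simp [hl, hz]
  have hlin : ∀ l, (trigDeriv^[s] (fun l => u l - coord β l)) l =
      (trigDeriv^[s] u) l - (trigDeriv^[s] (coord β)) l := by
    have : ∀ (i : ℕ) (v w : ℕ → ℝ) (l : ℕ), (trigDeriv^[i] (fun l => v l - w l)) l =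
        (trigDeriv^[i] v) l - (trigDeriv^[i] w) l := by
      intro i
      induction i with
      | zero => intro v w l; rfl
      | succ i ih =>
        intro v w l
        simp only [Function.iterate_succ_apply', trigDeriv, ih]
        ring
    exact this s u _
  have hn : ‖G - g‖ ^ 2 = ∑' l, (derivFactor l ^ 2) ^ s * (u l - coord β l) ^ 2 := by
    rw [← tsum_iterate_trigDeriv_sq (fun l => u l - coord β l), ← (hasSum_coord_sq _).tsum_eq]
    refine tsum_congr fun l => ?_
    rw [hlin, coord_sub, hG0, hg]
  rw [← hn, ← lintegral_enorm_sq_coe]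
  refine lintegral_congr_ae ?_
  have h1 : ∀ᵐ t ∂(volume.restrict (Set.Icc (0 : ℝ) 1)), ∀ l, ψ l t = trigFun l t :=
    ae_all_iff.2 fun l => (memLp_trigFun l).coeFn_toLp
  have h2 : ∀ᵐ t ∂(volume.restrict (Set.Icc (0 : ℝ) 1)),
      G t = ∑ l ∈ Finset.range (2 * m + 1), ((trigDeriv^[s] u) l • ψ l : L2) t := by
    rw [hG]
    filter_upwards [Lp.coeFn_finsetSum (Finset.range (2 * m + 1))
      fun l => (trigDeriv^[s] u) l • ψ l] with t ht
    rw [ht]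
    simp
  have h3 : ∀ᵐ t ∂(volume.restrict (Set.Icc (0 : ℝ) 1)), ∀ l,
      ((trigDeriv^[s] u) l • ψ l : L2) t = (trigDeriv^[s] u) l * ψ l t :=
    ae_all_iff.2 fun l => Lp.coeFn_smul _ _
  filter_upwards [h1, h2, h3, Lp.coeFn_sub G g] with t h1 h2 h3 h4
  rw [h4, Pi.sub_apply, h2]
  simp_rw [← ftrans_iterate_trigDeriv]
  rw [sum_ftrans_mul_expFun]
  simp_rw [h3, h1]
  push_cast
  rfl

/-! ### Comparison of positive operators -/

section Operators

variable {E : Type*} [NormedAddCommGroup E] [InnerProductSpace ℝ E]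

/-- Cauchy–Schwarz for a positive symmetric operator. -/
lemma norm_sq_le_of_nonneg {C : E →L[ℝ] E} {K : ℝ} (hK : 0 < K) (hCK : ‖C‖ ≤ K)
    (hs : ∀ x y, inner ℝ (C x) y = inner ℝ x (C y)) (h0 : ∀ x, 0 ≤ inner ℝ (C x) x) (x : E) :
    ‖C x‖ ^ 2 ≤ K * inner ℝ (C x) x := by
  -- The inequality is positivity of C at this vector, combined with ⟨C Cx, Cx⟩ ≤ K‖Cx‖².
  have h1 := h0 (x - K⁻¹ • C x)
  have h2 : inner ℝ (C (C x)) (C x) ≤ K * ‖C x‖ ^ 2 := by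
    calc inner ℝ (C (C x)) (C x) ≤ ‖C (C x)‖ * ‖C x‖ := real_inner_le_norm _ _
      _ ≤ (K * ‖C x‖) * ‖C x‖ := by
        gcongr
        exact C.le_of_opNorm_le hCK _
      _ = K * ‖C x‖ ^ 2 := by ring
  rw [map_sub, map_smul, inner_sub_left, inner_sub_right, inner_sub_right, real_inner_smul_left,
    real_inner_smul_left, real_inner_smul_right, real_inner_smul_right, hs (C x) x,
    real_inner_self_eq_norm_sq] at h1
  have h3 : K⁻¹ * (K⁻¹ * inner ℝ (C (C x)) (C x)) ≤ K⁻¹ * (K⁻¹ * (K * ‖C x‖ ^ 2)) := by gcongr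
  have h4 : K⁻¹ * (K⁻¹ * (K * ‖C x‖ ^ 2)) = K⁻¹ * ‖C x‖ ^ 2 := by field_simp
  have h5 : K⁻¹ * ‖C x‖ ^ 2 ≤ inner ℝ (C x) x := by linarith
  rwa [inv_mul_le_iff₀ hK] at h5

/-- The square root is operator monotone: if `B² ≤ A²` for positive operators, then `B ≤ A`. -/
lemma inner_le_inner_of_norm_le {A B : E →L[ℝ] E}
    (hA : ∀ x y, inner ℝ (A x) y = inner ℝ x (A y)) (hB : ∀ x y, inner ℝ (B x) y = inner ℝ x (B y))
    (hA0 : ∀ x, 0 ≤ inner ℝ (A x) x)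
    (h : ∀ x, ‖B x‖ ≤ ‖A x‖) (x : E) : inner ℝ (B x) x ≤ inner ℝ (A x) x := by
  by_contra! hx
  have hx0 : x ≠ 0 := by rintro rfl; simp at hx
  -- A spectral argument without eigenvectors: let μ < 0 be the infimum of the form of A - B on the
  -- unit sphere. An almost minimizing y is almost an eigenvector, so ‖Ay‖² - ‖By‖² = ⟨(A+B)y,
  -- (A-B)y⟩ is close to μ⟨(A+B)y, y⟩, which is negative.
  set S : Set ℝ := (fun y : E => (inner ℝ ((A - B) y) y : ℝ)) '' {y | ‖y‖ = 1} with hS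
  have hbdd : BddBelow S := by
    refine ⟨-‖A - B‖, ?_⟩
    rintro _ ⟨y, hy, rfl⟩
    have h1 := abs_real_inner_le_norm ((A - B) y) y
    have h2 := (A - B).le_opNorm y
    simp only [Set.mem_ofPred_eq] at hy
    rw [hy, mul_one] at h1 h2
    exact neg_le_of_abs_le (h1.trans h2)
  have hscale : ∀ y : E, y ≠ 0 →
      ‖y‖⁻¹ * (‖y‖⁻¹ * inner ℝ ((A - B) y) y) ∈ S := by
    intro y hy
    refine ⟨‖y‖⁻¹ • y, ?_, ?_⟩
    · simp only [Set.mem_ofPred_eq, norm_smul, norm_inv, norm_norm]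
      exact inv_mul_cancel₀ (norm_ne_zero_iff.2 hy)
    · simp only [map_smul, real_inner_smul_left, real_inner_smul_right]
  set μ := sInf S with hμ
  have hμ0 : μ < 0 := by
    refine lt_of_le_of_lt (csInf_le hbdd (hscale x hx0)) ?_
    have h1 : inner ℝ ((A - B) x) x < 0 := by
      rw [sub_apply, inner_sub_left]; linarith
    have h2 : 0 < ‖x‖⁻¹ := inv_pos.2 (norm_pos_iff.2 hx0)
    exact mul_neg_of_pos_of_neg h2 (mul_neg_of_pos_of_neg h2 h1)
  set C : E →L[ℝ] E := A - B - μ • ContinuousLinearMap.id ℝ E with hC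
  have hCx : ∀ y, C y = A y - B y - μ • y := fun y => by simp [hC]
  have hC0 : ∀ y, 0 ≤ inner ℝ (C y) y := by
    intro y
    by_cases hy : y = 0
    · simp [hy]
    have h1 := csInf_le hbdd (hscale y hy)
    have hn : 0 < ‖y‖ := norm_pos_iff.2 hy
    rw [← hμ, le_inv_mul_iff₀ hn, le_inv_mul_iff₀ hn, sub_apply] at h1
    rw [hCx, inner_sub_left _ (μ • y), real_inner_smul_left, real_inner_self_eq_norm_sq]
    linarith
  have hCs : ∀ y z, inner ℝ (C y) z = inner ℝ y (C z) := by
    intro y z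
    rw [hCx, hCx, inner_sub_left, inner_sub_left, inner_sub_right, inner_sub_right, hA, hB,
      real_inner_smul_left, real_inner_smul_right]
  set K := ‖C‖ + 1 with hK
  have hK0 : 0 < K := by positivity
  set L := ‖A + B‖ with hL
  have hL0 : 0 ≤ L := norm_nonneg _
  -- Chosen so that Lδ ≤ μ²/4. Taking y within δ²/K of the infimum gives ‖Cy‖ ≤ δ; taking it within
  -- -μ/2 gives ⟨(A+B)y, y⟩ ≥ -μ/2. The main term -μ²/2 then outweighs the error μ²/4.
  set δ := μ ^ 2 / (4 * (L + 1)) with hδ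
  have hδ0 : 0 < δ := by
    have : 0 < μ ^ 2 := by rw [pow_two]; exact mul_pos_of_neg_of_neg hμ0 hμ0
    positivity
  have hε : 0 < min (-μ / 2) (δ ^ 2 / K) := lt_min (by linarith) (by positivity)
  obtain ⟨_, ⟨y, hy, rfl⟩, hlt⟩ := exists_lt_of_csInf_lt ⟨_, hscale x hx0⟩
    (lt_add_of_pos_right μ hε)
  simp only [Set.mem_ofPred_eq] at hy
  beta_reduce at hlt
  have hCy : inner ℝ (C y) y = inner ℝ ((A - B) y) y - μ := by
    rw [hCx, inner_sub_left _ (μ • y), real_inner_smul_left, real_inner_self_eq_norm_sq, hy]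
    simp
  have hε1 := min_le_left (-μ / 2) (δ ^ 2 / K)
  have hε2 := min_le_right (-μ / 2) (δ ^ 2 / K)
  have h1 : ‖C y‖ ≤ δ := by
    refine abs_le_of_sq_le_sq' ?_ hδ0.le |>.2
    calc ‖C y‖ ^ 2 ≤ K * inner ℝ (C y) y :=
          norm_sq_le_of_nonneg hK0 (by simp [hK]) hCs hC0 y
      _ ≤ K * (δ ^ 2 / K) := by gcongr; linarith
      _ = δ ^ 2 := by field_simp
  have h2 : inner ℝ ((A + B) y) (C y) ≤ L * δ := by
    calc inner ℝ ((A + B) y) (C y) ≤ ‖(A + B) y‖ * ‖C y‖ := real_inner_le_norm _ _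
      _ ≤ (L * ‖y‖) * δ := by gcongr; exact (A + B).le_opNorm y
      _ = L * δ := by rw [hy, mul_one]
  have h3 : ‖A y‖ ^ 2 - ‖B y‖ ^ 2 = inner ℝ ((A + B) y) (C y) + μ * inner ℝ ((A + B) y) y := by
    rw [hCx, add_apply, inner_sub_right, real_inner_smul_right,
      inner_sub_right, inner_add_left, inner_add_left, real_inner_self_eq_norm_sq,
      real_inner_self_eq_norm_sq, real_inner_comm (A y) (B y)]
    ring
  have h4 : -μ / 2 ≤ inner ℝ ((A + B) y) y := by
    rw [sub_apply, inner_sub_left] at hlt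
    rw [add_apply, inner_add_left]
    have := hA0 y
    linarith
  have h5 : 0 ≤ ‖A y‖ ^ 2 - ‖B y‖ ^ 2 := by
    have := h y
    have := norm_nonneg (B y)
    nlinarith
  have h6 : L * δ ≤ μ ^ 2 / 4 := by
    rw [hδ, mul_div_assoc', div_le_div_iff₀ (by positivity) (by positivity)]
    nlinarith [sq_nonneg μ]
  have h7 : μ * inner ℝ ((A + B) y) y ≤ μ * (-μ / 2) := mul_le_mul_of_nonpos_left h4 hμ0.le
  have h8 : 0 < μ ^ 2 := by rw [pow_two]; exact mul_pos_of_neg_of_neg hμ0 hμ0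
  nlinarith

end Operators

/-! ### The link condition and the Galerkin approximation -/

/-- The function with coordinates `b l` for `l < D` and zero otherwise. -/
def trigPoly (D : ℕ) (b : ℕ → ℝ) : L2 := ∑ l ∈ Finset.range D, b l • ψ l

lemma coord_trigPoly (D : ℕ) (b : ℕ → ℝ) (l : ℕ) :
    coord (trigPoly D b) l = if l < D then b l else 0 := by
  rw [trigPoly, coord_sum]
  simp_rw [coord_smul, coord_ψ]
  simp

lemma norm_sq_trigPoly (D : ℕ) (b : ℕ → ℝ) :
    ‖trigPoly D b‖ ^ 2 = ∑ l ∈ Finset.range D, b l ^ 2 := by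
  rw [← (hasSum_coord_sq _).tsum_eq, tsum_eq_sum (s := Finset.range D)]
  · refine Finset.sum_congr rfl fun l hl => ?_
    rw [coord_trigPoly, if_pos (Finset.mem_range.1 hl)]
  · intro l hl
    rw [coord_trigPoly, if_neg (by simpa using hl)]
    simp

lemma inner_trigPoly (f : L2) (D : ℕ) (b : ℕ → ℝ) :
    inner ℝ f (trigPoly D b) = ∑ l ∈ Finset.range D, b l * coord f l := by
  rw [trigPoly, inner_sum]
  simp_rw [real_inner_smul_right]
  rfl

/-- The scaled orthogonal projection onto the span of the first `D` trigonometric functions. -/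
def scaledProj (c : ℝ) (D : ℕ) : L2 →L[ℝ] L2 :=
  ∑ l ∈ Finset.range D, c • (innerSL ℝ (ψ l)).smulRight (ψ l)

lemma scaledProj_apply (c : ℝ) (D : ℕ) (f : L2) :
    scaledProj c D f = trigPoly D fun l => c * coord f l := by
  rw [scaledProj, trigPoly, sum_apply]
  refine Finset.sum_congr rfl fun l _ => ?_
  simp [mul_smul, coord, real_inner_comm]

lemma summable_weight_mul_coord_sq {υ : ℕ → ℝ} (hυ : Antitone υ) (hpos : ∀ j, 0 < υ j) (f : L2) :
    Summable fun j => υ j ^ 2 * coord f j ^ 2 := by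
  refine Summable.of_nonneg_of_le (fun j => by positivity) (fun j => ?_)
    ((hasSum_coord_sq f).summable.mul_left (υ 0 ^ 2))
  have h1 := (hpos j).le
  have h2 := hυ (Nat.zero_le j)
  gcongr

section Link

variable {υ : ℕ → ℝ} {d : ℝ} {Γ : L2 →L[ℝ] L2}

/-- Only weights of index at least N contribute, and these are at most υ N by monotonicity. -/
lemma LinkCondition.norm_le_of_coord_eq_zero (hl : LinkCondition υ d Γ) (hυ : Antitone υ)
    (hpos : ∀ j, 0 < υ j) (hd : 0 < d) {N : ℕ} {f : L2} (hf : ∀ l < N, coord f l = 0) :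
    ‖Γ f‖ ≤ d * υ N * ‖f‖ := by
  have h0 := (hpos N).le
  refine abs_le_of_sq_le_sq' ?_ (by positivity) |>.2
  refine (hl f).2.trans ?_
  rw [mul_pow, mul_pow, mul_assoc]
  gcongr
  rw [← (hasSum_coord_sq f).tsum_eq, ← tsum_mul_left]
  refine (summable_weight_mul_coord_sq hυ hpos f).tsum_le_tsum (fun l => ?_)
    ((hasSum_coord_sq f).summable.mul_left _)
  by_cases hlN : l < N
  · simp [hf l hlN]
  · have h1 := (hpos l).le
    have h2 := hυ (not_lt.1 hlN)
    gcongr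

lemma LinkCondition.norm_apply_le (hl : LinkCondition υ d Γ) (hυ : Antitone υ)
    (hpos : ∀ j, 0 < υ j) (hd : 0 < d) (f : L2) : ‖Γ f‖ ≤ d * υ 0 * ‖f‖ :=
  hl.norm_le_of_coord_eq_zero hυ hpos hd (by simp)

lemma LinkCondition.coord_apply_ψ_le (hl : LinkCondition υ d Γ) (hυ : Antitone υ)
    (hpos : ∀ j, 0 < υ j) (hd : 0 < d) (j : ℕ) : coord (Γ (ψ j)) j ≤ d * υ j := by
  have h1 : ‖ψ j‖ = 1 := orthonormal_ψ.1 j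
  have h2 := hl.norm_le_of_coord_eq_zero hυ hpos hd (N := j) (f := ψ j) fun l hlj => by
    rw [coord_ψ, if_neg (by omega)]
  rw [h1, mul_one] at h2
  refine le_trans ?_ h2
  refine (real_inner_le_norm _ _).trans ?_
  rw [h1, mul_one]

/-- On the first N+1 coordinates all weights are at least υ N, so the lower link inequality
dominates the square of υ N / d times the projection by Γ². Operator monotonicity of the square root
removes the squares. -/
lemma LinkCondition.mul_sum_le_inner (hl : LinkCondition υ d Γ) (hυ : Antitone υ)
    (hpos : ∀ j, 0 < υ j) (hd : 0 < d)
    (hs : ∀ x y, inner ℝ (Γ x) y = inner ℝ x (Γ y)) (h0 : ∀ x, 0 ≤ inner ℝ (Γ x) x)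
    (N : ℕ) (f : L2) :
    υ N / d * ∑ l ∈ Finset.range (N + 1), coord f l ^ 2 ≤ inner ℝ (Γ f) f := by
  have key : ∀ x y : L2, inner ℝ (scaledProj (υ N / d) (N + 1) x) y =
      υ N / d * ∑ l ∈ Finset.range (N + 1), coord x l * coord y l := by
    intro x y
    rw [scaledProj_apply, real_inner_comm, inner_trigPoly, Finset.mul_sum]
    exact Finset.sum_congr rfl fun l _ => by ring
  have h := inner_le_inner_of_norm_le (A := Γ) (B := scaledProj (υ N / d) (N + 1)) hs
    (fun x y => by
      rw [key, real_inner_comm, key]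
      simp_rw [mul_comm])
    h0 (fun x => by
      refine abs_le_of_sq_le_sq' ?_ (norm_nonneg _) |>.2
      refine le_trans ?_ (hl x).1
      rw [scaledProj_apply, norm_sq_trigPoly, le_div_iff₀ (by positivity), Finset.sum_mul]
      refine le_trans ?_ ((summable_weight_mul_coord_sq hυ hpos x).sum_le_tsum
        (Finset.range (N + 1)) fun _ _ => by positivity)
      refine Finset.sum_le_sum fun l hlN => ?_
      have h1 := hυ (Nat.lt_succ_iff.1 (Finset.mem_range.1 hlN))
      have h2 := (hpos N).le
      have : (υ N / d * coord x l) ^ 2 * d ^ 2 = υ N ^ 2 * coord x l ^ 2 := by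
        field_simp
      rw [this]
      gcongr) f
  rw [key] at h
  simpa [pow_two] using h

/-- The Galerkin approximation is, up to a constant, as good as the orthogonal projection. -/
lemma LinkCondition.sum_galerkin_sub_sq_le (hl : LinkCondition υ d Γ) (hυ : Antitone υ)
    (hpos : ∀ j, 0 < υ j) (hd : 0 < d)
    (hs : ∀ x y, inner ℝ (Γ x) y = inner ℝ x (Γ y)) (h0 : ∀ x, 0 ≤ inner ℝ (Γ x) x)
    (N : ℕ) (β : L2) (b : ℕ → ℝ) (hb : ∀ j < N + 1, coord (Γ (β - trigPoly (N + 1) b)) j = 0) :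
    ∑ l ∈ Finset.range (N + 1), (b l - coord β l) ^ 2 ≤
      d ^ 4 * ‖β - trigPoly (N + 1) (coord β)‖ ^ 2 := by
  set r := β - trigPoly (N + 1) (coord β) with hr
  set f := trigPoly (N + 1) fun l => b l - coord β l with hf
  have hfr : β - trigPoly (N + 1) b = r - f := by
    have : f = trigPoly (N + 1) b - trigPoly (N + 1) (coord β) := by
      simp [hf, trigPoly, sub_smul, Finset.sum_sub_distrib]
    rw [this, hr]; abel
  -- Galerkin orthogonality: f is in the span of the first N+1 basis functions, to which Γ(r - f) is
  -- orthogonal. Hence ⟨Γf, f⟩ = ⟨Γr, f⟩.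
  have h1 : inner ℝ (Γ (r - f)) f = 0 := by
    rw [← hfr, hf, inner_trigPoly]
    exact Finset.sum_eq_zero fun l hl => by rw [hb l (Finset.mem_range.1 hl), mul_zero]
  have h2 : inner ℝ (Γ f) f = inner ℝ (Γ r) f := by
    rw [map_sub, inner_sub_left] at h1; linarith
  have h3 := hl.mul_sum_le_inner hυ hpos hd hs h0 N f
  have h4 : ∑ l ∈ Finset.range (N + 1), coord f l ^ 2 = ‖f‖ ^ 2 := by
    rw [hf, norm_sq_trigPoly]
    refine Finset.sum_congr rfl fun l hl => ?_
    rw [coord_trigPoly, if_pos (Finset.mem_range.1 hl)]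
  -- The coordinates of r vanish up to and including N, but the weight υ N is used on purpose: it
  -- cancels against the υ N of the lower bound for ⟨Γf, f⟩.
  have h5 : ‖Γ r‖ ≤ d * υ N * ‖r‖ := by
    refine hl.norm_le_of_coord_eq_zero hυ hpos hd fun l hlN => ?_
    rw [hr, coord_sub, coord_trigPoly, if_pos (by omega), sub_self]
  rw [h4, h2] at h3
  have h6 : inner ℝ (Γ r) f ≤ d * υ N * ‖r‖ * ‖f‖ :=
    (real_inner_le_norm _ _).trans (by gcongr)
  have h7 : ‖f‖ ≤ d ^ 2 * ‖r‖ := by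
    have hN := hpos N
    rcases (norm_nonneg f).eq_or_lt with hz | hz
    · rw [← hz]; positivity
    have h8 : υ N * ‖f‖ * ‖f‖ ≤ υ N * (d ^ 2 * ‖r‖) * ‖f‖ := by
      have h9 := h3.trans h6
      rw [div_mul_eq_mul_div, div_le_iff₀ hd] at h9
      calc υ N * ‖f‖ * ‖f‖ = υ N * ‖f‖ ^ 2 := by ring
        _ ≤ d * υ N * ‖r‖ * ‖f‖ * d := h9
        _ = _ := by ring
    exact le_of_mul_le_mul_left (le_of_mul_le_mul_right h8 hz) hN
  have h10 : ∑ l ∈ Finset.range (N + 1), (b l - coord β l) ^ 2 = ‖f‖ ^ 2 := by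
    rw [hf, norm_sq_trigPoly]
  rw [h10]
  calc ‖f‖ ^ 2 ≤ (d ^ 2 * ‖r‖) ^ 2 := by gcongr
    _ = d ^ 4 * ‖r‖ ^ 2 := by ring

end Link

/-! ### Sobolev ellipsoids -/

/-- Indices from 2m+1 on have frequency at least m+1, and frequency^(2s-2p) has a nonpositive
exponent. -/
lemma derivFactor_sq_pow_le {p : ℝ} {s m l : ℕ} (hsp : (s : ℝ) ≤ p) (hl : 2 * m + 1 ≤ l) :
    (derivFactor l ^ 2) ^ s ≤
      (2 * Real.pi) ^ (2 * s) * ((m : ℝ) + 1) ^ (2 * s - 2 * p) * sobolevWeight p l := by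
  have hl0 : l ≠ 0 := by omega
  have hfm : m + 1 ≤ freq l := by unfold freq; omega
  have hf : (m : ℝ) + 1 ≤ freq l := by exact_mod_cast hfm
  have hf0 : (0 : ℝ) < freq l := by have := Nat.cast_nonneg (α := ℝ) m; linarith
  rw [derivFactor_sq, sobolevWeight, if_neg hl0, ← pow_mul, mul_pow, mul_assoc]
  gcongr
  calc (freq l : ℝ) ^ (2 * s) = (freq l : ℝ) ^ (2 * (s : ℝ) - 2 * p) * (freq l : ℝ) ^ (2 * p) := by
        rw [← Real.rpow_add hf0, sub_add_cancel, ← Real.rpow_natCast]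
        push_cast
        rfl
    _ ≤ _ := by
      gcongr ?_ * _
      exact Real.rpow_le_rpow_of_nonpos (by positivity) hf (by linarith)

lemma sobolevWeight_nonneg (p : ℝ) (l : ℕ) : 0 ≤ sobolevWeight p l := by
  unfold sobolevWeight
  split_ifs <;> positivity

lemma derivFactor_sq_pow_le_weight {p : ℝ} {s : ℕ} (hsp : (s : ℝ) ≤ p) (l : ℕ) :
    (derivFactor l ^ 2) ^ s ≤ (2 * Real.pi) ^ (2 * s) * sobolevWeight p l := by
  -- Needed for the constant function: at index 0 the left side is 0 ^ s, which is 1 when s = 0.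
  have h2π : (1 : ℝ) ≤ (2 * Real.pi) ^ (2 * s) :=
    one_le_pow₀ (by have := Real.pi_gt_three; linarith)
  rcases Nat.eq_zero_or_pos l with rfl | hl
  · rw [derivFactor_zero]
    simp only [sobolevWeight, if_true, mul_one]
    refine le_trans ?_ h2π
    rcases s with _ | s <;> simp
  · have := derivFactor_sq_pow_le (m := 0) hsp (l := l) (by omega)
    simpa using this

section Ellipsoid

variable {p ρ : ℝ} {β : L2} {s : ℕ}

lemma summable_derivFactor_mul_coord_sq (hβ : β ∈ ellipsoid p ρ) (hsp : (s : ℝ) ≤ p) :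
    Summable fun l => (derivFactor l ^ 2) ^ s * coord β l ^ 2 := by
  refine Summable.of_nonneg_of_le (fun l => by positivity) (fun l => ?_)
    (hβ.1.mul_left ((2 * Real.pi) ^ (2 * s)))
  rw [← mul_assoc]
  gcongr
  exact derivFactor_sq_pow_le_weight hsp l

lemma tsum_derivFactor_mul_coord_sq_le (hβ : β ∈ ellipsoid p ρ) (hsp : (s : ℝ) ≤ p) :
    ∑' l, (derivFactor l ^ 2) ^ s * coord β l ^ 2 ≤ (2 * Real.pi) ^ (2 * s) * ρ := by
  calc ∑' l, (derivFactor l ^ 2) ^ s * coord β l ^ 2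
      ≤ ∑' l, (2 * Real.pi) ^ (2 * s) * (sobolevWeight p l * coord β l ^ 2) := by
        refine (summable_derivFactor_mul_coord_sq hβ hsp).tsum_le_tsum (fun l => ?_)
          (hβ.1.mul_left _)
        rw [← mul_assoc]
        gcongr
        exact derivFactor_sq_pow_le_weight hsp l
    _ ≤ _ := by
      rw [tsum_mul_left]
      gcongr
      exact hβ.2

lemma tsum_derivFactor_mul_tail_sq_le (hβ : β ∈ ellipsoid p ρ) (hsp : (s : ℝ) ≤ p) (m : ℕ) :
    ∑' l, (derivFactor l ^ 2) ^ s * (if l < 2 * m + 1 then 0 else coord β l) ^ 2 ≤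
      (2 * Real.pi) ^ (2 * s) * ((m : ℝ) + 1) ^ (2 * s - 2 * p) * ρ := by
  have hle : ∀ l, (derivFactor l ^ 2) ^ s * (if l < 2 * m + 1 then 0 else coord β l) ^ 2 ≤
      (2 * Real.pi) ^ (2 * s) * ((m : ℝ) + 1) ^ (2 * s - 2 * p) *
        (sobolevWeight p l * coord β l ^ 2) := by
    intro l
    have hw := sobolevWeight_nonneg p l
    split_ifs with hl
    · rw [zero_pow two_ne_zero, mul_zero]; positivity
    · rw [← mul_assoc]
      gcongr
      exact derivFactor_sq_pow_le hsp (not_lt.1 hl)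
  calc _ ≤ ∑' l, (2 * Real.pi) ^ (2 * s) * ((m : ℝ) + 1) ^ (2 * s - 2 * p) *
        (sobolevWeight p l * coord β l ^ 2) :=
        (Summable.of_nonneg_of_le (fun l => by positivity) hle (hβ.1.mul_left _)).tsum_le_tsum
          hle (hβ.1.mul_left _)
    _ ≤ _ := by
      rw [tsum_mul_left]
      gcongr
      exact hβ.2

/-- The weighted distance of a trigonometric polynomial to an element of the ellipsoid. -/
lemma tsum_derivFactor_mul_sub_sq_le (hβ : β ∈ ellipsoid p ρ) (hsp : (s : ℝ) ≤ p) (m : ℕ)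
    {u : ℕ → ℝ} (hu : ∀ l, 2 * m + 1 ≤ l → u l = 0) :
    ∑' l, (derivFactor l ^ 2) ^ s * (u l - coord β l) ^ 2 ≤
      (2 * Real.pi * m) ^ (2 * s) * ∑ l ∈ Finset.range (2 * m + 1), (u l - coord β l) ^ 2 +
      (2 * Real.pi) ^ (2 * s) * ((m : ℝ) + 1) ^ (2 * s - 2 * p) * ρ := by
  have hsplit : ∀ l, (derivFactor l ^ 2) ^ s * (u l - coord β l) ^ 2 =
      (if l < 2 * m + 1 then (derivFactor l ^ 2) ^ s * (u l - coord β l) ^ 2 else 0) +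
      (derivFactor l ^ 2) ^ s * (if l < 2 * m + 1 then 0 else coord β l) ^ 2 := by
    intro l
    split_ifs with hl
    · simp
    · simp [hu l (not_lt.1 hl)]
  have hfin : ∀ l ∉ Finset.range (2 * m + 1),
      (if l < 2 * m + 1 then (derivFactor l ^ 2) ^ s * (u l - coord β l) ^ 2 else 0) = 0 := by
    intro l hl
    rw [if_neg (by simpa using hl)]
  have htail : Summable fun l =>
      (derivFactor l ^ 2) ^ s * (if l < 2 * m + 1 then 0 else coord β l) ^ 2 := by
    refine Summable.of_nonneg_of_le (fun l => by positivity) (fun l => ?_)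
      (summable_derivFactor_mul_coord_sq hβ hsp)
    split_ifs
    · rw [zero_pow two_ne_zero, mul_zero]; positivity
    · exact le_rfl
  rw [tsum_congr hsplit, (summable_of_ne_finset_zero hfin).tsum_add htail, tsum_eq_sum hfin]
  refine add_le_add ?_ (tsum_derivFactor_mul_tail_sq_le hβ hsp m)
  rw [Finset.mul_sum]
  refine Finset.sum_le_sum fun l hl => ?_
  rw [Finset.mem_range] at hl
  rw [if_pos hl, derivFactor_sq, ← pow_mul]
  have : freq l ≤ m := by unfold freq; omega
  gcongr

lemma norm_sq_sub_trigPoly_le (hβ : β ∈ ellipsoid p ρ) (hp : 0 ≤ p) (m : ℕ) :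
    ‖β - trigPoly (2 * m + 1) (coord β)‖ ^ 2 ≤ ((m : ℝ) + 1) ^ (-(2 * p)) * ρ := by
  have h := tsum_derivFactor_mul_tail_sq_le (s := 0) hβ (by simpa using hp) m
  rw [← (hasSum_coord_sq _).tsum_eq]
  refine le_trans (le_of_eq (tsum_congr fun l => ?_)) (h.trans (le_of_eq ?_))
  · rw [coord_sub, coord_trigPoly]
    split_ifs <;> simp
  · simp

end Ellipsoid

/-! ### The estimator in real coordinates -/

section Estimator

open Matrix

/-- Extension of a finite vector by zero. -/
def extendZero {R : Type*} [Zero R] {D : ℕ} (u : Fin D → R) (l : ℕ) : R :=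
  if h : l < D then u ⟨l, h⟩ else 0

lemma extendZero_val {R : Type*} [Zero R] {D : ℕ} (u : Fin D → R) (l : Fin D) :
    extendZero u l = u l := by simp [extendZero]

lemma extendZero_of_le {R : Type*} [Zero R] {D : ℕ} (u : Fin D → R) {l : ℕ} (h : D ≤ l) :
    extendZero u l = 0 := by simp [extendZero, not_lt.2 h]

/-- The change of basis from the real trigonometric functions to the exponentials. -/
def trigToExp (m : ℕ) : Matrix (Freq m) (Fin (2 * m + 1)) ℂ :=
  Matrix.of fun j l => ftrans (Pi.single (l : ℕ) 1) j

lemma trigToExp_mulVec (m : ℕ) (v : ℕ → ℂ) (j : Freq m) :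
    (trigToExp m).mulVec (fun l => v l) j = ftrans v j := by
  obtain ⟨j, hj⟩ := j
  rw [Finset.mem_Icc] at hj
  have key : ∀ a : ℕ, a < 2 * m + 1 →
      ∑ l : Fin (2 * m + 1), (Pi.single (l : ℕ) (1 : ℂ) : ℕ → ℂ) a * v l = v a := by
    intro a ha
    rw [Finset.sum_eq_single ⟨a, ha⟩]
    · simp
    · intro l _ hl
      rw [Pi.single_apply, if_neg, zero_mul]
      rintro rfl
      exact hl rfl
    · simp
  simp only [Matrix.mulVec, dotProduct, trigToExp, Matrix.of_apply]
  by_cases h0 : j = 0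
  · simp only [ftrans, h0, if_true]
    exact key 0 (by omega)
  · simp only [ftrans, h0, if_false]
    rw [← key (2 * j.natAbs - 1) (by omega), ← key (2 * j.natAbs) (by omega), Finset.mul_sum,
      ← Finset.sum_sub_distrib, Finset.sum_div]
    refine Finset.sum_congr rfl fun l _ => ?_
    ring

lemma trigToExp_mulVec_extendZero (m : ℕ) (u : Fin (2 * m + 1) → ℂ) (j : Freq m) :
    (trigToExp m).mulVec u j = ftrans (extendZero u) j := by
  rw [← trigToExp_mulVec]
  simp_rw [extendZero_val]

lemma conjTranspose_trigToExp_mul (m : ℕ) : (trigToExp m)ᴴ * trigToExp m = 1 := by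
  ext l l'
  rw [Matrix.mul_apply]
  simp only [Matrix.conjTranspose_apply, trigToExp, Matrix.of_apply]
  rw [Finset.sum_coe_sort (Finset.Icc (-(m : ℤ)) (m : ℤ))
    fun j => star (ftrans (Pi.single (l : ℕ) 1) j) * ftrans (Pi.single (l' : ℕ) 1) j]
  refine (sum_conj_ftrans_mul _ _ m).trans ?_
  rw [Finset.sum_eq_single (l : ℕ)]
  · simp [Matrix.one_apply, Pi.single_apply, Fin.ext_iff]
  · intro a _ ha
    simp [Pi.single_apply, ha]
  · intro hl
    exact absurd (Finset.mem_range.2 l.2) hl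

/-- The index types differ but both have 2m+1 elements, so a one-sided inverse is two-sided. -/
lemma trigToExp_mul_conjTranspose (m : ℕ) : trigToExp m * (trigToExp m)ᴴ = 1 := by
  rw [Matrix.mul_eq_one_comm_of_card_eq (Freq m) (Fin (2 * m + 1)) ℂ]
  · exact conjTranspose_trigToExp_mul m
  · simp only [Fintype.card_coe, Int.card_Icc, Fintype.card_fin]
    omega

lemma norm_sq_trigToExp_mulVec (m : ℕ) (u : Fin (2 * m + 1) → ℂ) :
    ‖WithLp.toLp 2 ((trigToExp m).mulVec u)‖ ^ 2 = ∑ l, ‖u l‖ ^ 2 := by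
  rw [EuclideanSpace.norm_sq_eq]
  simp_rw [trigToExp_mulVec_extendZero]
  rw [Finset.sum_coe_sort (Finset.Icc (-(m : ℤ)) (m : ℤ))
    fun j => ‖ftrans (extendZero u) j‖ ^ 2, sum_normSq_ftrans, ← Fin.sum_univ_eq_sum_range
    (fun l => ‖extendZero u l‖ ^ 2)]
  simp_rw [extendZero_val]

/-- The first `D` coordinates of a function. -/
def coords (D : ℕ) (f : L2) (l : Fin D) : ℝ := coord f l

lemma fourierCoord_eq_mulVec (m : ℕ) (f : L2) (j : Freq m) :
    fourierCoord f j =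
      (trigToExp m).mulVec (fun l => ((coords (2 * m + 1) f l : ℝ) : ℂ)) j := by
  rw [fourierCoord_eq_ftrans, ← trigToExp_mulVec]
  rfl

/-- The empirical second moment matrix of real random vectors. -/
def secondMoment {n D : ℕ} (c : Fin n → Fin D → ℝ) : Matrix (Fin D) (Fin D) ℝ :=
  Matrix.of fun j l => (n : ℝ)⁻¹ * ∑ i, c i j * c i l

/-- The empirical cross moment vector of real random vectors with real random variables. -/
def crossMoment {n D : ℕ} (c : Fin n → Fin D → ℝ) (y : Fin n → ℝ) (j : Fin D) : ℝ :=
  (n : ℝ)⁻¹ * ∑ i, y i * c i j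

variable {n m : ℕ} (x : Fin n → L2) (y : Fin n → ℝ)

/-- The complex empirical matrix is unitarily equivalent to a real Gram matrix, so invertibility and
the norm of the inverse can be read off the latter. -/
lemma empCov_eq : empCov m x = trigToExp m *
    (secondMoment fun i => coords (2 * m + 1) (x i)).map (fun r : ℝ => (r : ℂ)) *
      (trigToExp m)ᴴ := by
  ext j l
  rw [Matrix.mul_assoc, Matrix.mul_apply]
  simp_rw [Matrix.mul_apply]
  simp only [empCov, Matrix.of_apply, fourierCoord_eq_mulVec, Matrix.mulVec, dotProduct,
    Matrix.map_apply, secondMoment, Matrix.conjTranspose_apply, map_sum, map_mul,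
    Complex.conj_ofReal]
  push_cast
  simp_rw [Finset.mul_sum, Finset.sum_mul, Finset.mul_sum]
  rw [Finset.sum_comm]
  simp_rw [Finset.sum_comm (s := (Finset.univ : Finset (Fin n)))]
  refine Finset.sum_congr rfl fun a _ => Finset.sum_congr rfl fun b _ =>
    Finset.sum_congr rfl fun i _ => ?_
  simp only [RCLike.star_def]
  ring

lemma empCross_eq : empCross m x y = (trigToExp m).mulVec
    (fun l => ((crossMoment (fun i => coords (2 * m + 1) (x i)) y l : ℝ) : ℂ)) := by
  ext j
  simp only [empCross, fourierCoord_eq_mulVec, Matrix.mulVec, dotProduct, crossMoment]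
  push_cast
  simp_rw [Finset.mul_sum]
  rw [Finset.sum_comm]
  refine Finset.sum_congr rfl fun a _ => Finset.sum_congr rfl fun i _ => ?_
  ring

lemma map_ofReal_mulVec {D : ℕ} (A : Matrix (Fin D) (Fin D) ℝ) (v : Fin D → ℝ) :
    (A.map (fun r : ℝ => (r : ℂ))).mulVec (fun l => (v l : ℂ)) =
      fun l => ((A.mulVec v l : ℝ) : ℂ) := by
  ext l
  simp [Matrix.mulVec, dotProduct]

lemma sum_norm_sq_map_ofReal_mulVec {D : ℕ} (A : Matrix (Fin D) (Fin D) ℝ) (v : Fin D → ℂ) :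
    ∑ l, ‖(A.map (fun r : ℝ => (r : ℂ))).mulVec v l‖ ^ 2 =
      A.mulVec (fun l => (v l).re) ⬝ᵥ A.mulVec (fun l => (v l).re) +
        A.mulVec (fun l => (v l).im) ⬝ᵥ A.mulVec (fun l => (v l).im) := by
  simp only [dotProduct, ← Finset.sum_add_distrib]
  refine Finset.sum_congr rfl fun l _ => ?_
  rw [Complex.sq_norm, Complex.normSq_apply]
  simp [Matrix.mulVec, dotProduct]

lemma empCov_mul_eq_one {H : Matrix (Fin (2 * m + 1)) (Fin (2 * m + 1)) ℝ}
    (hH : (secondMoment fun i => coords (2 * m + 1) (x i)) * H = 1) :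
    empCov m x * (trigToExp m * H.map (fun r : ℝ => (r : ℂ)) * (trigToExp m)ᴴ) = 1 := by
  rw [empCov_eq]
  have h : (secondMoment fun i => coords (2 * m + 1) (x i)).map (fun r : ℝ => (r : ℂ)) *
      H.map (fun r : ℝ => (r : ℂ)) = 1 := by
    have := congrArg (fun A => A.map (Complex.ofRealHom)) hH
    rw [Matrix.map_mul] at this
    rw [Matrix.map_one _ (map_zero _) (map_one _)] at this
    exact this
  calc _ = trigToExp m * ((secondMoment fun i => coords (2 * m + 1) (x i)).map
        (fun r : ℝ => (r : ℂ)) * ((trigToExp m)ᴴ * trigToExp m) *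
        H.map (fun r : ℝ => (r : ℂ))) * (trigToExp m)ᴴ := by
        simp only [Matrix.mul_assoc]
    _ = 1 := by
      rw [conjTranspose_trigToExp_mul, Matrix.mul_one, h, Matrix.mul_one,
        trigToExp_mul_conjTranspose]

lemma isUnit_secondMoment_of_isUnit_empCov (h : IsUnit (empCov m x).det) :
    IsUnit (secondMoment fun i => coords (2 * m + 1) (x i)).det := by
  set G := secondMoment fun i => coords (2 * m + 1) (x i) with hG
  have h1 := Matrix.mul_nonsing_inv _ h
  have h2 : G.map (fun r : ℝ => (r : ℂ)) *
      ((trigToExp m)ᴴ * (empCov m x)⁻¹ * trigToExp m) = 1 := by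
    calc G.map (fun r : ℝ => (r : ℂ)) * ((trigToExp m)ᴴ * (empCov m x)⁻¹ * trigToExp m)
        = ((trigToExp m)ᴴ * trigToExp m) * (G.map (fun r : ℝ => (r : ℂ)) *
            ((trigToExp m)ᴴ * (empCov m x)⁻¹ * trigToExp m)) := by
          rw [conjTranspose_trigToExp_mul, Matrix.one_mul]
      _ = (trigToExp m)ᴴ * ((trigToExp m * G.map (fun r : ℝ => (r : ℂ)) * (trigToExp m)ᴴ) *
            (empCov m x)⁻¹) * trigToExp m := by
          simp only [Matrix.mul_assoc]
      _ = 1 := by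
        rw [← empCov_eq, h1, Matrix.mul_one, conjTranspose_trigToExp_mul]
  have h3 := (Matrix.isUnit_det_of_right_inverse h2)
  have h4 : (G.map (fun r : ℝ => (r : ℂ))).det = ((G.det : ℝ) : ℂ) :=
    (Complex.ofRealHom.map_det G).symm
  rw [h4, isUnit_iff_ne_zero] at h3
  rw [isUnit_iff_ne_zero]
  exact_mod_cast h3

lemma empCov_inv_eq (h : IsUnit (secondMoment fun i => coords (2 * m + 1) (x i)).det) :
    (empCov m x)⁻¹ = trigToExp m * (secondMoment fun i => coords (2 * m + 1) (x i))⁻¹.map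
      (fun r : ℝ => (r : ℂ)) * (trigToExp m)ᴴ :=
  Matrix.inv_eq_right_inv (empCov_mul_eq_one x (Matrix.mul_nonsing_inv _ h))

lemma empCov_inv_mulVec (h : IsUnit (secondMoment fun i => coords (2 * m + 1) (x i)).det)
    (z : Fin (2 * m + 1) → ℝ) :
    (empCov m x)⁻¹.mulVec ((trigToExp m).mulVec fun l => (z l : ℂ)) =
      (trigToExp m).mulVec fun l =>
        (((secondMoment fun i => coords (2 * m + 1) (x i))⁻¹.mulVec z l : ℝ) : ℂ) := by
  rw [empCov_inv_eq x h, Matrix.mulVec_mulVec, Matrix.mul_assoc, conjTranspose_trigToExp_mul,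
    Matrix.mul_one, ← Matrix.mulVec_mulVec, map_ofReal_mulVec]

/-- If the threshold condition holds, the real Gram matrix is invertible with controlled
inverse. -/
lemma secondMoment_inv_mulVec_le {γ : ℝ} (h : IsUnit (empCov m x).det)
    (hγ : opNorm (empCov m x)⁻¹ ≤ γ) (z : Fin (2 * m + 1) → ℝ) :
    (secondMoment fun i => coords (2 * m + 1) (x i))⁻¹.mulVec z ⬝ᵥ
      (secondMoment fun i => coords (2 * m + 1) (x i))⁻¹.mulVec z ≤ γ ^ 2 * (z ⬝ᵥ z) := by
  have hu := isUnit_secondMoment_of_isUnit_empCov x h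
  have h1 := ContinuousLinearMap.le_of_opNorm_le _ hγ
    (WithLp.toLp 2 ((trigToExp m).mulVec fun l => (z l : ℂ)))
  rw [Matrix.toEuclideanCLM_toLp, empCov_inv_mulVec x hu] at h1
  have h2 := pow_le_pow_left₀ (norm_nonneg _) h1 2
  rw [mul_pow, norm_sq_trigToExp_mulVec, norm_sq_trigToExp_mulVec] at h2
  simpa [dotProduct, pow_two] using h2

/-- The threshold condition holds if the real Gram matrix is bounded below. -/
lemma threshold_of_lower_bound {c γ : ℝ} (hc : 0 < c) (hcγ : c⁻¹ ≤ γ)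
    (h : ∀ v, c * (v ⬝ᵥ v) ≤ v ⬝ᵥ (secondMoment fun i => coords (2 * m + 1) (x i)).mulVec v) :
    IsUnit (empCov m x).det ∧ opNorm (empCov m x)⁻¹ ≤ γ := by
  set G := secondMoment fun i => coords (2 * m + 1) (x i) with hG
  have hvv : ∀ v : Fin (2 * m + 1) → ℝ, 0 ≤ v ⬝ᵥ v := fun v =>
    Finset.sum_nonneg fun i _ => mul_self_nonneg _
  have hcs : ∀ v w : Fin (2 * m + 1) → ℝ, (v ⬝ᵥ w) ^ 2 ≤ (v ⬝ᵥ v) * (w ⬝ᵥ w) := fun v w => by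
    simpa [dotProduct, pow_two] using Finset.sum_mul_sq_le_sq_mul_sq Finset.univ v w
  have hlow : ∀ v, c ^ 2 * (v ⬝ᵥ v) ≤ G.mulVec v ⬝ᵥ G.mulVec v := by
    intro v
    rcases (hvv v).eq_or_lt with h0 | h0
    · rw [← h0, mul_zero]; exact hvv _
    have h1 := h v
    have h2 := hcs v (G.mulVec v)
    have h3 : (c * (v ⬝ᵥ v)) ^ 2 ≤ (v ⬝ᵥ v) * (G.mulVec v ⬝ᵥ G.mulVec v) :=
      (pow_le_pow_left₀ (by positivity) h1 2).trans h2
    refine le_of_mul_le_mul_left ?_ h0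
    calc (v ⬝ᵥ v) * (c ^ 2 * (v ⬝ᵥ v)) = (c * (v ⬝ᵥ v)) ^ 2 := by ring
      _ ≤ _ := h3
  have hGu : IsUnit G.det := by
    rw [isUnit_iff_ne_zero]
    intro h0
    obtain ⟨v, hv, hv0⟩ := Matrix.exists_mulVec_eq_zero_iff.2 h0
    have h1 := h v
    rw [hv0, dotProduct_zero] at h1
    have h2 : v ⬝ᵥ v = 0 := le_antisymm (by nlinarith) (hvv v)
    exact hv (dotProduct_self_eq_zero.1 h2)
  have hEu : IsUnit (empCov m x).det :=
    Matrix.isUnit_det_of_right_inverse (empCov_mul_eq_one x (Matrix.mul_nonsing_inv _ hGu))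
  refine ⟨hEu, le_trans ?_ hcγ⟩
  refine ContinuousLinearMap.opNorm_le_bound _ (by positivity) fun w => ?_
  obtain ⟨w, rfl⟩ : ∃ w' : Freq m → ℂ, WithLp.toLp 2 w' = w := ⟨w.ofLp, rfl⟩
  -- In these coordinates the claim is c‖u‖ ≤ ‖Gu‖ for complex u. As G is real, real and imaginary
  -- parts separate and `hlow` applies to each.
  obtain ⟨u, hu⟩ : ∃ u, u = (trigToExp m)ᴴ.mulVec ((empCov m x)⁻¹.mulVec w) := ⟨_, rfl⟩
  have h1 : (empCov m x)⁻¹.mulVec w = (trigToExp m).mulVec u := by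
    rw [hu, Matrix.mulVec_mulVec, trigToExp_mul_conjTranspose, Matrix.one_mulVec]
  have h2 : w = (trigToExp m).mulVec ((G.map (fun r : ℝ => (r : ℂ))).mulVec u) := by
    rw [hu, Matrix.mulVec_mulVec, Matrix.mulVec_mulVec, Matrix.mulVec_mulVec, ← empCov_eq,
      Matrix.mul_nonsing_inv _ hEu, Matrix.one_mulVec]
  rw [Matrix.toEuclideanCLM_toLp, h1]
  conv_rhs => rw [h2]
  refine abs_le_of_sq_le_sq' ?_ (by positivity) |>.2
  rw [mul_pow, norm_sq_trigToExp_mulVec, norm_sq_trigToExp_mulVec, sum_norm_sq_map_ofReal_mulVec,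
    inv_pow, le_inv_mul_iff₀ (by positivity)]
  have h3 : ∑ l, ‖u l‖ ^ 2 =
      (fun l => (u l).re) ⬝ᵥ (fun l => (u l).re) + (fun l => (u l).im) ⬝ᵥ (fun l => (u l).im) := by
    simp only [dotProduct, ← Finset.sum_add_distrib]
    refine Finset.sum_congr rfl fun l _ => ?_
    rw [Complex.sq_norm, Complex.normSq_apply]
  rw [h3, mul_add]
  exact add_le_add (hlow _) (hlow _)

lemma derivEstimator_eq {s : ℕ} {γ : ℝ} (h : IsUnit (empCov m x).det)
    (hγ : opNorm (empCov m x)⁻¹ ≤ γ) (t : ℝ) :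
    derivEstimator s m γ x y t = ∑ j ∈ Finset.Icc (-(m : ℤ)) (m : ℤ),
      (2 * Complex.I * Real.pi * (j : ℂ)) ^ s *
        ftrans (fun l => ((extendZero ((secondMoment fun i => coords (2 * m + 1) (x i))⁻¹.mulVec
          (crossMoment (fun i => coords (2 * m + 1) (x i)) y)) l : ℝ) : ℂ)) j * expFun j t := by
  have hu := isUnit_secondMoment_of_isUnit_empCov x h
  rw [derivEstimator, if_pos ⟨h, hγ⟩, empCross_eq, empCov_inv_mulVec x hu]
  rw [← Finset.sum_coe_sort (Finset.Icc (-(m : ℤ)) (m : ℤ))]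
  refine Finset.sum_congr rfl fun j _ => ?_
  rw [← trigToExp_mulVec]
  simp_rw [extendZero_val]

end Estimator

/-! ### Whitening -/

section Whitening

open Matrix

variable {D : ℕ} {M R G : Matrix (Fin D) (Fin D) ℝ}

lemma dotProduct_self_nonneg' (v : Fin D → ℝ) : 0 ≤ v ⬝ᵥ v :=
  Finset.sum_nonneg fun _ _ => mul_self_nonneg _

lemma dotProduct_sq_le (v w : Fin D → ℝ) : (v ⬝ᵥ w) ^ 2 ≤ (v ⬝ᵥ v) * (w ⬝ᵥ w) := by
  simpa [dotProduct, pow_two] using Finset.sum_mul_sq_le_sq_mul_sq Finset.univ v w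

/-- The squared Frobenius norm of `R G R - 1`. -/
def whitenedError (R G : Matrix (Fin D) (Fin D) ℝ) : ℝ := ∑ j, ∑ l, ((R * G * R - 1) j l) ^ 2

lemma whitenedError_nonneg (R G : Matrix (Fin D) (Fin D) ℝ) : 0 ≤ whitenedError R G :=
  Finset.sum_nonneg fun _ _ => Finset.sum_nonneg fun _ _ => sq_nonneg _

lemma dotProduct_mulVec_of_whitening (hR : Rᵀ = R) (v : Fin D → ℝ) :
    R.mulVec v ⬝ᵥ M.mulVec (R.mulVec v) = v ⬝ᵥ (R * M * R).mulVec v := by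
  rw [← Matrix.mulVec_mulVec, ← Matrix.mulVec_mulVec, dotProduct_mulVec v R, ← mulVec_transpose,
    hR]

lemma exists_mulVec_eq_of_whitening (hRM : R * M * R = 1) (v : Fin D → ℝ) :
    ∃ w, R.mulVec w = v :=
  ⟨(R * M).mulVec v, by
    rw [Matrix.mulVec_mulVec, mul_eq_one_comm.1 hRM, Matrix.one_mulVec]⟩

/-- The Frobenius norm dominates the operator norm, so RGR differs from the identity by at most 1/2.
-/
lemma half_dotProduct_le_of_whitenedError_le (hF : whitenedError R G ≤ 1 / 4) (v : Fin D → ℝ) :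
    1 / 2 * (v ⬝ᵥ v) ≤ v ⬝ᵥ (R * G * R).mulVec v := by
  have h1 : (R * G * R - 1).mulVec v ⬝ᵥ (R * G * R - 1).mulVec v ≤
      whitenedError R G * (v ⬝ᵥ v) := by
    rw [whitenedError, Finset.sum_mul, dotProduct]
    refine Finset.sum_le_sum fun j _ => ?_
    have := dotProduct_sq_le ((R * G * R - 1) j) v
    rw [← pow_two]
    refine this.trans (le_of_eq ?_)
    simp [dotProduct, pow_two]
  have h2 := dotProduct_sq_le v ((R * G * R - 1).mulVec v)
  have h0 := dotProduct_self_nonneg' v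
  have h3 : (v ⬝ᵥ (R * G * R - 1).mulVec v) ^ 2 ≤ (1 / 2 * (v ⬝ᵥ v)) ^ 2 := by
    calc _ ≤ (v ⬝ᵥ v) * (1 / 4 * (v ⬝ᵥ v)) := h2.trans (by
          gcongr
          exact h1.trans (by gcongr))
      _ = _ := by ring
  have h4 := (abs_le_of_sq_le_sq' h3 (by positivity)).1
  rw [Matrix.sub_mulVec, Matrix.one_mulVec, dotProduct_sub] at h4
  linarith

lemma lower_bound_of_whitenedError_le (hR : Rᵀ = R) (hRM : R * M * R = 1) {c : ℝ}
    (hc : ∀ v, c * (v ⬝ᵥ v) ≤ v ⬝ᵥ M.mulVec v) (hF : whitenedError R G ≤ 1 / 4)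
    (v : Fin D → ℝ) : c / 2 * (v ⬝ᵥ v) ≤ v ⬝ᵥ G.mulVec v := by
  obtain ⟨w, rfl⟩ := exists_mulVec_eq_of_whitening hRM v
  have h1 := hc (R.mulVec w)
  have h2 := half_dotProduct_le_of_whitenedError_le hF w
  rw [dotProduct_mulVec_of_whitening hR, hRM, Matrix.one_mulVec] at h1
  rw [dotProduct_mulVec_of_whitening hR]
  linarith

/-- With v = Rw one has c|v|² ≤ |w|², and |w|²/2 ≤ ⟨w, RGRw⟩ = ⟨w, Rz⟩ gives |w| ≤ 2|Rz|. Whitening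
costs only one factor 1/c, where the crude bound on G⁻¹ would cost two. -/
lemma dotProduct_solution_le (hR : Rᵀ = R) (hRM : R * M * R = 1) {c : ℝ}
    (hc : ∀ v, c * (v ⬝ᵥ v) ≤ v ⬝ᵥ M.mulVec v) (hF : whitenedError R G ≤ 1 / 4)
    {v z : Fin D → ℝ} (hv : G.mulVec v = z) :
    c * (v ⬝ᵥ v) ≤ 4 * (R.mulVec z ⬝ᵥ R.mulVec z) := by
  obtain ⟨w, rfl⟩ := exists_mulVec_eq_of_whitening hRM v
  have h1 := hc (R.mulVec w)
  have h2 := half_dotProduct_le_of_whitenedError_le hF w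
  rw [dotProduct_mulVec_of_whitening hR, hRM, Matrix.one_mulVec] at h1
  rw [← Matrix.mulVec_mulVec, ← Matrix.mulVec_mulVec, hv] at h2
  refine h1.trans ?_
  have h3 := dotProduct_sq_le w (R.mulVec z)
  rcases (dotProduct_self_nonneg' w).eq_or_lt with h0 | h0
  · rw [← h0]
    have := dotProduct_self_nonneg' (R.mulVec z)
    positivity
  · have h4 : (1 / 2 * (w ⬝ᵥ w)) ^ 2 ≤ (w ⬝ᵥ w) * (R.mulVec z ⬝ᵥ R.mulVec z) :=
      (pow_le_pow_left₀ (by positivity) h2 2).trans h3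
    refine le_of_mul_le_mul_left ?_ h0
    nlinarith

lemma dotProduct_le_of_upper_bound (hR : Rᵀ = R) (hM : Mᵀ = M) (hRM : R * M * R = 1) {K : ℝ}
    (hK : ∀ v, v ⬝ᵥ M.mulVec v ≤ K * (v ⬝ᵥ v)) (z : Fin D → ℝ) :
    z ⬝ᵥ z ≤ K * (R.mulVec z ⬝ᵥ R.mulVec z) := by
  have h1 : R * (M * R) = 1 := by rw [← Matrix.mul_assoc, hRM]
  have h2 : M * R * R = 1 := mul_eq_one_comm.1 h1
  have h3 : R * M = M * R := by
    have := congrArg Matrix.transpose h2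
    rw [Matrix.transpose_mul, Matrix.transpose_mul, hR, hM, Matrix.transpose_one] at this
    calc R * M = (M * R * R) * (R * M) := by rw [h2, Matrix.one_mul]
      _ = M * R * (R * (R * M)) := by simp only [Matrix.mul_assoc]
      _ = M * R := by rw [this, Matrix.mul_one]
  have h4 : R * R * M = 1 := by rw [Matrix.mul_assoc, h3, h1]
  refine le_trans (le_of_eq ?_) (hK (R.mulVec z))
  rw [dotProduct_mulVec_of_whitening hR, hRM, Matrix.one_mulVec]

end Whitening

/-! ### A pointwise bound for the loss -/

section Loss

open Matrix

variable {n m s k : ℕ} {x : Fin n → L2} {y : Fin n → ℝ} {β g : L2} {p ρ γ c K : ℝ}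
  {M R : Matrix (Fin (2 * m + 1)) (Fin (2 * m + 1)) ℝ} {b : Fin (2 * m + 1) → ℝ}

/-- The residual vector `[ĝ] - [Γ̂] b`. -/
def residual {n D : ℕ} (c : Fin n → Fin D → ℝ) (y : Fin n → ℝ) (b : Fin D → ℝ) : Fin D → ℝ :=
  crossMoment c y - (secondMoment c).mulVec b

/-- The deterministic core. The term 4T/c covers the event F ≤ 1/4, where the threshold condition is
automatic because 2/c ≤ γ. On F > 1/4 the factors (4F)^(k-1) and (4F)^k are at least 1 and absorb,
respectively, the stochastic error under the threshold bound and the loss of the zero estimator. -/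
lemma lintegral_derivEstimator_sub_sq_le (hβ : β ∈ ellipsoid p ρ)
    (hsp : (s : ℝ) ≤ p) (hg : ∀ l, coord g l = (trigDeriv^[s] (coord β)) l)
    (hR : Rᵀ = R) (hM : Mᵀ = M) (hRM : R * M * R = 1) (hc0 : 0 < c) (hcγ : 2 / c ≤ γ)
    (hc : ∀ v, c * (v ⬝ᵥ v) ≤ v ⬝ᵥ M.mulVec v) (hK0 : 0 ≤ K)
    (hK : ∀ v, v ⬝ᵥ M.mulVec v ≤ K * (v ⬝ᵥ v)) {T F B : ℝ}
    (hF : F = whitenedError R (secondMoment fun i => coords (2 * m + 1) (x i)))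
    (hT : T = R.mulVec (residual (fun i => coords (2 * m + 1) (x i)) y b) ⬝ᵥ
      R.mulVec (residual (fun i => coords (2 * m + 1) (x i)) y b))
    (hB : B = ∑ l : Fin (2 * m + 1), (b l - coord β l) ^ 2) :
    ∫⁻ t in Set.Icc (0 : ℝ) 1, ‖derivEstimator s m γ x y t - ((g t : ℝ) : ℂ)‖ₑ ^ 2 ≤
      ENNReal.ofReal ((2 * Real.pi * m) ^ (2 * s) *
        (2 * (4 / c * T + γ ^ 2 * (K * T) * (4 * F) ^ (k - 1)) + 2 * B) +
        (2 * Real.pi) ^ (2 * s) * ((m : ℝ) + 1) ^ (2 * s - 2 * p) * ρ +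
        (2 * Real.pi) ^ (2 * s) * ρ * (4 * F) ^ k) := by
  set G := secondMoment fun i => coords (2 * m + 1) (x i) with hG
  set z := residual (fun i => coords (2 * m + 1) (x i)) y b with hz
  have hT0 : 0 ≤ T := by rw [hT]; exact dotProduct_self_nonneg' _
  have hF0 : 0 ≤ F := by rw [hF]; exact whitenedError_nonneg _ _
  have hB0 : 0 ≤ B := by rw [hB]; exact Finset.sum_nonneg fun _ _ => sq_nonneg _
  have hρ : 0 ≤ ρ := le_trans
    (tsum_nonneg fun l => mul_nonneg (sobolevWeight_nonneg p l) (sq_nonneg _)) hβ.2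
  have hm1 : (0 : ℝ) < (m : ℝ) + 1 := by positivity
  by_cases hcond : IsUnit (empCov m x).det ∧ opNorm (empCov m x)⁻¹ ≤ γ
  · obtain ⟨hE, hEγ⟩ := hcond
    have hGu := isUnit_secondMoment_of_isUnit_empCov x hE
    rw [← hG] at hGu
    set u := G⁻¹.mulVec (crossMoment (fun i => coords (2 * m + 1) (x i)) y) with hu
    have hub : u - b = G⁻¹.mulVec z := by
      rw [hz, residual, Matrix.mulVec_sub, ← hG, Matrix.mulVec_mulVec,
        Matrix.nonsing_inv_mul _ hGu, Matrix.one_mulVec]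
    have hGub : G.mulVec (u - b) = z := by
      rw [hub, Matrix.mulVec_mulVec, Matrix.mul_nonsing_inv _ hGu, Matrix.one_mulVec]
    have hmain : (u - b) ⬝ᵥ (u - b) ≤ 4 / c * T + γ ^ 2 * (K * T) * (4 * F) ^ (k - 1) := by
      by_cases hF4 : F ≤ 1 / 4
      · have h1 := dotProduct_solution_le hR hRM hc (hF ▸ hF4) hGub
        rw [← hT, ← le_div_iff₀' hc0] at h1
        have h2 : 0 ≤ γ ^ 2 * (K * T) * (4 * F) ^ (k - 1) := by positivity
        calc _ ≤ _ := h1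
          _ = 4 / c * T := by ring
          _ ≤ _ := le_add_of_nonneg_right h2
      · have h1 := secondMoment_inv_mulVec_le x hE hEγ z
        rw [← hG, ← hub] at h1
        have h2 := dotProduct_le_of_upper_bound hR hM hRM hK z
        rw [← hT] at h2
        have h3 : (1 : ℝ) ≤ (4 * F) ^ (k - 1) := one_le_pow₀ (by linarith [not_le.1 hF4])
        have h4 : 0 ≤ 4 / c * T := by positivity
        calc _ ≤ γ ^ 2 * (z ⬝ᵥ z) := h1
          _ ≤ γ ^ 2 * (K * T) := by gcongr
          _ ≤ γ ^ 2 * (K * T) * (4 * F) ^ (k - 1) := le_mul_of_one_le_right (by positivity) h3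
          _ ≤ _ := le_add_of_nonneg_left h4
    have hsum : ∑ l ∈ Finset.range (2 * m + 1), (extendZero u l - coord β l) ^ 2 ≤
        2 * (4 / c * T + γ ^ 2 * (K * T) * (4 * F) ^ (k - 1)) + 2 * B := by
      rw [← Fin.sum_univ_eq_sum_range (fun l => (extendZero u l - coord β l) ^ 2)]
      calc _ ≤ ∑ l : Fin (2 * m + 1), (2 * ((u - b) l * (u - b) l) +
            2 * (b l - coord β l) ^ 2) := by
            refine Finset.sum_le_sum fun l _ => ?_
            rw [extendZero_val, Pi.sub_apply]
            nlinarith [sq_nonneg (u l - b l - (b l - coord β l))]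
        _ = 2 * ((u - b) ⬝ᵥ (u - b)) + 2 * B := by
          rw [Finset.sum_add_distrib, ← Finset.mul_sum, ← Finset.mul_sum, hB, dotProduct]
        _ ≤ _ := by gcongr
    simp_rw [derivEstimator_eq x y hE hEγ]
    rw [lintegral_sum_sub_sq (extendZero u) (fun l hl => extendZero_of_le u hl) hg]
    refine ENNReal.ofReal_le_ofReal ?_
    refine (tsum_derivFactor_mul_sub_sq_le hβ hsp m fun l hl => extendZero_of_le u hl).trans ?_
    have h5 : 0 ≤ (2 * Real.pi) ^ (2 * s) * ρ * (4 * F) ^ k := by positivity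
    refine le_trans ?_ (le_add_of_nonneg_right h5)
    gcongr
  · have hF4 : 1 / 4 < F := by
      by_contra hF4
      refine hcond (threshold_of_lower_bound x (half_pos hc0) (by rwa [inv_div]) ?_)
      exact lower_bound_of_whitenedError_le hR hRM hc (hF ▸ not_lt.1 hF4)
    have h0 : ∀ t, ‖derivEstimator s m γ x y t - ((g t : ℝ) : ℂ)‖ₑ ^ 2 =
        ‖((g t : ℝ) : ℂ)‖ₑ ^ 2 := by
      intro t
      rw [derivEstimator, if_neg hcond, zero_sub, enorm_neg]
    simp_rw [h0]
    rw [lintegral_enorm_sq_coe]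
    refine ENNReal.ofReal_le_ofReal ?_
    have h1 : ‖g‖ ^ 2 ≤ (2 * Real.pi) ^ (2 * s) * ρ := by
      rw [← (hasSum_coord_sq g).tsum_eq]
      simp_rw [hg]
      rw [tsum_iterate_trigDeriv_sq]
      exact tsum_derivFactor_mul_coord_sq_le hβ hsp
    have h2 : (1 : ℝ) ≤ (4 * F) ^ k := one_le_pow₀ (by linarith)
    calc ‖g‖ ^ 2 ≤ (2 * Real.pi) ^ (2 * s) * ρ := h1
      _ ≤ (2 * Real.pi) ^ (2 * s) * ρ * (4 * F) ^ k := le_mul_of_one_le_right (by positivity) h2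
      _ ≤ _ := le_add_of_nonneg_left (by positivity)

end Loss

/-! ### Moments of sums of independent centered random variables -/

/-- Second-order Taylor expansion in x with an explicit remainder; the linear term is kept exact
because it will have mean zero. The induction multiplies by (s + x)². -/
lemma exists_even_pow_add_le (q : ℕ) (hq : 1 ≤ q) : ∃ K : ℝ, 0 < K ∧ ∀ s x : ℝ,
    (s + x) ^ (2 * q) ≤ s ^ (2 * q) + 2 * q * s ^ (2 * q - 1) * x +
      K * (x ^ 2 * ((s ^ 2) ^ (q - 1) + (x ^ 2) ^ (q - 1))) := by
  induction q, hq using Nat.le_induction with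
  | base => exact ⟨1, one_pos, fun s x => by norm_num; nlinarith [sq_nonneg x]⟩
  | succ q hq ih =>
    obtain ⟨K, hK, h⟩ := ih
    -- Multiplying out gives 4q+1 copies of U from the square terms, 4q from the cubic term and 6K
    -- from the old remainder.
    refine ⟨8 * q + 1 + 6 * K, by positivity, fun s x => ?_⟩
    obtain ⟨r, rfl⟩ : ∃ r, q = r + 1 := ⟨q - 1, by omega⟩
    have e1 : 2 * (r + 1) - 1 = 2 * r + 1 := by omega
    have e2 : 2 * (r + 1 + 1) - 1 = 2 * r + 3 := by omega
    have h1 := h s x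
    rw [e1] at h1
    rw [e2]
    simp only [Nat.add_sub_cancel] at h1 ⊢
    have h2 := mul_le_mul_of_nonneg_left h1 (sq_nonneg (s + x))
    have hS : 0 ≤ s ^ 2 := sq_nonneg s
    have hX : 0 ≤ x ^ 2 := sq_nonneg x
    have hSr : 0 ≤ (s ^ 2) ^ r := by positivity
    have hXr : 0 ≤ (x ^ 2) ^ r := by positivity
    have hmix1 : (s ^ 2) ^ r * x ^ 2 ≤ (s ^ 2) ^ (r + 1) + (x ^ 2) ^ (r + 1) := by
      rcases le_total (s ^ 2) (x ^ 2) with hle | hle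
      · have : (s ^ 2) ^ r * x ^ 2 ≤ (x ^ 2) ^ (r + 1) := by rw [pow_succ (x ^ 2) r]; gcongr
        have : 0 ≤ (s ^ 2) ^ (r + 1) := by positivity
        linarith
      · have : (s ^ 2) ^ r * x ^ 2 ≤ (s ^ 2) ^ (r + 1) := by rw [pow_succ (s ^ 2) r]; gcongr
        have : 0 ≤ (x ^ 2) ^ (r + 1) := by positivity
        linarith
    have hmix2 : (x ^ 2) ^ r * s ^ 2 ≤ (s ^ 2) ^ (r + 1) + (x ^ 2) ^ (r + 1) := by
      rcases le_total (s ^ 2) (x ^ 2) with hle | hle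
      · have : (x ^ 2) ^ r * s ^ 2 ≤ (x ^ 2) ^ (r + 1) := by rw [pow_succ (x ^ 2) r]; gcongr
        have : 0 ≤ (s ^ 2) ^ (r + 1) := by positivity
        linarith
      · have : (x ^ 2) ^ r * s ^ 2 ≤ (s ^ 2) ^ (r + 1) := by rw [pow_succ (s ^ 2) r]; gcongr
        have : 0 ≤ (x ^ 2) ^ (r + 1) := by positivity
        linarith
    set U := (s ^ 2) ^ (r + 1) + (x ^ 2) ^ (r + 1) with hU
    have hU1 : (s ^ 2) ^ (r + 1) ≤ U := le_add_of_nonneg_right (by positivity)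
    have hU0 : 0 ≤ U := by positivity
    have hsq : (s + x) ^ 2 ≤ 2 * (s ^ 2 + x ^ 2) := by nlinarith [sq_nonneg (s - x)]
    have hrem : (s + x) ^ 2 * ((s ^ 2) ^ r + (x ^ 2) ^ r) ≤ 6 * U := by
      calc (s + x) ^ 2 * ((s ^ 2) ^ r + (x ^ 2) ^ r)
          ≤ 2 * (s ^ 2 + x ^ 2) * ((s ^ 2) ^ r + (x ^ 2) ^ r) := by gcongr
        _ = 2 * U + 2 * ((s ^ 2) ^ r * x ^ 2) + 2 * ((x ^ 2) ^ r * s ^ 2) := by rw [hU]; ring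
        _ ≤ 6 * U := by linarith
    have hsx : s * x ≤ s ^ 2 + x ^ 2 := by nlinarith [sq_nonneg (s - x)]
    have hcub : (s ^ 2) ^ r * (s * x) ≤ 2 * U := by
      calc (s ^ 2) ^ r * (s * x) ≤ (s ^ 2) ^ r * (s ^ 2 + x ^ 2) := by gcongr
        _ = (s ^ 2) ^ (r + 1) + (s ^ 2) ^ r * x ^ 2 := by ring
        _ ≤ 2 * U := by linarith
    have hr0 : (0 : ℝ) ≤ r := Nat.cast_nonneg r
    calc (s + x) ^ (2 * (r + 1 + 1)) = (s + x) ^ 2 * (s + x) ^ (2 * (r + 1)) := by ring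
      _ ≤ _ := h2
      _ = s ^ (2 * (r + 1 + 1)) + 2 * ((r + 1 + 1 : ℕ) : ℝ) * s ^ (2 * r + 3) * x +
          x ^ 2 * ((4 * ((r : ℝ) + 1) + 1) * (s ^ 2) ^ (r + 1) +
            2 * ((r : ℝ) + 1) * ((s ^ 2) ^ r * (s * x)) +
            K * ((s + x) ^ 2 * ((s ^ 2) ^ r + (x ^ 2) ^ r))) := by
          push_cast; ring
      _ ≤ s ^ (2 * (r + 1 + 1)) + 2 * ((r + 1 + 1 : ℕ) : ℝ) * s ^ (2 * r + 3) * x +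
          x ^ 2 * ((4 * ((r : ℝ) + 1) + 1) * U + 2 * ((r : ℝ) + 1) * (2 * U) + K * (6 * U)) := by
          gcongr
      _ ≤ _ := by
        push_cast
        exact le_of_eq (by ring)

/-- The constant absorbing the second order term is of order `N^{q-1}` if the leading term may
be increased by a factor `1 + 1/N`. -/
lemma exists_even_pow_add_le_of_one_le (q : ℕ) (hq : 1 ≤ q) :
    ∃ C : ℝ, 0 < C ∧ ∀ N : ℝ, 1 ≤ N → ∀ s x : ℝ,
      (s + x) ^ (2 * q) ≤ (1 + N⁻¹) * s ^ (2 * q) + 2 * q * (s ^ (2 * q - 1) * x) +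
        C * N ^ (q - 1) * x ^ (2 * q) := by
  obtain ⟨K, hK, h⟩ := exists_even_pow_add_le q hq
  obtain ⟨r, rfl⟩ : ∃ r, q = r + 1 := ⟨q - 1, by omega⟩
  -- The case split is at s² = L N x². Below it the remainder is bounded by N^(q-1) x^(2q). Above
  -- it, x² ≤ s²/(LN) and 2K ≤ L bound the remainder by s^(2q)/N.
  set L := max 1 (2 * K) with hL
  have hL1 : 1 ≤ L := le_max_left _ _
  have hLK : 2 * K ≤ L := le_max_right _ _
  refine ⟨K * (L ^ r + 1), by positivity, fun N hN s x => ?_⟩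
  refine (h s x).trans ?_
  simp only [Nat.add_sub_cancel]
  have hS : 0 ≤ s ^ 2 := sq_nonneg s
  have hX : 0 ≤ x ^ 2 := sq_nonneg x
  have hN0 : 0 < N := by linarith
  have hs2 : s ^ (2 * (r + 1)) = (s ^ 2) ^ (r + 1) := pow_mul _ _ _
  have hx2 : x ^ (2 * (r + 1)) = (x ^ 2) ^ (r + 1) := pow_mul _ _ _
  have hNr : 1 ≤ N ^ r := one_le_pow₀ hN
  have key : K * (x ^ 2 * ((s ^ 2) ^ r + (x ^ 2) ^ r)) ≤
      N⁻¹ * (s ^ 2) ^ (r + 1) + K * (L ^ r + 1) * N ^ r * (x ^ 2) ^ (r + 1) := by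
    rcases le_total (s ^ 2) (L * N * x ^ 2) with hle | hle
    · have h1 : (s ^ 2) ^ r ≤ (L * N * x ^ 2) ^ r := by gcongr
      have h2 : (x ^ 2) ^ r ≤ N ^ r * (x ^ 2) ^ r := le_mul_of_one_le_left (by positivity) hNr
      calc K * (x ^ 2 * ((s ^ 2) ^ r + (x ^ 2) ^ r))
          ≤ K * (x ^ 2 * ((L * N * x ^ 2) ^ r + N ^ r * (x ^ 2) ^ r)) := by gcongr
        _ = K * (L ^ r + 1) * N ^ r * (x ^ 2) ^ (r + 1) := by ring
        _ ≤ _ := le_add_of_nonneg_left (by positivity)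
    · have hLN : 1 ≤ L * N := one_le_mul_of_one_le_of_one_le hL1 hN
      have hxs : x ^ 2 ≤ s ^ 2 := (le_mul_of_one_le_left hX hLN).trans hle
      calc K * (x ^ 2 * ((s ^ 2) ^ r + (x ^ 2) ^ r))
          ≤ K * (x ^ 2 * ((s ^ 2) ^ r + (s ^ 2) ^ r)) := by gcongr
        _ = 2 * K * x ^ 2 * (s ^ 2) ^ r := by ring
        _ ≤ L * x ^ 2 * (s ^ 2) ^ r := by gcongr
        _ = N⁻¹ * ((L * N * x ^ 2) * (s ^ 2) ^ r) := by field_simp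
        _ ≤ N⁻¹ * (s ^ 2 * (s ^ 2) ^ r) := by gcongr
        _ = N⁻¹ * (s ^ 2) ^ (r + 1) := by ring
        _ ≤ _ := le_add_of_nonneg_right (by positivity)
  rw [hs2, hx2]
  linarith

section Moments

variable {Ω : Type*} [MeasurableSpace Ω] {P : Measure Ω}

lemma integrable_even_pow {q : ℕ} (hq : 1 ≤ q) {f : Ω → ℝ} (hf : MemLp f ((2 * q : ℕ) : ℝ≥0∞) P) :
    Integrable (fun ω => f ω ^ (2 * q)) P := by
  have h := hf.integrable_norm_pow (by omega)
  refine h.congr (Eventually.of_forall fun ω => ?_)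
  simp only [Real.norm_eq_abs]
  exact Even.pow_abs ⟨q, by ring⟩ _

lemma integrable_odd_pow_mul {q : ℕ} (hq : 1 ≤ q) {f g : Ω → ℝ}
    (hf : MemLp f ((2 * q : ℕ) : ℝ≥0∞) P) (hg : MemLp g ((2 * q : ℕ) : ℝ≥0∞) P) :
    Integrable (fun ω => f ω ^ (2 * q - 1) * g ω) P := by
  refine ((integrable_even_pow hq hf).add (integrable_even_pow hq hg)).mono'
    ((hf.aestronglyMeasurable.pow _).mul hg.aestronglyMeasurable)
    (Eventually.of_forall fun ω => ?_)
  have he : Even (2 * q) := ⟨q, by ring⟩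
  rw [Pi.add_apply, norm_mul, norm_pow, Real.norm_eq_abs, Real.norm_eq_abs, ← he.pow_abs (f ω),
    ← he.pow_abs (g ω)]
  have e : 2 * q = (2 * q - 1) + 1 := by omega
  rcases le_total |f ω| |g ω| with h | h
  · have h1 : |f ω| ^ (2 * q - 1) * |g ω| ≤ |g ω| ^ (2 * q) := by
      conv_rhs => rw [e, pow_succ]
      gcongr
    have h2 : 0 ≤ |f ω| ^ (2 * q) := by positivity
    linarith
  · have h1 : |f ω| ^ (2 * q - 1) * |g ω| ≤ |f ω| ^ (2 * q) := by
      conv_rhs => rw [e, pow_succ]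
      gcongr
    have h2 : 0 ≤ |g ω| ^ (2 * q) := by positivity
    linarith

/-- A moment inequality for sums of independent centered random variables. -/
lemma integral_sum_even_pow_le [IsProbabilityMeasure P] {q : ℕ} (hq : 1 ≤ q) {C : ℝ} (hC : 0 < C)
    (hCq : ∀ N : ℝ, 1 ≤ N → ∀ s x : ℝ,
      (s + x) ^ (2 * q) ≤ (1 + N⁻¹) * s ^ (2 * q) + 2 * q * (s ^ (2 * q - 1) * x) +
        C * N ^ (q - 1) * x ^ (2 * q))
    {n : ℕ} {ξ : Fin n → Ω → ℝ} (hind : iIndepFun ξ P)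
    (hm : ∀ i, MemLp (ξ i) ((2 * q : ℕ) : ℝ≥0∞) P) (h0 : ∀ i, ∫ ω, ξ i ω ∂P = 0) {μ : ℝ}
    (hμ : ∀ i, ∫ ω, ξ i ω ^ (2 * q) ∂P ≤ μ) {N : ℝ} (hN : 1 ≤ N) (S : Finset (Fin n)) :
    ∫ ω, (∑ i ∈ S, ξ i ω) ^ (2 * q) ∂P ≤
      (1 + N⁻¹) ^ S.card * (S.card * (C * N ^ (q - 1) * μ)) := by
  have hN0 : 0 < N := by linarith
  induction S using Finset.induction_on with
  | empty =>
    have : 2 * q ≠ 0 := by omega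
    simp [this]
  | insert i S hi ih =>
    have hμ0 : 0 ≤ μ := le_trans (integral_nonneg fun ω => Even.pow_nonneg ⟨q, by ring⟩ _) (hμ i)
    have hS : MemLp (fun ω => ∑ j ∈ S, ξ j ω) ((2 * q : ℕ) : ℝ≥0∞) P :=
      memLp_finsetSum S fun j _ => hm j
    have hI1 := integrable_even_pow hq hS
    have hI2 := integrable_odd_pow_mul hq hS (hm i)
    have hI3 := integrable_even_pow hq (hm i)
    have hindS : IndepFun (fun ω => ∑ j ∈ S, ξ j ω) (ξ i) P := by
      have := hind.indepFun_finsetSum_of_notMem₀ (fun j => (hm j).aestronglyMeasurable.aemeasurable)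
        hi
      convert this using 1
      ext ω
      simp
    -- The linear term vanishes since the new summand is centered and independent of the partial
    -- sum.
    have hcross : ∫ ω, (∑ j ∈ S, ξ j ω) ^ (2 * q - 1) * ξ i ω ∂P = 0 := by
      have h1 : IndepFun (fun ω => (∑ j ∈ S, ξ j ω) ^ (2 * q - 1)) (ξ i) P :=
        hindS.comp (φ := fun r : ℝ => r ^ (2 * q - 1)) (ψ := id) (by fun_prop) measurable_id
      rw [h1.integral_fun_mul_eq_mul_integral (hS.aestronglyMeasurable.pow _)
        (hm i).aestronglyMeasurable, h0, mul_zero]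
    set A := C * N ^ (q - 1) * μ with hA
    have hA0 : 0 ≤ A := by positivity
    calc ∫ ω, (∑ j ∈ insert i S, ξ j ω) ^ (2 * q) ∂P
        ≤ ∫ ω, ((1 + N⁻¹) * (∑ j ∈ S, ξ j ω) ^ (2 * q) +
            2 * q * ((∑ j ∈ S, ξ j ω) ^ (2 * q - 1) * ξ i ω) +
            C * N ^ (q - 1) * ξ i ω ^ (2 * q)) ∂P := by
          refine integral_mono ?_ (((hI1.const_mul _).add (hI2.const_mul _)).add
            (hI3.const_mul _)) fun ω => ?_
          · exact integrable_even_pow hq (memLp_finsetSum (insert i S) fun j _ => hm j)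
          · simp only
            rw [Finset.sum_insert hi, add_comm (ξ i ω)]
            exact hCq N hN _ _
      _ = (1 + N⁻¹) * ∫ ω, (∑ j ∈ S, ξ j ω) ^ (2 * q) ∂P +
            C * N ^ (q - 1) * ∫ ω, ξ i ω ^ (2 * q) ∂P := by
          have hI12 : Integrable (fun ω => (1 + N⁻¹) * (∑ j ∈ S, ξ j ω) ^ (2 * q) +
              2 * q * ((∑ j ∈ S, ξ j ω) ^ (2 * q - 1) * ξ i ω)) P :=
            (hI1.const_mul _).add (hI2.const_mul _)
          rw [integral_add hI12 (hI3.const_mul _),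
            integral_add (hI1.const_mul _) (hI2.const_mul _), integral_const_mul, integral_const_mul,
            integral_const_mul, hcross, mul_zero, add_zero]
      _ ≤ (1 + N⁻¹) * ((1 + N⁻¹) ^ S.card * (S.card * A)) + A := by
          gcongr
          exact mul_le_mul_of_nonneg_left (hμ i) (by positivity)
      _ ≤ (1 + N⁻¹) * ((1 + N⁻¹) ^ S.card * (S.card * A)) + (1 + N⁻¹) ^ (S.card + 1) * A := by
          gcongr
          refine le_mul_of_one_le_left hA0 (one_le_pow₀ ?_)
          have : 0 < N⁻¹ := by positivity
          linarith
      _ = _ := by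
          rw [Finset.card_insert_of_notMem hi]
          push_cast
          ring

/-- Taking N = n keeps the accumulated factor (1 + 1/n)^n below e < 3. The n increments of order
n^(q-1) add up to n^q, the rate of the Marcinkiewicz–Zygmund inequality. -/
lemma integral_average_even_pow_le [IsProbabilityMeasure P] {q : ℕ} (hq : 1 ≤ q) {C : ℝ}
    (hC : 0 < C)
    (hCq : ∀ N : ℝ, 1 ≤ N → ∀ s x : ℝ,
      (s + x) ^ (2 * q) ≤ (1 + N⁻¹) * s ^ (2 * q) + 2 * q * (s ^ (2 * q - 1) * x) +
        C * N ^ (q - 1) * x ^ (2 * q))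
    {n : ℕ} (hn : 1 ≤ n) {ξ : Fin n → Ω → ℝ} (hind : iIndepFun ξ P)
    (hm : ∀ i, MemLp (ξ i) ((2 * q : ℕ) : ℝ≥0∞) P) (h0 : ∀ i, ∫ ω, ξ i ω ∂P = 0) {μ : ℝ}
    (hμ : ∀ i, ∫ ω, ξ i ω ^ (2 * q) ∂P ≤ μ) :
    ∫ ω, ((n : ℝ)⁻¹ * ∑ i, ξ i ω) ^ (2 * q) ∂P ≤ 3 * C * μ / (n : ℝ) ^ q := by
  have hn1 : (1 : ℝ) ≤ n := by exact_mod_cast hn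
  have hn0 : (0 : ℝ) < n := by linarith
  have hμ0 : 0 ≤ μ := le_trans (integral_nonneg fun ω => Even.pow_nonneg ⟨q, by ring⟩ _)
    (hμ ⟨0, hn⟩)
  have h := integral_sum_even_pow_le hq hC hCq hind hm h0 hμ hn1 Finset.univ
  rw [Finset.card_univ, Fintype.card_fin] at h
  have he : (1 + (n : ℝ)⁻¹) ^ n ≤ 3 := by
    calc (1 + (n : ℝ)⁻¹) ^ n ≤ Real.exp ((n : ℝ)⁻¹) ^ n := by
          gcongr
          rw [add_comm]
          exact Real.add_one_le_exp _
      _ = Real.exp 1 := by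
        rw [← Real.exp_nat_mul, mul_inv_cancel₀ hn0.ne']
      _ ≤ 3 := by have := Real.exp_one_lt_d9; linarith
  simp_rw [mul_pow]
  rw [integral_const_mul]
  have e : (n : ℝ) ^ (2 * q) = (n : ℝ) ^ q * (n * (n : ℝ) ^ (q - 1)) := by
    rw [← pow_succ', Nat.sub_add_cancel hq]; ring
  calc (n : ℝ)⁻¹ ^ (2 * q) * ∫ ω, (∑ i, ξ i ω) ^ (2 * q) ∂P
      ≤ (n : ℝ)⁻¹ ^ (2 * q) * (3 * (n * (C * (n : ℝ) ^ (q - 1) * μ))) := by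
        gcongr
        exact h.trans (by gcongr)
    _ = _ := by
      rw [inv_pow, e]
      field_simp

lemma sum_sq_pow_le {ι : Type*} [Fintype ι] (a : ι → ℝ) {k : ℕ} (hk : 1 ≤ k) :
    (∑ i, a i ^ 2) ^ k ≤ (Fintype.card ι : ℝ) ^ (k - 1) * ∑ i, a i ^ (2 * k) := by
  have h := Real.rpow_sum_le_const_mul_sum_rpow_of_nonneg (p := k) (s := Finset.univ)
    (f := fun i => a i ^ 2) (by exact_mod_cast hk) fun _ _ => sq_nonneg _
  have e : ((k : ℝ) - 1) = ((k - 1 : ℕ) : ℝ) := by push_cast [Nat.cast_sub hk]; ring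
  simp_rw [e, Real.rpow_natCast, ← pow_mul] at h
  simpa using h

end Moments

/-! ### Moments of products, sums and sums of squares. -/

section MomentTools

variable {Ω : Type*} [MeasurableSpace Ω] {P : Measure Ω}

lemma memLp_of_integrable_even_pow {q : ℕ} (hq : 1 ≤ q) {f : Ω → ℝ}
    (hf : AEStronglyMeasurable f P) (h : Integrable (fun ω => f ω ^ (2 * q)) P) :
    MemLp f ((2 * q : ℕ) : ℝ≥0∞) P := by
  rw [← integrable_norm_rpow_iff hf (by exact_mod_cast (by omega : 2 * q ≠ 0))
    (ENNReal.natCast_ne_top _)]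
  refine h.congr (Eventually.of_forall fun ω => ?_)
  simp only [ENNReal.toReal_natCast, Real.rpow_natCast, Real.norm_eq_abs]
  exact (Even.pow_abs ⟨q, by ring⟩ _).symm

lemma even_pow_moment {q : ℕ} (hq : 1 ≤ q) {f : Ω → ℝ} (hf : AEStronglyMeasurable f P) {η : ℝ}
    (hη : 0 ≤ η) (h : ∫⁻ ω, ‖f ω‖ₑ ^ (2 * q) ∂P ≤ ENNReal.ofReal η) :
    MemLp f ((2 * q : ℕ) : ℝ≥0∞) P ∧ ∫ ω, f ω ^ (2 * q) ∂P ≤ η := by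
  have h0 : ∀ ω, 0 ≤ f ω ^ (2 * q) := fun ω => Even.pow_nonneg ⟨q, by ring⟩ _
  have h1 : ∀ ω, ‖f ω‖ₑ ^ (2 * q) = ENNReal.ofReal (f ω ^ (2 * q)) := fun ω => by
    rw [← enorm_pow, Real.enorm_eq_ofReal (h0 ω)]
  have hint : Integrable (fun ω => f ω ^ (2 * q)) P := by
    refine ⟨hf.pow _, ?_⟩
    rw [HasFiniteIntegral]
    simp_rw [enorm_pow]
    exact h.trans_lt ENNReal.ofReal_lt_top
  refine ⟨memLp_of_integrable_even_pow hq hf hint, ?_⟩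
  rw [integral_eq_lintegral_of_nonneg_ae (Eventually.of_forall h0) (hf.pow _)]
  refine ENNReal.toReal_le_of_le_ofReal hη ?_
  simpa only [h1] using h

lemma mul_even_pow_le (q : ℕ) (a b : ℝ) :
    (a * b) ^ (2 * q) ≤ a ^ (2 * (2 * q)) + b ^ (2 * (2 * q)) := by
  have h1 : a ^ (2 * (2 * q)) = (a ^ (2 * q)) ^ 2 := by rw [← pow_mul]; ring_nf
  have h2 : b ^ (2 * (2 * q)) = (b ^ (2 * q)) ^ 2 := by rw [← pow_mul]; ring_nf
  rw [h1, h2, mul_pow]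
  nlinarith [sq_nonneg (a ^ (2 * q) - b ^ (2 * q)), sq_nonneg (a ^ (2 * q)),
    sq_nonneg (b ^ (2 * q))]

lemma add_even_pow_le (q : ℕ) (a b : ℝ) :
    (a + b) ^ (2 * q) ≤ 2 ^ (2 * q) * (a ^ (2 * q) + b ^ (2 * q)) := by
  have he : Even (2 * q) := ⟨q, by ring⟩
  rw [← he.pow_abs (a + b), ← he.pow_abs a, ← he.pow_abs b]
  calc |a + b| ^ (2 * q) ≤ (|a| + |b|) ^ (2 * q) := by gcongr; exact abs_add_le a b
    _ ≤ 2 ^ (2 * q - 1) * (|a| ^ (2 * q) + |b| ^ (2 * q)) :=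
      add_pow_le (abs_nonneg a) (abs_nonneg b) _
    _ ≤ _ := by
      gcongr
      · norm_num
      · omega

/-- A product of two variables keeps half the moment order, which is why 4k moments are assumed in
order to get 2k for the scores. -/
lemma memLp_mul_even {q : ℕ} (hq : 1 ≤ q) {f g : Ω → ℝ}
    (hf : MemLp f ((2 * (2 * q) : ℕ) : ℝ≥0∞) P) (hg : MemLp g ((2 * (2 * q) : ℕ) : ℝ≥0∞) P) :
    MemLp (fun ω => f ω * g ω) ((2 * q : ℕ) : ℝ≥0∞) P ∧
      ∫ ω, (f ω * g ω) ^ (2 * q) ∂P ≤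
        ∫ ω, f ω ^ (2 * (2 * q)) ∂P + ∫ ω, g ω ^ (2 * (2 * q)) ∂P := by
  have hq2 : 1 ≤ 2 * q := by omega
  have hI1 := integrable_even_pow hq2 hf
  have hI2 := integrable_even_pow hq2 hg
  have hm : AEStronglyMeasurable (fun ω => f ω * g ω) P :=
    hf.aestronglyMeasurable.mul hg.aestronglyMeasurable
  have hI : Integrable (fun ω => (f ω * g ω) ^ (2 * q)) P := by
    refine (hI1.add hI2).mono' (hm.pow _) (Eventually.of_forall fun ω => ?_)
    rw [Real.norm_of_nonneg (Even.pow_nonneg ⟨q, by ring⟩ _)]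
    exact mul_even_pow_le q _ _
  refine ⟨memLp_of_integrable_even_pow hq hm hI, ?_⟩
  rw [← integral_add hI1 hI2]
  exact integral_mono hI (hI1.add hI2) fun ω => mul_even_pow_le q _ _

lemma integral_add_even_pow_le {q : ℕ} (hq : 1 ≤ q) {f g : Ω → ℝ}
    (hf : MemLp f ((2 * q : ℕ) : ℝ≥0∞) P) (hg : MemLp g ((2 * q : ℕ) : ℝ≥0∞) P) :
    ∫ ω, (f ω + g ω) ^ (2 * q) ∂P ≤
      2 ^ (2 * q) * (∫ ω, f ω ^ (2 * q) ∂P + ∫ ω, g ω ^ (2 * q) ∂P) := by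
  have hI1 := integrable_even_pow hq hf
  have hI2 := integrable_even_pow hq hg
  rw [← integral_add hI1 hI2, ← integral_const_mul]
  exact integral_mono (integrable_even_pow hq (hf.add hg)) ((hI1.add hI2).const_mul _)
    fun ω => add_even_pow_le q _ _

lemma integral_sq_le_one_add [IsProbabilityMeasure P] {q : ℕ} (hq : 1 ≤ q) {f : Ω → ℝ}
    (hf : MemLp f ((2 * q : ℕ) : ℝ≥0∞) P) :
    ∫ ω, f ω ^ 2 ∂P ≤ 1 + ∫ ω, f ω ^ (2 * q) ∂P := by
  have hI := integrable_even_pow hq hf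
  have h2 : MemLp f 2 P := hf.mono_exponent (by exact_mod_cast (by omega : 2 ≤ 2 * q))
  calc ∫ ω, f ω ^ 2 ∂P ≤ ∫ ω, (1 + f ω ^ (2 * q)) ∂P := by
        refine integral_mono h2.integrable_sq ((integrable_const _).add hI) fun ω => ?_
        simp only [pow_mul]
        rcases le_total (f ω ^ 2) 1 with h | h
        · have : 0 ≤ (f ω ^ 2) ^ q := by positivity
          linarith
        · have : f ω ^ 2 ≤ (f ω ^ 2) ^ q := le_self_pow₀ h (by omega)
          linarith
    _ = _ := by rw [integral_add (integrable_const _) hI]; simp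

/-- Moments of a sum of squares. -/
lemma integral_sum_sq_pow_le {ι : Type*} [Fintype ι] {τ : ι → Ω → ℝ} {k : ℕ} (hk : 1 ≤ k)
    (hm : ∀ i, MemLp (τ i) ((2 * k : ℕ) : ℝ≥0∞) P) {A : ℝ}
    (hA : ∀ i, ∫ ω, τ i ω ^ (2 * k) ∂P ≤ A) :
    Integrable (fun ω => (∑ i, τ i ω ^ 2) ^ k) P ∧
      ∫ ω, (∑ i, τ i ω ^ 2) ^ k ∂P ≤ (Fintype.card ι : ℝ) ^ k * A := by
  have hI : ∀ i, Integrable (fun ω => τ i ω ^ (2 * k)) P := fun i => integrable_even_pow hk (hm i)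
  have hB : Integrable (fun ω => (Fintype.card ι : ℝ) ^ (k - 1) * ∑ i, τ i ω ^ (2 * k)) P :=
    (integrable_finsetSum _ fun i _ => hI i).const_mul _
  have hint : Integrable (fun ω => (∑ i, τ i ω ^ 2) ^ k) P := by
    refine hB.mono' ?_ (Eventually.of_forall fun ω => ?_)
    · exact (Finset.aestronglyMeasurable_fun_sum _
        fun i _ => (hm i).aestronglyMeasurable.pow 2).pow k
    · rw [Real.norm_of_nonneg (pow_nonneg (Finset.sum_nonneg fun i _ => sq_nonneg _) _)]
      exact sum_sq_pow_le _ hk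
  refine ⟨hint, ?_⟩
  calc _ ≤ _ := integral_mono hint hB fun ω => sum_sq_pow_le _ hk
    _ = (Fintype.card ι : ℝ) ^ (k - 1) * ∑ i, ∫ ω, τ i ω ^ (2 * k) ∂P := by
      rw [integral_const_mul, integral_finsetSum _ fun i _ => hI i]
    _ ≤ (Fintype.card ι : ℝ) ^ (k - 1) * ∑ _i : ι, A := by
      gcongr with i
      exact hA i
    _ = (Fintype.card ι : ℝ) ^ (k - 1) * Fintype.card ι * A := by simp; ring
    _ = _ := by rw [← pow_succ, Nat.sub_add_cancel hk]

/-- A product moment bounded by the moments of the factors, with weights. -/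
lemma integral_mul_pow_le {T F : Ω → ℝ} (hT : AEStronglyMeasurable T P)
    (hF : AEStronglyMeasurable F P) (hT0 : ∀ ω, 0 ≤ T ω) (hF0 : ∀ ω, 0 ≤ F ω) {k : ℕ}
    (hk : 1 ≤ k) (hTk : Integrable (fun ω => T ω ^ k) P) (hFk : Integrable (fun ω => F ω ^ k) P)
    {a c : ℝ} (ha : 0 < a) (hc : 0 < c) :
    Integrable (fun ω => T ω * F ω ^ (k - 1)) P ∧
      ∫ ω, T ω * F ω ^ (k - 1) ∂P ≤ (a * c ^ (k - 1))⁻¹ *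
        (a ^ k * ∫ ω, T ω ^ k ∂P + c ^ k * ∫ ω, F ω ^ k ∂P) := by
  -- With x = aT and y = cF this is x y^(k-1) ≤ x^k + y^k, seen by bounding both by the larger. The
  -- weights are later chosen to normalize both k-th moments.
  have hpt : ∀ ω, T ω * F ω ^ (k - 1) ≤
      (a * c ^ (k - 1))⁻¹ * (a ^ k * T ω ^ k + c ^ k * F ω ^ k) := by
    intro ω
    rw [le_inv_mul_iff₀ (by positivity)]
    have h1 : a * c ^ (k - 1) * (T ω * F ω ^ (k - 1)) = (a * T ω) * (c * F ω) ^ (k - 1) := by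
      rw [mul_pow]; ring
    rw [h1, ← mul_pow, ← mul_pow]
    have hx : 0 ≤ a * T ω := mul_nonneg ha.le (hT0 ω)
    have hy : 0 ≤ c * F ω := mul_nonneg hc.le (hF0 ω)
    have e : ∀ r : ℝ, r ^ k = r * r ^ (k - 1) := fun r => by
      rw [← pow_succ', Nat.sub_add_cancel hk]
    rcases le_total (a * T ω) (c * F ω) with h | h
    · calc (a * T ω) * (c * F ω) ^ (k - 1) ≤ (c * F ω) * (c * F ω) ^ (k - 1) := by gcongr
        _ = (c * F ω) ^ k := (e _).symm
        _ ≤ _ := le_add_of_nonneg_left (by positivity)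
    · calc (a * T ω) * (c * F ω) ^ (k - 1) ≤ (a * T ω) * (a * T ω) ^ (k - 1) := by gcongr
        _ = (a * T ω) ^ k := (e _).symm
        _ ≤ _ := le_add_of_nonneg_right (by positivity)
  have hB : Integrable (fun ω => (a * c ^ (k - 1))⁻¹ * (a ^ k * T ω ^ k + c ^ k * F ω ^ k)) P :=
    ((hTk.const_mul _).add (hFk.const_mul _)).const_mul _
  have hint : Integrable (fun ω => T ω * F ω ^ (k - 1)) P := by
    refine hB.mono' (hT.mul (hF.pow _)) (Eventually.of_forall fun ω => ?_)
    rw [Real.norm_of_nonneg (mul_nonneg (hT0 ω) (pow_nonneg (hF0 ω) _))]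
    exact hpt ω
  refine ⟨hint, (integral_mono hint hB hpt).trans (le_of_eq ?_)⟩
  rw [integral_const_mul, integral_add (hTk.const_mul _) (hFk.const_mul _), integral_const_mul,
    integral_const_mul]

end MomentTools

/-! ### Covariance operators and moments of the regressor -/

/-- The span of a countable Hilbert basis is dense, so the space is separable. This makes the
identity strongly measurable under the law of X, as `covOp_inner` requires. -/
instance : SecondCountableTopology L2 := by
  have h1 : TopologicalSpace.IsSeparable (Set.range trigBasis) :=
    (Set.countable_range _).isSeparable
  have h2 := (h1.span (R := ℝ)).closure
  have h3 := trigBasis.dense_span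
  have h4 : closure ((Submodule.span ℝ (Set.range trigBasis) : Submodule ℝ L2) : Set L2) =
      Set.univ := by
    rw [← Submodule.topologicalClosure_coe, h3]
    rfl
  rw [h4] at h2
  have : TopologicalSpace.SeparableSpace L2 := TopologicalSpace.isSeparable_univ_iff.1 h2
  exact UniformSpace.secondCountable_of_separable L2

section Regressor

variable {Ω : Type u} [MeasurableSpace Ω] {P : Measure Ω}

lemma covOp_inner {X : Ω → L2} (hX : AEMeasurable X P) (h2 : MemLp X 2 P) (f g : L2) :
    inner ℝ (covOp P X f) g = ∫ ω, inner ℝ f (X ω) * inner ℝ g (X ω) ∂P := by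
  have hid : MemLp id 2 (P.map X) :=
    (memLp_map_measure_iff aestronglyMeasurable_id hX).2 h2
  rw [covOp, covarianceOperator_inner hid, integral_map hX]
  exact (Measurable.aestronglyMeasurable (by fun_prop))

lemma covOp_symm (X : Ω → L2) (f g : L2) :
    inner ℝ (covOp P X f) g = inner ℝ f (covOp P X g) :=
  isPositive_covarianceOperator.isSymmetric f g

lemma covOp_nonneg (X : Ω → L2) (f : L2) : 0 ≤ inner ℝ (covOp P X f) f :=
  isPositive_covarianceOperator.inner_nonneg_left f

lemma covEntry_symm (X : Ω → L2) (j l : ℕ) : covEntry P X j l = covEntry P X l j := by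
  rw [covEntry, covEntry, coord, coord, covOp_symm, real_inner_comm]

variable {υ : ℕ → ℝ} {d η : ℝ} {k : ℕ} {X : Ω → L2} {ε : Ω → ℝ}

/-- Jensen's inequality for t^(2k) at the points c_l²/v_l with weights v_l/S. With v_l the
variances, moments of ‖X‖ are bounded by the trace of Γ and the moments of standardized coordinates.
-/
lemma sum_sq_pow_le_of_weights (v c : ℕ → ℝ) (hv : ∀ l, 0 < v l) {N : ℕ} {S : ℝ}
    (hS : S = ∑ l ∈ Finset.range N, v l) (hS0 : 0 < S) (k : ℕ) :
    (∑ l ∈ Finset.range N, c l ^ 2) ^ (2 * k) ≤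
      ∑ l ∈ Finset.range N, S ^ (2 * k) * (v l / S) * |c l / Real.sqrt (v l)| ^ (4 * k) := by
  have hj := Real.pow_arith_mean_le_arith_mean_pow (Finset.range N)
    (fun l => v l / S) (fun l => c l ^ 2 / v l)
    (fun l _ => div_nonneg (hv l).le hS0.le)
    (by rw [← Finset.sum_div, ← hS, div_self hS0.ne'])
    (fun l _ => div_nonneg (sq_nonneg _) (hv l).le) (2 * k)
  have e1 : ∀ l, v l / S * (c l ^ 2 / v l) = c l ^ 2 / S := fun l => by
    have := (hv l).ne'
    field_simp
  simp_rw [e1] at hj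
  rw [← Finset.sum_div, div_pow, div_le_iff₀ (pow_pos hS0 _), Finset.sum_mul] at hj
  refine hj.trans (Finset.sum_le_sum fun l _ => le_of_eq ?_)
  have e2 : |c l / Real.sqrt (v l)| ^ (4 * k) = (c l ^ 2 / v l) ^ (2 * k) := by
    rw [show 4 * k = 2 * (2 * k) by ring, pow_mul, sq_abs, div_pow, Real.sq_sqrt (hv l).le]
  rw [e2]
  ring

lemma lintegral_sum_sq_pow_le_of_weights {c : ℕ → Ω → ℝ} (hc : ∀ l, AEMeasurable (c l) P)
    {v : ℕ → ℝ} (hv : ∀ l, 0 < v l) (hk : 1 ≤ k)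
    (hm : ∀ l, ∫⁻ ω, ‖c l ω / Real.sqrt (v l)‖ₑ ^ (4 * k) ∂P ≤ ENNReal.ofReal η)
    {V : ℝ} (N : ℕ) (hV : ∑ l ∈ Finset.range N, v l ≤ V) :
    ∫⁻ ω, ENNReal.ofReal ((∑ l ∈ Finset.range N, c l ω ^ 2) ^ (2 * k)) ∂P ≤
      ENNReal.ofReal (V ^ (2 * k)) * ENNReal.ofReal η := by
  rcases Nat.eq_zero_or_pos N with rfl | hN
  · have : 2 * k ≠ 0 := by omega
    simp [this]
  obtain ⟨S, hS⟩ : ∃ S, S = ∑ l ∈ Finset.range N, v l := ⟨_, rfl⟩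
  have hS0 : 0 < S := by
    rw [hS]; exact Finset.sum_pos (fun l _ => hv l) ⟨0, Finset.mem_range.2 hN⟩
  have hw : ∀ l, 0 ≤ S ^ (2 * k) * (v l / S) := fun l =>
    mul_nonneg (pow_nonneg hS0.le _) (div_nonneg (hv l).le hS0.le)
  have hme : ∀ l, AEMeasurable (fun ω => ‖c l ω / Real.sqrt (v l)‖ₑ ^ (4 * k)) P := fun l =>
    (((hc l).div_const _).enorm).pow_const _
  calc ∫⁻ ω, ENNReal.ofReal ((∑ l ∈ Finset.range N, c l ω ^ 2) ^ (2 * k)) ∂P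
      ≤ ∫⁻ ω, ∑ l ∈ Finset.range N, ENNReal.ofReal (S ^ (2 * k) * (v l / S)) *
          ‖c l ω / Real.sqrt (v l)‖ₑ ^ (4 * k) ∂P := by
        refine lintegral_mono fun ω => (ENNReal.ofReal_le_ofReal
          (sum_sq_pow_le_of_weights v (fun l => c l ω) hv hS hS0 k)).trans (le_of_eq ?_)
        rw [ENNReal.ofReal_sum_of_nonneg fun l _ =>
          mul_nonneg (hw l) (pow_nonneg (abs_nonneg _) _)]
        refine Finset.sum_congr rfl fun l _ => ?_
        rw [ENNReal.ofReal_mul (hw l), ENNReal.ofReal_pow (abs_nonneg _), ← Real.norm_eq_abs,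
          ofReal_norm]
    _ = ∑ l ∈ Finset.range N, ENNReal.ofReal (S ^ (2 * k) * (v l / S)) *
          ∫⁻ ω, ‖c l ω / Real.sqrt (v l)‖ₑ ^ (4 * k) ∂P := by
        rw [lintegral_finsetSum' _ fun l _ => (hme l).const_mul _]
        exact Finset.sum_congr rfl fun l _ => lintegral_const_mul'' _ (hme l)
    _ ≤ ∑ l ∈ Finset.range N, ENNReal.ofReal (S ^ (2 * k) * (v l / S)) *
          ENNReal.ofReal η := by
        gcongr with l
        exact hm l
    _ = ENNReal.ofReal (S ^ (2 * k)) * ENNReal.ofReal η := by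
        rw [← Finset.sum_mul, ← ENNReal.ofReal_sum_of_nonneg fun l _ => hw l, ← Finset.mul_sum,
          ← Finset.sum_div, ← hS, div_self hS0.ne', mul_one]
    _ ≤ _ := by
        gcongr
        rwa [hS]

/-- The moments of the norm of the regressor. -/
lemma RegressorClass.lintegral_norm_pow_le (h : RegressorClass P (4 * k) η X) (hk : 1 ≤ k)
    {V : ℝ} (hV : ∀ N, ∑ l ∈ Finset.range N, covEntry P X l l ≤ V) :
    ∫⁻ ω, ‖X ω‖ₑ ^ (2 * (2 * k)) ∂P ≤ ENNReal.ofReal (V ^ (2 * k) * η) := by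
  have hV0 : 0 ≤ V := by simpa using hV 0
  -- Parseval writes the norm as a limit of finite sums, whose moments are bounded uniformly in N;
  -- Fatou's lemma passes to the limit.
  have hlim : ∀ ω, ‖X ω‖ₑ ^ (2 * (2 * k)) = liminf (fun N : ℕ =>
      ENNReal.ofReal ((∑ l ∈ Finset.range N, coord (X ω) l ^ 2) ^ (2 * k))) atTop := by
    intro ω
    have h1 := (hasSum_coord_sq (X ω)).tendsto_sum_nat.pow (2 * k)
    have h2 := (ENNReal.continuous_ofReal.tendsto _).comp h1
    refine Eq.trans ?_ h2.liminf_eq.symm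
    rw [← pow_mul, ENNReal.ofReal_pow (norm_nonneg _), ofReal_norm]
  simp_rw [hlim]
  refine (lintegral_liminf_le' fun N => ?_).trans ?_
  · refine (AEMeasurable.pow_const ?_ _).ennreal_ofReal
    refine Finset.aemeasurable_fun_sum _ fun l _ => ?_
    exact ((measurable_coord l).comp_aemeasurable h.aemeasurable).pow_const _
  · rw [ENNReal.ofReal_mul (by positivity)]
    refine liminf_le_of_le (by isBoundedDefault) fun b hb => ?_
    obtain ⟨N, hN⟩ := hb.exists
    exact hN.trans (lintegral_sum_sq_pow_le_of_weights
      (fun l => (measurable_coord l).comp_aemeasurable h.aemeasurable)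
      (fun l => h.pos (ψ l) (orthonormal_ψ.ne_zero l)) hk h.moment_coord N (hV N))

end Regressor

/-! ### Averages over the sample -/

section Sample

variable {Ω : Type u} [MeasurableSpace Ω] {P : Measure Ω} [IsProbabilityMeasure P]
  {X₀ : Ω → L2} {ε₀ : Ω → ℝ} {n : ℕ} {X : Fin n → Ω → L2} {ε : Fin n → Ω → ℝ}

lemma IsSample.average_moment (hs : IsSample P X₀ ε₀ X ε) (hn : 1 ≤ n) {φ : L2 × ℝ → ℝ}
    (hφ : Measurable φ) {q : ℕ} (hq : 1 ≤ q) {C : ℝ} (hC : 0 < C)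
    (hCq : ∀ N : ℝ, 1 ≤ N → ∀ s x : ℝ,
      (s + x) ^ (2 * q) ≤ (1 + N⁻¹) * s ^ (2 * q) + 2 * q * (s ^ (2 * q - 1) * x) +
        C * N ^ (q - 1) * x ^ (2 * q))
    (hm : MemLp (fun ω => φ (X₀ ω, ε₀ ω)) ((2 * q : ℕ) : ℝ≥0∞) P)
    (h0 : ∫ ω, φ (X₀ ω, ε₀ ω) ∂P = 0) {μ : ℝ}
    (hμ : ∫ ω, φ (X₀ ω, ε₀ ω) ^ (2 * q) ∂P ≤ μ) :
    MemLp (fun ω => (n : ℝ)⁻¹ * ∑ i, φ (X i ω, ε i ω)) ((2 * q : ℕ) : ℝ≥0∞) P ∧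
      ∫ ω, ((n : ℝ)⁻¹ * ∑ i, φ (X i ω, ε i ω)) ^ (2 * q) ∂P ≤ 3 * C * μ / (n : ℝ) ^ q := by
  have hid : ∀ i, IdentDistrib (fun ω => φ (X i ω, ε i ω)) (fun ω => φ (X₀ ω, ε₀ ω)) P P :=
    fun i => (hs.identDistrib i).comp hφ
  have hmi : ∀ i, MemLp (fun ω => φ (X i ω, ε i ω)) ((2 * q : ℕ) : ℝ≥0∞) P :=
    fun i => (hid i).memLp_iff.2 hm
  refine ⟨(memLp_finsetSum Finset.univ fun i _ => hmi i).const_mul _, ?_⟩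
  refine integral_average_even_pow_le hq hC hCq hn (ξ := fun i ω => φ (X i ω, ε i ω)) ?_ hmi
    (fun i => by rw [(hid i).integral_eq, h0]) fun i => ?_
  · exact hs.indep.comp (fun _ => φ) fun _ => hφ
  · have h1 : IdentDistrib (fun ω => φ (X i ω, ε i ω) ^ (2 * q))
        (fun ω => φ (X₀ ω, ε₀ ω) ^ (2 * q)) P P :=
      (hid i).comp (u := fun r : ℝ => r ^ (2 * q)) (by fun_prop)
    rw [h1.integral_eq]
    exact hμ

end Sample

/-! ### The score variables -/

section Scores

variable {Ω : Type u} [MeasurableSpace Ω] {P : Measure Ω} {υ : ℕ → ℝ}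
  {d η : ℝ} {k : ℕ} {X : Ω → L2} {ε : Ω → ℝ}

lemma aestronglyMeasurable_inner_left {X : Ω → L2} (hX : AEMeasurable X P) (h : L2) :
    AEStronglyMeasurable (fun ω => (inner ℝ h (X ω) : ℝ)) P :=
  (AEMeasurable.aestronglyMeasurable
    ((by fun_prop : Measurable fun x : L2 => (inner ℝ h x : ℝ)).comp_aemeasurable hX))

lemma sum_covEntry_le (hA : ModelAssumptions P υ d η k X ε) (hυ : Antitone υ)
    (hpos : ∀ j, 0 < υ j) (hsum : Summable υ) (hd : 0 < d) (N : ℕ) :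
    ∑ l ∈ Finset.range N, covEntry P X l l ≤ d * ∑' l, υ l := by
  calc ∑ l ∈ Finset.range N, covEntry P X l l ≤ ∑ l ∈ Finset.range N, d * υ l :=
        Finset.sum_le_sum fun l _ => hA.link.coord_apply_ψ_le hυ hpos hd l
    _ = d * ∑ l ∈ Finset.range N, υ l := (Finset.mul_sum _ _ _).symm
    _ ≤ _ := by
      gcongr
      exact hsum.sum_le_tsum _ fun l _ => (hpos l).le

lemma inner_moment (hA : ModelAssumptions P υ d η k X ε) (hk : 1 ≤ k) (hη : 0 ≤ η) {V : ℝ}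
    (hV : ∀ N, ∑ l ∈ Finset.range N, covEntry P X l l ≤ V) {h : L2} {H : ℝ} (hH : ‖h‖ ≤ H) :
    MemLp (fun ω => (inner ℝ h (X ω) : ℝ)) ((2 * (2 * k) : ℕ) : ℝ≥0∞) P ∧
      ∫ ω, (inner ℝ h (X ω) : ℝ) ^ (2 * (2 * k)) ∂P ≤
        H ^ (2 * (2 * k)) * (V ^ (2 * k) * η) := by
  have hV0 : 0 ≤ V := by simpa using hV 0
  have hH0 : 0 ≤ H := (norm_nonneg h).trans hH
  refine even_pow_moment (by omega)
    (aestronglyMeasurable_inner_left hA.regressor.aemeasurable h) (by positivity) ?_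
  rw [ENNReal.ofReal_mul (by positivity)]
  calc ∫⁻ ω, ‖(inner ℝ h (X ω) : ℝ)‖ₑ ^ (2 * (2 * k)) ∂P
      ≤ ∫⁻ ω, ENNReal.ofReal (H ^ (2 * (2 * k))) * ‖X ω‖ₑ ^ (2 * (2 * k)) ∂P := by
        refine lintegral_mono fun ω => ?_
        rw [ENNReal.ofReal_pow hH0, ← mul_pow]
        gcongr
        rw [← ofReal_norm, ← ofReal_norm, ← ENNReal.ofReal_mul hH0]
        exact ENNReal.ofReal_le_ofReal ((norm_inner_le_norm _ _).trans (by gcongr))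
    _ = ENNReal.ofReal (H ^ (2 * (2 * k))) * ∫⁻ ω, ‖X ω‖ₑ ^ (2 * (2 * k)) ∂P :=
        lintegral_const_mul'' _ ((hA.regressor.aemeasurable.enorm).pow_const _)
    _ ≤ _ := by
        gcongr
        exact hA.regressor.lintegral_norm_pow_le hk hV

lemma error_moment (hA : ModelAssumptions P υ d η k X ε) (hk : 1 ≤ k) (hη : 0 ≤ η) :
    MemLp ε ((2 * (2 * k) : ℕ) : ℝ≥0∞) P ∧ ∫ ω, ε ω ^ (2 * (2 * k)) ∂P ≤ η := by
  refine even_pow_moment (by omega) hA.error.memLp.aestronglyMeasurable hη ?_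
  have := hA.error.moment
  rwa [show 4 * k = 2 * (2 * k) by ring] at this

lemma integrable_inner_mul_inner (hA : ModelAssumptions P υ d η k X ε) (h r : L2) :
    Integrable (fun ω => (inner ℝ h (X ω) : ℝ) * inner ℝ r (X ω)) P := by
  have h2 : ∀ g : L2, MemLp (fun ω => (inner ℝ g (X ω) : ℝ)) 2 P := fun g =>
    hA.regressor.memLp.const_inner g
  exact (h2 h).integrable_mul (h2 r)

lemma integrable_error_mul_inner (hA : ModelAssumptions P υ d η k X ε) (r : L2) :
    Integrable (fun ω => ε ω * inner ℝ r (X ω)) P :=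
  hA.error.memLp.integrable_mul (hA.regressor.memLp.const_inner r)

/-- The lack of correlation is a vanishing Bochner integral in L²[0,1]; pairing with r commutes with
the integral. -/
lemma integral_error_mul_inner (hA : ModelAssumptions P υ d η k X ε) (r : L2) :
    ∫ ω, ε ω * inner ℝ r (X ω) ∂P = 0 := by
  have hi : Integrable (fun ω => ε ω • X ω) P :=
    memLp_one_iff_integrable.1 (hA.regressor.memLp.smul hA.error.memLp)
  have h := integral_inner (𝕜 := ℝ) hi r
  rw [hA.uncorrelated, inner_zero_right] at h
  simpa [real_inner_smul_right] using h

/-- The bound for the moments of the scores of the Galerkin residual. -/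
def scoreMoment (k : ℕ) (H V σ η : ℝ) : ℝ :=
  2 ^ (2 * (2 * k)) * (H ^ (2 * (2 * k)) * (V ^ (2 * k) * η) + σ ^ (2 * (2 * k)) * η) + η

/-- The mean is ⟨Γh, r⟩ plus a multiple of E[ε⟨r, X⟩]. The first vanishes by orthogonality, the
second by lack of correlation, so independence of X and ε is not required. -/
lemma score_moment (hA : ModelAssumptions P υ d η k X ε) (hk : 1 ≤ k) (hη : 0 ≤ η) {V : ℝ}
    (hV : ∀ N, ∑ l ∈ Finset.range N, covEntry P X l l ≤ V) {h r : L2} {H : ℝ} (hH : ‖h‖ ≤ H)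
    (σ : ℝ) (hr : MemLp (fun ω => (inner ℝ r (X ω) : ℝ)) ((2 * (2 * k) : ℕ) : ℝ≥0∞) P)
    (hrη : ∫ ω, (inner ℝ r (X ω) : ℝ) ^ (2 * (2 * k)) ∂P ≤ η)
    (horth : inner ℝ (covOp P X h) r = (0 : ℝ)) :
    MemLp (fun ω => (inner ℝ h (X ω) + σ * ε ω) * inner ℝ r (X ω)) ((2 * k : ℕ) : ℝ≥0∞) P ∧
    ∫ ω, (inner ℝ h (X ω) + σ * ε ω) * inner ℝ r (X ω) ∂P = 0 ∧
    ∫ ω, ((inner ℝ h (X ω) + σ * ε ω) * inner ℝ r (X ω)) ^ (2 * k) ∂P ≤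
      scoreMoment k H V σ η := by
  obtain ⟨h1, h2⟩ := inner_moment hA hk hη hV hH
  obtain ⟨h3, h4⟩ := error_moment hA hk hη
  have h5 : MemLp (fun ω => σ * ε ω) ((2 * (2 * k) : ℕ) : ℝ≥0∞) P := h3.const_mul σ
  have h6 : ∫ ω, (σ * ε ω) ^ (2 * (2 * k)) ∂P ≤ σ ^ (2 * (2 * k)) * η := by
    simp_rw [mul_pow]
    rw [integral_const_mul]
    exact mul_le_mul_of_nonneg_left h4 (Even.pow_nonneg ⟨2 * k, by ring⟩ _)
  have h7 := integral_add_even_pow_le (q := 2 * k) (by omega) h1 h5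
  have h8 := memLp_mul_even hk (h1.add h5) hr
  refine ⟨h8.1, ?_, ?_⟩
  · have e : ∀ ω, (inner ℝ h (X ω) + σ * ε ω) * (inner ℝ r (X ω) : ℝ) =
        inner ℝ h (X ω) * inner ℝ r (X ω) + σ * (ε ω * inner ℝ r (X ω)) := fun ω => by ring
    simp_rw [e]
    rw [integral_add (integrable_inner_mul_inner hA h r)
      ((integrable_error_mul_inner hA r).const_mul σ), integral_const_mul,
      integral_error_mul_inner hA, ← covOp_inner hA.regressor.aemeasurable hA.regressor.memLp,
      horth]
    ring
  · refine h8.2.trans ?_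
    rw [scoreMoment]
    refine add_le_add (h7.trans ?_) hrη
    gcongr

lemma gram_moment [IsProbabilityMeasure P] (hA : ModelAssumptions P υ d η k X ε) (hk : 1 ≤ k)
    {r r' : L2} {δ : ℝ}
    (hr : MemLp (fun ω => (inner ℝ r (X ω) : ℝ)) ((2 * (2 * k) : ℕ) : ℝ≥0∞) P)
    (hrη : ∫ ω, (inner ℝ r (X ω) : ℝ) ^ (2 * (2 * k)) ∂P ≤ η)
    (hr' : MemLp (fun ω => (inner ℝ r' (X ω) : ℝ)) ((2 * (2 * k) : ℕ) : ℝ≥0∞) P)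
    (hrη' : ∫ ω, (inner ℝ r' (X ω) : ℝ) ^ (2 * (2 * k)) ∂P ≤ η)
    (hcov : inner ℝ (covOp P X r) r' = δ) (hδ : |δ| ≤ 1) :
    MemLp (fun ω => inner ℝ r (X ω) * inner ℝ r' (X ω) - δ) ((2 * k : ℕ) : ℝ≥0∞) P ∧
    ∫ ω, (inner ℝ r (X ω) * inner ℝ r' (X ω) - δ) ∂P = 0 ∧
    ∫ ω, (inner ℝ r (X ω) * inner ℝ r' (X ω) - δ) ^ (2 * k) ∂P ≤
      2 ^ (2 * k) * (η + η + 1) := by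
  have h1 := memLp_mul_even hk hr hr'
  have h2 : MemLp (fun _ : Ω => -δ) ((2 * k : ℕ) : ℝ≥0∞) P := memLp_const _
  refine ⟨(h1.1.add h2).ae_eq (Eventually.of_forall fun ω => ?_), ?_, ?_⟩
  · exact (sub_eq_add_neg _ _).symm
  · rw [integral_sub (integrable_inner_mul_inner hA r r') (integrable_const _),
      ← covOp_inner hA.regressor.aemeasurable hA.regressor.memLp, hcov]
    simp
  · have h3 := integral_add_even_pow_le hk h1.1 h2
    simp only [← sub_eq_add_neg] at h3
    refine h3.trans ?_
    have h4 : ∫ _ω : Ω, (-δ) ^ (2 * k) ∂P ≤ 1 := by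
      rw [integral_const]
      simp only [probReal_univ, one_smul]
      rw [← Even.pow_abs ⟨k, by ring⟩, abs_neg]
      exact pow_le_one₀ (abs_nonneg _) hδ
    have h5 := h1.2
    gcongr
    linarith

end Scores

/-! ### The covariance matrix and its inverse square root -/

section CovMatrix

open Matrix

variable {Ω : Type u} [MeasurableSpace Ω] {P : Measure Ω} {X : Ω → L2} {D : ℕ}

lemma coord_covOp_trigPoly (w : Fin D → ℝ) (j : Fin D) :
    coord (covOp P X (trigPoly D (extendZero w))) j = (covMatrix P X D).mulVec w j := by
  rw [trigPoly, map_sum, coord_sum, ← Fin.sum_univ_eq_sum_range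
    (fun l => coord (covOp P X (extendZero w l • ψ l)) j), Matrix.mulVec, dotProduct]
  refine Finset.sum_congr rfl fun l _ => ?_
  rw [map_smul, coord_smul, extendZero_val, covMatrix, Matrix.of_apply, covEntry, mul_comm]

lemma inner_trigPoly_extendZero (f : L2) (v : Fin D → ℝ) :
    inner ℝ f (trigPoly D (extendZero v)) = v ⬝ᵥ coords D f := by
  rw [inner_trigPoly, ← Fin.sum_univ_eq_sum_range (fun l => extendZero v l * coord f l)]
  simp_rw [extendZero_val]
  rfl

lemma inner_covOp_trigPoly (v w : Fin D → ℝ) :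
    inner ℝ (covOp P X (trigPoly D (extendZero w))) (trigPoly D (extendZero v)) =
      v ⬝ᵥ (covMatrix P X D).mulVec w := by
  rw [inner_trigPoly_extendZero]
  congr 1
  ext j
  exact coord_covOp_trigPoly w j

lemma norm_sq_trigPoly_extendZero (v : Fin D → ℝ) :
    ‖trigPoly D (extendZero v)‖ ^ 2 = v ⬝ᵥ v := by
  rw [norm_sq_trigPoly, ← Fin.sum_univ_eq_sum_range (fun l => extendZero v l ^ 2)]
  simp_rw [extendZero_val, pow_two]
  rfl

lemma transpose_covMatrix : (covMatrix P X D)ᵀ = covMatrix P X D := by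
  ext j l
  exact covEntry_symm X _ _

lemma covMatrix_posDef (h : ∀ f : L2, f ≠ 0 → 0 < inner ℝ (covOp P X f) f) :
    (covMatrix P X D).PosDef := by
  refine Matrix.PosDef.of_dotProduct_mulVec_pos ?_ fun v hv => ?_
  · rw [Matrix.IsHermitian, Matrix.conjTranspose_eq_transpose_of_trivial, transpose_covMatrix]
  · rw [star_trivial, ← inner_covOp_trigPoly]
    refine h _ fun h0 => hv ?_
    have h1 := norm_sq_trigPoly_extendZero v
    rw [h0, norm_zero] at h1
    exact dotProduct_self_eq_zero.1 (by rw [← h1]; simp)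

open scoped MatrixOrder in
/-- The matrix `[Γ]_D^{-1/2}`. -/
def whiteningMatrix (P : Measure Ω) (X : Ω → L2) (D : ℕ) : Matrix (Fin D) (Fin D) ℝ :=
  CFC.sqrt (covMatrix P X D)⁻¹

open scoped MatrixOrder in
lemma transpose_whiteningMatrix : (whiteningMatrix P X D)ᵀ = whiteningMatrix P X D := by
  have := (Matrix.nonneg_iff_posSemidef.1 (CFC.sqrt_nonneg (covMatrix P X D)⁻¹)).isHermitian
  rw [whiteningMatrix]
  simpa [Matrix.IsHermitian] using this

open scoped MatrixOrder in
-- From R² = M⁻¹ one gets R(RM) = 1, and one-sided inverses of square matrices commute.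
lemma whiteningMatrix_mul_mul (h : ∀ f : L2, f ≠ 0 → 0 < inner ℝ (covOp P X f) f) :
    whiteningMatrix P X D * covMatrix P X D * whiteningMatrix P X D = 1 := by
  have hM := covMatrix_posDef (D := D) h
  have h1 : whiteningMatrix P X D * whiteningMatrix P X D = (covMatrix P X D)⁻¹ :=
    CFC.sqrt_mul_sqrt_self _ hM.inv.posSemidef.nonneg
  have h2 : whiteningMatrix P X D * (whiteningMatrix P X D * covMatrix P X D) = 1 := by
    rw [← Matrix.mul_assoc, h1,
      Matrix.nonsing_inv_mul _ ((Matrix.isUnit_iff_isUnit_det _).1 hM.isUnit)]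
  exact mul_eq_one_comm.1 h2

lemma whitened_eq_inner (ω : Ω) (j : Fin D) :
    whitened P X D ω j =
      inner ℝ (trigPoly D (extendZero (whiteningMatrix P X D j))) (X ω) := by
  rw [real_inner_comm, inner_trigPoly_extendZero]
  rfl

/-- The coefficients of the Galerkin approximation of `β`. -/
def galerkin (P : Measure Ω) (X : Ω → L2) (D : ℕ) (β : L2) : Fin D → ℝ :=
  (covMatrix P X D)⁻¹.mulVec (coords D (covOp P X β))

/-- These are the normal equations that `galerkin` solves. They center the scores and control the
approximation error. -/
lemma coord_covOp_sub_galerkin (h : ∀ f : L2, f ≠ 0 → 0 < inner ℝ (covOp P X f) f) (β : L2)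
    {j : ℕ} (hj : j < D) :
    coord (covOp P X (β - trigPoly D (extendZero (galerkin P X D β)))) j = 0 := by
  have hM := covMatrix_posDef (D := D) h
  have h1 := coord_covOp_trigPoly (P := P) (X := X) (galerkin P X D β) ⟨j, hj⟩
  rw [galerkin, Matrix.mulVec_mulVec,
    Matrix.mul_nonsing_inv _ ((Matrix.isUnit_iff_isUnit_det _).1 hM.isUnit),
    Matrix.one_mulVec] at h1
  rw [map_sub, coord_sub, sub_eq_zero]
  exact h1.symm

lemma inner_covOp_whiteningMatrix (h : ∀ f : L2, f ≠ 0 → 0 < inner ℝ (covOp P X f) f)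
    (j l : Fin D) :
    inner ℝ (covOp P X (trigPoly D (extendZero (whiteningMatrix P X D j))))
      (trigPoly D (extendZero (whiteningMatrix P X D l))) =
      (1 : Matrix (Fin D) (Fin D) ℝ) j l := by
  rw [inner_covOp_trigPoly, ← whiteningMatrix_mul_mul h, ← transpose_covMatrix,
    mulVec_transpose, dotProduct_comm, ← dotProduct_mulVec, Matrix.mul_assoc, Matrix.mul_apply]
  refine Finset.sum_congr rfl fun a _ => ?_
  congr 1
  rw [Matrix.mul_apply, Matrix.mulVec, dotProduct]
  refine Finset.sum_congr rfl fun b _ => ?_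
  rw [transpose_covMatrix, ← Matrix.transpose_apply (whiteningMatrix P X D) b l,
    transpose_whiteningMatrix]

end CovMatrix

/-! ### The risk for a fixed sample size -/

section Identities

open Matrix

variable {n D : ℕ} (c : Fin n → Fin D → ℝ) (y : Fin n → ℝ) (b : Fin D → ℝ)

lemma residual_apply (l : Fin D) :
    residual c y b l = (n : ℝ)⁻¹ * ∑ i, (y i - b ⬝ᵥ c i) * c i l := by
  simp only [residual, Pi.sub_apply, crossMoment, Matrix.mulVec, dotProduct, secondMoment,
    Matrix.of_apply]
  have h : ∑ a, ((n : ℝ)⁻¹ * ∑ i, c i l * c i a) * b a =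
      (n : ℝ)⁻¹ * ∑ i, (∑ a, b a * c i a) * c i l := by
    simp_rw [Finset.mul_sum, Finset.sum_mul, Finset.mul_sum]
    rw [Finset.sum_comm]
    refine Finset.sum_congr rfl fun i _ => Finset.sum_congr rfl fun a _ => ?_
    ring
  rw [h, ← mul_sub, ← Finset.sum_sub_distrib]
  simp_rw [sub_mul]

/-- Shows the whitened residual as a sample average, to which the moment inequality for averages
applies. -/
lemma mulVec_residual (R : Matrix (Fin D) (Fin D) ℝ) (j : Fin D) :
    R.mulVec (residual c y b) j = (n : ℝ)⁻¹ * ∑ i, (y i - b ⬝ᵥ c i) * (R j ⬝ᵥ c i) := by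
  simp only [Matrix.mulVec, dotProduct, residual_apply]
  simp_rw [Finset.mul_sum]
  rw [Finset.sum_comm]
  refine Finset.sum_congr rfl fun i _ => Finset.sum_congr rfl fun a _ => ?_
  ring

lemma whitened_secondMoment_apply (hn : 1 ≤ n) {R : Matrix (Fin D) (Fin D) ℝ} (hR : Rᵀ = R)
    (j l : Fin D) : (R * secondMoment c * R - 1) j l =
      (n : ℝ)⁻¹ * ∑ i, ((R j ⬝ᵥ c i) * (R l ⬝ᵥ c i) - (1 : Matrix (Fin D) (Fin D) ℝ) j l) := by
  have hn0 : (n : ℝ) ≠ 0 := by positivity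
  rw [Finset.sum_sub_distrib, Finset.sum_const, Finset.card_univ, Fintype.card_fin, nsmul_eq_mul,
    mul_sub, inv_mul_cancel_left₀ hn0, Matrix.sub_apply, Matrix.mul_assoc, Matrix.mul_apply]
  congr 1
  have hRl : ∀ a, R a l = R l a := fun a => by
    rw [← Matrix.transpose_apply R, hR]
  simp only [Matrix.mul_apply, secondMoment, Matrix.of_apply, dotProduct, hRl]
  simp_rw [Finset.mul_sum, Finset.sum_mul, Finset.mul_sum]
  simp_rw [Finset.sum_comm (s := (Finset.univ : Finset (Fin n)))]
  rw [Finset.sum_comm]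
  refine Finset.sum_congr rfl fun a _ => ?_
  refine Finset.sum_congr rfl fun a' _ => Finset.sum_congr rfl fun i _ => ?_
  ring

end Identities

/-! ### From averages of scores to a bound for the risk. -/

section Risk

open Matrix

variable {Ω : Type u} [MeasurableSpace Ω] {P : Measure Ω}
  {υ : ℕ → ℝ} {d η σ p ρ : ℝ} {s k m n : ℕ} {X₀ : Ω → L2} {ε₀ : Ω → ℝ}
  {X : Fin n → Ω → L2} {ε : Fin n → Ω → ℝ} {β g : L2}

/-- The first bound gives the bias rate; the second, free of m, makes the moments of the scores
bounded uniformly in the dimension. -/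
lemma norm_sub_galerkin_le (hA : ModelAssumptions P υ d η k X₀ ε₀) (hυ : Antitone υ)
    (hpos : ∀ j, 0 < υ j) (hd : 0 < d) (hp : 0 ≤ p) (hβ : β ∈ ellipsoid p ρ) (m : ℕ) :
    ∑ l : Fin (2 * m + 1), (galerkin P X₀ (2 * m + 1) β l - coord β l) ^ 2 ≤
        d ^ 4 * (((m : ℝ) + 1) ^ (-(2 * p)) * ρ) ∧
      ‖β - trigPoly (2 * m + 1) (extendZero (galerkin P X₀ (2 * m + 1) β))‖ ≤
        (1 + d ^ 2) * Real.sqrt ρ := by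
  set b := galerkin P X₀ (2 * m + 1) β with hb
  have h1 := hA.link.sum_galerkin_sub_sq_le hυ hpos hd (covOp_symm X₀) (covOp_nonneg X₀) (2 * m) β
    (extendZero b) fun j hj => coord_covOp_sub_galerkin hA.regressor.pos β hj
  have h2 := norm_sq_sub_trigPoly_le hβ hp m
  have hρ : 0 ≤ ρ := le_trans
    (tsum_nonneg fun l => mul_nonneg (sobolevWeight_nonneg p l) (sq_nonneg _)) hβ.2
  have h3 : ((m : ℝ) + 1) ^ (-(2 * p)) * ρ ≤ ρ :=
    mul_le_of_le_one_left hρ (Real.rpow_le_one_of_one_le_of_nonpos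
      (by have := Nat.cast_nonneg (α := ℝ) m; linarith) (by linarith))
  constructor
  · rw [← Fin.sum_univ_eq_sum_range (fun l => (extendZero b l - coord β l) ^ 2)] at h1
    simp_rw [extendZero_val] at h1
    exact h1.trans (by gcongr)
  · set r := β - trigPoly (2 * m + 1) (coord β) with hr
    set f := trigPoly (2 * m + 1) fun l => extendZero b l - coord β l with hf
    have e : β - trigPoly (2 * m + 1) (extendZero b) = r - f := by
      have : f = trigPoly (2 * m + 1) (extendZero b) - trigPoly (2 * m + 1) (coord β) := by
        simp [hf, trigPoly, sub_smul, Finset.sum_sub_distrib]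
      rw [this, hr]; abel
    have h4 : ‖r‖ ≤ Real.sqrt ρ := Real.le_sqrt_of_sq_le (h2.trans h3)
    have h5 : ‖f‖ ≤ d ^ 2 * Real.sqrt ρ := by
      refine abs_le_of_sq_le_sq' ?_ (by positivity) |>.2
      rw [hf, norm_sq_trigPoly, mul_pow, Real.sq_sqrt hρ]
      refine h1.trans ?_
      rw [← pow_mul]
      gcongr
      exact h2.trans h3
    rw [e]
    calc ‖r - f‖ ≤ ‖r‖ + ‖f‖ := norm_sub_le _ _
      _ ≤ _ := by linarith

/-- The error of the Galerkin approximation of `β`. -/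
def galerkinError (P : Measure Ω) (X : Ω → L2) (D : ℕ) (β : L2) : L2 :=
  β - trigPoly D (extendZero (galerkin P X D β))

/-- The function whose inner product with `X` is the `j`-th whitened coordinate of `X`. -/
def whitenedFun (P : Measure Ω) (X : Ω → L2) (D : ℕ) (j : Fin D) : L2 :=
  trigPoly D (extendZero (whiteningMatrix P X D j))

/-- The `j`-th whitened coordinate of the normal equations at the Galerkin approximation, for a
single observation. -/
def score (P : Measure Ω) (X : Ω → L2) (D : ℕ) (β : L2) (σ : ℝ) (j : Fin D) (z : L2 × ℝ) : ℝ :=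
  (inner ℝ (galerkinError P X D β) z.1 + σ * z.2) * inner ℝ (whitenedFun P X D j) z.1

/-- The centered products of the whitened coordinates of a single observation. -/
def gramScore (P : Measure Ω) (X : Ω → L2) (D : ℕ) (jl : Fin D × Fin D) (z : L2 × ℝ) : ℝ :=
  inner ℝ (whitenedFun P X D jl.1) z.1 * inner ℝ (whitenedFun P X D jl.2) z.1 -
    (1 : Matrix (Fin D) (Fin D) ℝ) jl.1 jl.2

lemma measurable_score (D : ℕ) (j : Fin D) : Measurable (score P X₀ D β σ j) := by
  unfold score; fun_prop

lemma measurable_gramScore (D : ℕ) (jl : Fin D × Fin D) : Measurable (gramScore P X₀ D jl) := by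
  unfold gramScore; fun_prop

lemma inner_whitenedFun {D : ℕ} (j : Fin D) (f : L2) :
    inner ℝ (whitenedFun P X₀ D j) f = whiteningMatrix P X₀ D j ⬝ᵥ coords D f := by
  rw [whitenedFun, real_inner_comm, inner_trigPoly_extendZero]

lemma inner_galerkinError {D : ℕ} (f : L2) :
    inner ℝ (galerkinError P X₀ D β) f = inner ℝ β f - galerkin P X₀ D β ⬝ᵥ coords D f := by
  rw [galerkinError, inner_sub_left, real_inner_comm _ (trigPoly D _), inner_trigPoly_extendZero]

lemma sum_average_score_sq (D : ℕ) (x : Fin n → L2) (e : Fin n → ℝ) :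
    ∑ j, ((n : ℝ)⁻¹ * ∑ i, score P X₀ D β σ j (x i, e i)) ^ 2 =
      (whiteningMatrix P X₀ D).mulVec (residual (fun i => coords D (x i))
        (fun i => inner ℝ β (x i) + σ * e i) (galerkin P X₀ D β)) ⬝ᵥ
      (whiteningMatrix P X₀ D).mulVec (residual (fun i => coords D (x i))
        (fun i => inner ℝ β (x i) + σ * e i) (galerkin P X₀ D β)) := by
  rw [dotProduct]
  refine Finset.sum_congr rfl fun j _ => ?_
  rw [mulVec_residual, ← pow_two]
  refine congrArg (fun t => ((n : ℝ)⁻¹ * t) ^ 2) (Finset.sum_congr rfl fun i _ => ?_)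
  rw [score, inner_whitenedFun, inner_galerkinError]
  ring

lemma sum_average_gramScore_sq (hn : 1 ≤ n) (D : ℕ) (x : Fin n → L2) (e : Fin n → ℝ) :
    ∑ jl, ((n : ℝ)⁻¹ * ∑ i, gramScore P X₀ D jl (x i, e i)) ^ 2 =
      whitenedError (whiteningMatrix P X₀ D) (secondMoment fun i => coords D (x i)) := by
  rw [whitenedError, Fintype.sum_prod_type]
  refine Finset.sum_congr rfl fun j _ => Finset.sum_congr rfl fun l _ => ?_
  rw [whitened_secondMoment_apply _ hn transpose_whiteningMatrix]
  refine congrArg (fun t => ((n : ℝ)⁻¹ * t) ^ 2) (Finset.sum_congr rfl fun i _ => ?_)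
  rw [gramScore, inner_whitenedFun, inner_whitenedFun]

/-- The pointwise bound with c = υ (2m) / d and K = d υ 0. The index 2m is the last of the 2m+1
coordinates, so its weight is the smallest in play. -/
lemma lintegral_loss_le (hA : ModelAssumptions P υ d η k X₀ ε₀)
    (hυ : Antitone υ) (hpos : ∀ j, 0 < υ j) (hd : 0 < d) (hp : 0 ≤ p)
    (hsp : (s : ℝ) ≤ p) (hn : 1 ≤ n) (hβ : β ∈ ellipsoid p ρ)
    (hg : ∀ l, coord g l = (trigDeriv^[s] (coord β)) l)
    (hγ : 2 / (υ (2 * m) / d) ≤ n) (x : Fin n → L2) (e : Fin n → ℝ) {T F : ℝ}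
    (hT : T = ∑ j, ((n : ℝ)⁻¹ * ∑ i, score P X₀ (2 * m + 1) β σ j (x i, e i)) ^ 2)
    (hF : F = ∑ jl, ((n : ℝ)⁻¹ * ∑ i, gramScore P X₀ (2 * m + 1) jl (x i, e i)) ^ 2) :
    ∫⁻ t in Set.Icc (0 : ℝ) 1, ‖derivEstimator s m (n : ℝ) x
      (fun i => inner ℝ β (x i) + σ * e i) t - ((g t : ℝ) : ℂ)‖ₑ ^ 2 ≤
      ENNReal.ofReal
        ((2 * Real.pi * m) ^ (2 * s) * (2 * (d ^ 4 * (((m : ℝ) + 1) ^ (-(2 * p)) * ρ))) +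
          (2 * Real.pi) ^ (2 * s) * ((m : ℝ) + 1) ^ (2 * s - 2 * p) * ρ +
        (2 * Real.pi * m) ^ (2 * s) * (8 / (υ (2 * m) / d)) * T +
        (2 * Real.pi * m) ^ (2 * s) * (2 * n ^ 2 * (d * υ 0) * 4 ^ (k - 1)) *
          (T * F ^ (k - 1)) +
        (2 * Real.pi) ^ (2 * s) * ρ * 4 ^ k * F ^ k) := by
  have hposΓ := hA.regressor.pos
  have hB := (norm_sub_galerkin_le hA hυ hpos hd hp hβ m).1
  rw [sum_average_score_sq] at hT
  rw [sum_average_gramScore_sq hn] at hF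
  refine (lintegral_derivEstimator_sub_sq_le (k := k) (c := υ (2 * m) / d) (K := d * υ 0)
    hβ hsp hg transpose_whiteningMatrix transpose_covMatrix (whiteningMatrix_mul_mul hposΓ)
    (div_pos (hpos _) hd) hγ ?_ (mul_nonneg hd.le (hpos 0).le) ?_ hF hT rfl).trans
    (ENNReal.ofReal_le_ofReal ?_)
  · intro v
    have h1 := hA.link.mul_sum_le_inner hυ hpos hd (covOp_symm X₀) (covOp_nonneg X₀) (2 * m)
      (trigPoly (2 * m + 1) (extendZero v))
    rw [inner_covOp_trigPoly] at h1
    have h2 : ∑ l ∈ Finset.range (2 * m + 1), coord (trigPoly (2 * m + 1) (extendZero v)) l ^ 2 =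
        v ⬝ᵥ v := by
      rw [← norm_sq_trigPoly_extendZero, norm_sq_trigPoly]
      refine Finset.sum_congr rfl fun l hl => ?_
      rw [coord_trigPoly, if_pos (Finset.mem_range.1 hl)]
    rwa [h2] at h1
  · intro v
    rw [← norm_sq_trigPoly_extendZero, ← inner_covOp_trigPoly]
    calc _ ≤ ‖covOp P X₀ (trigPoly (2 * m + 1) (extendZero v))‖ *
          ‖trigPoly (2 * m + 1) (extendZero v)‖ := real_inner_le_norm _ _
      _ ≤ (d * υ 0 * ‖trigPoly (2 * m + 1) (extendZero v)‖) *
          ‖trigPoly (2 * m + 1) (extendZero v)‖ := by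
          gcongr
          exact hA.link.norm_apply_le hυ hpos hd _
      _ = _ := by ring
  · have h1 : (2 * Real.pi * m) ^ (2 * s) *
        (2 * ∑ l : Fin (2 * m + 1), (galerkin P X₀ (2 * m + 1) β l - coord β l) ^ 2) ≤
          (2 * Real.pi * m) ^ (2 * s) * (2 * (d ^ 4 * (((m : ℝ) + 1) ^ (-(2 * p)) * ρ))) := by
      gcongr
    rw [mul_pow 4 F (k - 1), mul_pow 4 F k, mul_add]
    refine le_trans (le_of_eq ?_) (add_le_add_left h1
      ((2 * Real.pi) ^ (2 * s) * ((m : ℝ) + 1) ^ (2 * s - 2 * p) * ρ +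
        (2 * Real.pi * m) ^ (2 * s) * (8 / (υ (2 * m) / d)) * T +
        (2 * Real.pi * m) ^ (2 * s) * (2 * n ^ 2 * (d * υ 0) * 4 ^ (k - 1)) *
          (T * F ^ (k - 1)) + (2 * Real.pi) ^ (2 * s) * ρ * 4 ^ k * F ^ k)) |>.trans
      (le_of_eq ?_)
    · ring
    · ring

lemma lintegral_ofReal_le_of_moments [IsProbabilityMeasure P] {T F : Ω → ℝ} (hT0 : ∀ ω, 0 ≤ T ω)
    (hF0 : ∀ ω, 0 ≤ F ω) (hk : 1 ≤ k) (hT : Integrable T P) (hTk : Integrable (fun ω => T ω ^ k) P)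
    (hFm : AEStronglyMeasurable F P) (hFk : Integrable (fun ω => F ω ^ k) P)
    {a c A₀ A₁ A₂ A₃ t u v : ℝ} (ha : 0 < a) (hc : 0 < c) (hA₀ : 0 ≤ A₀) (hA₁ : 0 ≤ A₁)
    (hA₂ : 0 ≤ A₂) (hA₃ : 0 ≤ A₃) (ht : ∫ ω, T ω ∂P ≤ t) (hu : a ^ k * ∫ ω, T ω ^ k ∂P ≤ u)
    (hv : c ^ k * ∫ ω, F ω ^ k ∂P ≤ v) :
    ∫⁻ ω, ENNReal.ofReal (A₀ + A₁ * T ω + A₂ * (T ω * F ω ^ (k - 1)) + A₃ * F ω ^ k) ∂P ≤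
      ENNReal.ofReal (A₀ + A₁ * t + A₂ * ((a * c ^ (k - 1))⁻¹ * (u + v)) +
        A₃ * ((c ^ k)⁻¹ * v)) := by
  obtain ⟨hTFi, hTF⟩ := integral_mul_pow_le hT.aestronglyMeasurable hFm hT0 hF0 hk hTk hFk ha hc
  have i1 : Integrable (fun ω => A₁ * T ω) P := hT.const_mul _
  have i2 : Integrable (fun ω => A₂ * (T ω * F ω ^ (k - 1))) P := hTFi.const_mul _
  have i3 : Integrable (fun ω => A₃ * F ω ^ k) P := hFk.const_mul _
  have i01 : Integrable (fun ω => A₀ + A₁ * T ω) P := (integrable_const _).add i1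
  have i012 : Integrable (fun ω => A₀ + A₁ * T ω + A₂ * (T ω * F ω ^ (k - 1))) P := i01.add i2
  have i : Integrable (fun ω => A₀ + A₁ * T ω + A₂ * (T ω * F ω ^ (k - 1)) + A₃ * F ω ^ k) P :=
    i012.add i3
  rw [← ofReal_integral_eq_lintegral_ofReal i (Eventually.of_forall fun ω => by
    have := hT0 ω
    have := hF0 ω
    positivity)]
  refine ENNReal.ofReal_le_ofReal ?_
  rw [integral_add i012 i3, integral_add i01 i2, integral_add (integrable_const _) i1,
    integral_const_mul, integral_const_mul, integral_const_mul, integral_const, probReal_univ,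
    one_smul]
  have hv' : ∫ ω, F ω ^ k ∂P ≤ (c ^ k)⁻¹ * v := by rwa [le_inv_mul_iff₀ (by positivity)]
  have hTF' : ∫ ω, T ω * F ω ^ (k - 1) ∂P ≤ (a * c ^ (k - 1))⁻¹ * (u + v) :=
    hTF.trans (mul_le_mul_of_nonneg_left (add_le_add hu hv) (by positivity))
  exact add_le_add (add_le_add (add_le_add le_rfl (mul_le_mul_of_nonneg_left ht hA₁))
    (mul_le_mul_of_nonneg_left hTF' hA₂)) (mul_le_mul_of_nonneg_left hv' hA₃)

/-- The bound for the risk at a fixed sample size, in terms of the constants `C₁`, `C₂` in the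
moment inequalities for sums, and the moments `μ₁`, `μ₂` of the scores. -/
def riskBound (p ρ d : ℝ) (s k m n : ℕ) (c K C₁ C₂ μ₁ μ₂ : ℝ) : ℝ :=
  (2 * Real.pi * m) ^ (2 * s) * (2 * (d ^ 4 * (((m : ℝ) + 1) ^ (-(2 * p)) * ρ))) +
    (2 * Real.pi) ^ (2 * s) * ((m : ℝ) + 1) ^ (2 * s - 2 * p) * ρ +
  (2 * Real.pi * m) ^ (2 * s) * (8 / c) * ((2 * m + 1 : ℕ) * (3 * C₁ * (1 + μ₁) / n)) +
  (2 * Real.pi * m) ^ (2 * s) * (2 * n ^ 2 * K * 4 ^ (k - 1)) *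
    (((n : ℝ) / (2 * m + 1 : ℕ) * ((n : ℝ) / (2 * m + 1 : ℕ) ^ 2) ^ (k - 1))⁻¹ *
      (3 * C₂ * μ₁ + 3 * C₂ * μ₂)) +
  (2 * Real.pi) ^ (2 * s) * ρ * 4 ^ k * ((((n : ℝ) / (2 * m + 1 : ℕ) ^ 2) ^ k)⁻¹ * (3 * C₂ * μ₂))

lemma derivRisk_le [IsProbabilityMeasure P]
    (hA : ModelAssumptions P υ d η k X₀ ε₀) (hs : IsSample P X₀ ε₀ X ε)
    (hυ : Antitone υ) (hpos : ∀ j, 0 < υ j) (hsum : Summable υ) (hd : 0 < d) (hp : 0 ≤ p)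
    (hsp : (s : ℝ) ≤ p) (hη : 0 ≤ η) (hk : 1 ≤ k) (hn : 1 ≤ n) (hβ : β ∈ ellipsoid p ρ)
    (hg : ∀ l, coord g l = (trigDeriv^[s] (coord β)) l)
    (hγ : 2 / (υ (2 * m) / d) ≤ n) {C₁ C₂ : ℝ} (hC₁ : 0 < C₁) (hC₂ : 0 < C₂)
    (hq₁ : ∀ N : ℝ, 1 ≤ N → ∀ s x : ℝ,
      (s + x) ^ (2 * 1) ≤ (1 + N⁻¹) * s ^ (2 * 1) + 2 * (1 : ℕ) * (s ^ (2 * 1 - 1) * x) +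
        C₁ * N ^ (1 - 1) * x ^ (2 * 1))
    (hq₂ : ∀ N : ℝ, 1 ≤ N → ∀ s x : ℝ,
      (s + x) ^ (2 * k) ≤ (1 + N⁻¹) * s ^ (2 * k) + 2 * k * (s ^ (2 * k - 1) * x) +
        C₂ * N ^ (k - 1) * x ^ (2 * k)) :
    derivRisk P s m (n : ℝ) σ X ε β g ≤ ENNReal.ofReal (riskBound p ρ d s k m n (υ (2 * m) / d)
      (d * υ 0) C₁ C₂ (scoreMoment k ((1 + d ^ 2) * Real.sqrt ρ) (d * ∑' l, υ l) σ η)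
      (2 ^ (2 * k) * (η + η + 1))) := by
  set V := d * ∑' l, υ l
  set H := (1 + d ^ 2) * Real.sqrt ρ
  set D := 2 * m + 1 with hD
  have hH : ‖galerkinError P X₀ D β‖ ≤ H := (norm_sub_galerkin_le hA hυ hpos hd hp hβ m).2
  have hV : ∀ N, ∑ l ∈ Finset.range N, covEntry P X₀ l l ≤ V := sum_covEntry_le hA hυ hpos hsum hd
  have hn0 : (0 : ℝ) < n := by exact_mod_cast hn
  have hD0 : (0 : ℝ) < (D : ℕ) := by positivity
  have hrm : ∀ j, MemLp (fun ω => (inner ℝ (whitenedFun P X₀ D j) (X₀ ω) : ℝ))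
      ((2 * (2 * k) : ℕ) : ℝ≥0∞) P ∧
      ∫ ω, (inner ℝ (whitenedFun P X₀ D j) (X₀ ω) : ℝ) ^ (2 * (2 * k)) ∂P ≤ η := fun j => by
    refine even_pow_moment (by omega)
      (aestronglyMeasurable_inner_left hA.regressor.aemeasurable _) hη ?_
    have := hA.regressor.moment_whitened D j
    simp_rw [whitened_eq_inner] at this
    rwa [show 4 * k = 2 * (2 * k) by ring] at this
  have horth : ∀ j, inner ℝ (covOp P X₀ (galerkinError P X₀ D β)) (whitenedFun P X₀ D j) =
      (0 : ℝ) := fun j => by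
    rw [whitenedFun, inner_trigPoly]
    exact Finset.sum_eq_zero fun l hl => by
      rw [galerkinError, coord_covOp_sub_galerkin hA.regressor.pos β (Finset.mem_range.1 hl),
        mul_zero]
  have hφ := fun j => score_moment hA hk hη hV hH σ (hrm j).1 (hrm j).2 (horth j)
  have hχ := fun jl : Fin D × Fin D => gram_moment hA hk (hrm jl.1).1 (hrm jl.1).2 (hrm jl.2).1
    (hrm jl.2).2 (inner_covOp_whiteningMatrix hA.regressor.pos jl.1 jl.2)
    (by rw [Matrix.one_apply]; split_ifs <;> simp)
  have hτ := fun j => hs.average_moment hn (measurable_score (P := P) (X₀ := X₀) (β := β) (σ := σ)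
    D j) hk hC₂ hq₂ (hφ j).1 (hφ j).2.1 (hφ j).2.2
  have hθ := fun jl => hs.average_moment hn (measurable_gramScore (P := P) (X₀ := X₀) D jl) hk hC₂
    hq₂ (hχ jl).1 (hχ jl).2.1 (hχ jl).2.2
  -- The leading term needs E T itself, hence the moment inequality once more with q = 1.
  have hτ1 := fun j => hs.average_moment hn (measurable_score (P := P) (X₀ := X₀) (β := β) (σ := σ)
    D j) le_rfl hC₁ hq₁ ((hφ j).1.mono_exponent (by exact_mod_cast (by omega : 2 * 1 ≤ 2 * k)))
    (hφ j).2.1 ((integral_sq_le_one_add hk (hφ j).1).trans (add_le_add_right (hφ j).2.2 1))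
  obtain ⟨hT1i, hT1⟩ := integral_sum_sq_pow_le le_rfl (fun j => (hτ1 j).1) fun j => (hτ1 j).2
  obtain ⟨hTki, hTk⟩ := integral_sum_sq_pow_le hk (fun j => (hτ j).1) fun j => (hτ j).2
  obtain ⟨hFki, hFk⟩ := integral_sum_sq_pow_le hk (fun jl => (hθ jl).1) fun jl => (hθ jl).2
  simp only [pow_one, Fintype.card_fin, Fintype.card_prod] at hT1i hT1 hTk hFk
  have hFm := Finset.aestronglyMeasurable_fun_sum (μ := P) Finset.univ
    fun jl _ => (hθ jl).1.aestronglyMeasurable.pow 2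
  have hρ : 0 ≤ ρ := le_trans
    (tsum_nonneg fun l => mul_nonneg (sobolevWeight_nonneg p l) (sq_nonneg _)) hβ.2
  have hυ0 := (hpos 0).le
  have hυm := hpos (2 * m)
  rw [derivRisk]
  refine (lintegral_mono fun ω => lintegral_loss_le hA hυ hpos hd hp hsp hn hβ hg hγ
    (fun i => X i ω) (fun i => ε i ω) rfl rfl).trans ?_
  -- T has D squared averages and F has D², so E T^k and E F^k are of order (D/n)^k and (D²/n)^k;
  -- these weights make both normalized moments bounded by constants.
  refine lintegral_ofReal_le_of_moments (a := (n : ℝ) / D) (c := (n : ℝ) / (D : ℝ) ^ 2)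
    (fun ω => Finset.sum_nonneg fun _ _ => sq_nonneg _)
    (fun ω => Finset.sum_nonneg fun _ _ => sq_nonneg _) hk hT1i hTki hFm hFki (by positivity)
    (by positivity) (by positivity) (by positivity) (by positivity) (by positivity) hT1 ?_ ?_
  · refine (mul_le_mul_of_nonneg_left hTk (by positivity)).trans (le_of_eq ?_)
    rw [div_pow]; field_simp
  · refine (mul_le_mul_of_nonneg_left hFk (by positivity)).trans (le_of_eq ?_)
    rw [Nat.cast_mul, ← pow_two, div_pow]; field_simp

end Risk

/-! ### Rates of convergence -/

section Rates

/-- Each of the five terms of `riskBound` is compared with m^(2s-2p): two bias terms, the variance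
through `hA`, and two terms of the bad event through `hB`. The factors 3 come from 2m+1 ≤ 3m. -/
lemma le_mul_rpow_of_bounds {p ρ d c c₀ K K₀ L C₁ C₂ μ₁ μ₂ : ℝ} {s k m n : ℕ} (hp : 0 ≤ p)
    (hsp : (s : ℝ) ≤ p) (hρ : 0 ≤ ρ) (hm : 1 ≤ m) (hn : 1 ≤ n) (hk : 1 ≤ k) (hc : 0 < c)
    (hcc : c ≤ c₀) (hK : 0 ≤ K) (hK₀ : 0 ≤ K₀) (hL : 0 ≤ L) (hC₁ : 0 ≤ C₁) (hC₂ : 0 ≤ C₂)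
    (hμ₁ : 0 ≤ μ₁) (hμ₂ : 0 ≤ μ₂) (hA : (m : ℝ) ^ (2 * p) * m ≤ K * n * c)
    (hB : (m : ℝ) ^ (2 * p) * m ^ (2 * k - 1) * n ^ 2 ≤ L * n ^ k) :
    riskBound p ρ d s k m n c K₀ C₁ C₂ μ₁ μ₂ ≤
      ((2 * Real.pi) ^ (2 * s) * (2 * d ^ 4 * ρ) + (2 * Real.pi) ^ (2 * s) * ρ +
        (2 * Real.pi) ^ (2 * s) * 8 * (3 * C₁ * (1 + μ₁)) * (3 * K) +
        (2 * Real.pi) ^ (2 * s) * (2 * K₀ * 4 ^ (k - 1)) * (3 * C₂ * μ₁ + 3 * C₂ * μ₂) *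
          (3 ^ (2 * k - 1) * L) +
        (2 * Real.pi) ^ (2 * s) * ρ * 4 ^ k * (3 * C₂ * μ₂) * (3 ^ (2 * k) * (L * K * c₀))) *
        (m : ℝ) ^ (2 * (s : ℝ) - 2 * p) := by
  have hM1 : (1 : ℝ) ≤ m := by exact_mod_cast hm
  have hN1 : (1 : ℝ) ≤ n := by exact_mod_cast hn
  have hDM : ((2 * m + 1 : ℕ) : ℝ) ≤ 3 * m := by push_cast; linarith
  have hD0 : (0 : ℝ) < (2 * m + 1 : ℕ) := by positivity
  unfold riskBound
  generalize ((2 * m + 1 : ℕ) : ℝ) = D at *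
  have hQw : (m : ℝ) ^ (2 * s) = (m : ℝ) ^ (2 * (s : ℝ) - 2 * p) * (m : ℝ) ^ (2 * p) := by
    rw [← Real.rpow_add (by linarith), ← Real.rpow_natCast]
    congr 1
    push_cast
    ring
  have hQ1 : 1 ≤ (m : ℝ) ^ (2 * p) := Real.one_le_rpow hM1 (by linarith)
  have hM1s : ((m : ℝ) + 1) ^ (-(2 * p)) ≤ ((m : ℝ) ^ (2 * p))⁻¹ := by
    rw [← Real.rpow_neg (by linarith)]
    exact Real.rpow_le_rpow_of_nonpos (by linarith) (by linarith) (by linarith)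
  have hM1w : ((m : ℝ) + 1) ^ (2 * (s : ℝ) - 2 * p) ≤ (m : ℝ) ^ (2 * (s : ℝ) - 2 * p) :=
    Real.rpow_le_rpow_of_nonpos (by linarith) (by linarith) (by linarith)
  have hw0 : 0 ≤ (m : ℝ) ^ (2 * (s : ℝ) - 2 * p) := by positivity
  have hwQ : 1 ≤ (m : ℝ) ^ (2 * (s : ℝ) - 2 * p) * (m : ℝ) ^ (2 * p) :=
    hQw ▸ one_le_pow₀ hM1
  have hS0 : 0 ≤ (2 * Real.pi) ^ (2 * s) := by positivity
  simp only [mul_pow (2 * Real.pi) (m : ℝ), hQw]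
  generalize (2 * Real.pi) ^ (2 * s) = S at *
  generalize (m : ℝ) ^ (2 * (s : ℝ) - 2 * p) = w at *
  generalize ((m : ℝ) + 1) ^ (2 * (s : ℝ) - 2 * p) = w' at *
  generalize ((m : ℝ) + 1) ^ (-(2 * p)) = q at *
  generalize (m : ℝ) ^ (2 * p) = Q at *
  generalize (m : ℝ) = M at *
  generalize (n : ℝ) = N at *
  have hQ0 : 0 < Q := by linarith
  have hN0 : 0 < N := by linarith
  have h3 : Q * D / (c * N) ≤ 3 * K := by
    rw [div_le_iff₀ (by positivity)]
    have : Q * D ≤ Q * (3 * M) := by gcongr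
    nlinarith
  have h4 : N ^ 2 * Q * (N / D * (N / D ^ 2) ^ (k - 1))⁻¹ ≤ 3 ^ (2 * k - 1) * L := by
    obtain ⟨j, rfl⟩ : ∃ j, k = j + 1 := ⟨k - 1, by omega⟩
    have e : N / D * (N / D ^ 2) ^ (j + 1 - 1) = N ^ (j + 1) / D ^ (2 * (j + 1) - 1) := by
      rw [show 2 * (j + 1) - 1 = 2 * j + 1 by omega, Nat.add_sub_cancel, div_pow, ← pow_mul,
        pow_succ, pow_succ]
      field_simp
    rw [e, inv_div, mul_div_assoc', div_le_iff₀ (by positivity)]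
    calc N ^ 2 * Q * D ^ (2 * (j + 1) - 1) ≤ N ^ 2 * Q * (3 * M) ^ (2 * (j + 1) - 1) := by gcongr
      _ = 3 ^ (2 * (j + 1) - 1) * (Q * M ^ (2 * (j + 1) - 1) * N ^ 2) := by rw [mul_pow]; ring
      _ ≤ 3 ^ (2 * (j + 1) - 1) * (L * N ^ (j + 1)) := by gcongr
      _ = _ := by ring
  -- This term carries one power of m more than `hB` controls and lacks the factor n²; the crude
  -- consequence M ≤ K c₀ N² of `hA` makes up for both.
  have h5 : ((N / D ^ 2) ^ k)⁻¹ ≤ 3 ^ (2 * k) * (L * K * c₀) * w := by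
    have hMN : M ≤ K * c₀ * N ^ 2 := by
      calc M ≤ Q * M := le_mul_of_one_le_left (by linarith) hQ1
        _ ≤ K * N * c := hA
        _ ≤ K * N * c₀ := by gcongr
        _ = K * c₀ * (N * 1) := by ring
        _ ≤ K * c₀ * (N * N) := by
            have : 0 ≤ K * c₀ := mul_nonneg hK (hc.le.trans hcc)
            gcongr
        _ = _ := by ring
    have hMk : M ^ (2 * k) * Q ≤ L * K * c₀ * N ^ k := by
      refine le_of_mul_le_mul_right ?_ (by positivity : 0 < N ^ 2)
      calc M ^ (2 * k) * Q * N ^ 2 = Q * M ^ (2 * k - 1) * N ^ 2 * M := by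
            rw [show 2 * k = 2 * k - 1 + 1 by omega, pow_succ]
            simp only [Nat.add_sub_cancel]
            ring
        _ ≤ L * N ^ k * (K * c₀ * N ^ 2) := by gcongr
        _ = _ := by ring
    rw [div_pow, inv_div, div_le_iff₀ (by positivity), ← pow_mul]
    calc D ^ (2 * k) ≤ (3 * M) ^ (2 * k) := by gcongr
      _ = 3 ^ (2 * k) * (M ^ (2 * k) * 1) := by rw [mul_pow]; ring
      _ ≤ 3 ^ (2 * k) * (M ^ (2 * k) * (w * Q)) := by gcongr
      _ = 3 ^ (2 * k) * w * (M ^ (2 * k) * Q) := by ring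
      _ ≤ 3 ^ (2 * k) * w * (L * K * c₀ * N ^ k) := by gcongr
      _ = _ := by ring
  have t1 : S * (w * Q) * (2 * (d ^ 4 * (q * ρ))) ≤ S * (2 * d ^ 4 * ρ) * w := by
    calc S * (w * Q) * (2 * (d ^ 4 * (q * ρ))) ≤ S * (w * Q) * (2 * (d ^ 4 * (Q⁻¹ * ρ))) := by
          gcongr
      _ = _ := by field_simp
  have t2 : S * w' * ρ ≤ S * ρ * w := by
    calc S * w' * ρ ≤ S * w * ρ := by gcongr
      _ = _ := by ring
  have t3 : S * (w * Q) * (8 / c) * (D * (3 * C₁ * (1 + μ₁) / N)) ≤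
      S * 8 * (3 * C₁ * (1 + μ₁)) * (3 * K) * w := by
    calc S * (w * Q) * (8 / c) * (D * (3 * C₁ * (1 + μ₁) / N)) =
          S * 8 * (3 * C₁ * (1 + μ₁)) * (Q * D / (c * N)) * w := by field_simp
      _ ≤ _ := by gcongr
  have t4 : S * (w * Q) * (2 * N ^ 2 * K₀ * 4 ^ (k - 1)) *
      ((N / D * (N / D ^ 2) ^ (k - 1))⁻¹ * (3 * C₂ * μ₁ + 3 * C₂ * μ₂)) ≤
      S * (2 * K₀ * 4 ^ (k - 1)) * (3 * C₂ * μ₁ + 3 * C₂ * μ₂) * (3 ^ (2 * k - 1) * L) * w := by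
    calc _ = S * (2 * K₀ * 4 ^ (k - 1)) * (3 * C₂ * μ₁ + 3 * C₂ * μ₂) *
          (N ^ 2 * Q * (N / D * (N / D ^ 2) ^ (k - 1))⁻¹) * w := by ring
      _ ≤ _ := by gcongr
  have t5 : S * ρ * 4 ^ k * (((N / D ^ 2) ^ k)⁻¹ * (3 * C₂ * μ₂)) ≤
      S * ρ * 4 ^ k * (3 * C₂ * μ₂) * (3 ^ (2 * k) * (L * K * c₀)) * w := by
    calc _ ≤ S * ρ * 4 ^ k * (3 ^ (2 * k) * (L * K * c₀) * w * (3 * C₂ * μ₂)) := by gcongr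
      _ = _ := by ring
  refine (add_le_add (add_le_add (add_le_add (add_le_add t1 t2) t3) t4) t5).trans (le_of_eq ?_)
  ring

lemma uniformDerivRate_of_bounds {υ : ℕ → ℝ} {p ρ σ d η : ℝ} {s k : ℕ} {m : ℕ → ℕ} {r : ℕ → ℝ}
    (hυ : Antitone υ) (hpos : ∀ j, 0 < υ j) (hsum : Summable υ) (hp : 0 ≤ p)
    (hsp : (s : ℝ) ≤ p) (hρ : 0 ≤ ρ) (hd : 0 < d) (hη : 0 ≤ η) (hk : 1 ≤ k)
    (hm : Tendsto m atTop atTop) {K L R : ℝ} (hR₀ : 0 ≤ R)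
    (hA : ∀ᶠ n in atTop, (m n : ℝ) ^ (2 * p) * m n ≤ K * n * υ (2 * m n))
    (hB : ∀ᶠ n in atTop, (m n : ℝ) ^ (2 * p) * m n ^ (2 * k - 1) * n ^ 2 ≤ L * n ^ k)
    (hR : ∀ᶠ n in atTop, (m n : ℝ) ^ (2 * (s : ℝ) - 2 * p) ≤ R * r n) :
    UniformDerivRate.{u} υ p ρ σ d η s k m r := by
  obtain ⟨C₁, hC₁, hq₁⟩ := exists_even_pow_add_le_of_one_le 1 le_rfl
  obtain ⟨C₂, hC₂, hq₂⟩ := exists_even_pow_add_le_of_one_le k hk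
  set μ₁ := scoreMoment k ((1 + d ^ 2) * Real.sqrt ρ) (d * ∑' l, υ l) σ η with hμ₁
  set μ₂ : ℝ := 2 ^ (2 * k) * (η + η + 1) with hμ₂
  have hυs : 0 ≤ ∑' l, υ l := tsum_nonneg fun l => (hpos l).le
  have hμ₁0 : 0 ≤ μ₁ := by
    rw [hμ₁, scoreMoment, pow_mul σ]
    positivity
  have hμ₂0 : 0 ≤ μ₂ := by positivity
  set E := (2 * Real.pi) ^ (2 * s) * (2 * d ^ 4 * ρ) + (2 * Real.pi) ^ (2 * s) * ρ +
        (2 * Real.pi) ^ (2 * s) * 8 * (3 * C₁ * (1 + μ₁)) * (3 * (|K| * d)) +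
        (2 * Real.pi) ^ (2 * s) * (2 * (d * υ 0) * 4 ^ (k - 1)) * (3 * C₂ * μ₁ + 3 * C₂ * μ₂) *
          (3 ^ (2 * k - 1) * |L|) +
        (2 * Real.pi) ^ (2 * s) * ρ * 4 ^ k * (3 * C₂ * μ₂) *
          (3 ^ (2 * k) * (|L| * (|K| * d) * (υ 0 / d))) with hE
  have hυ0 := hpos 0
  have hE0 : 0 ≤ E := by positivity
  have hmr : Tendsto (fun n => (m n : ℝ)) atTop atTop := tendsto_natCast_atTop_atTop.comp hm
  obtain ⟨N, hN⟩ := eventually_atTop.1 (((hA.and hB).and hR).and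
    (((hmr.eventually_ge_atTop (2 * d * |K|)).and (hm.eventually_ge_atTop 1)).and
      (eventually_ge_atTop 1)))
  refine ⟨E * R + 1, by positivity, N, fun β hβ => ?_⟩
  obtain ⟨g, hg, hgc⟩ := exists_isWeakDeriv (f := β) (s := s) fun i hi =>
    summable_derivFactor_mul_coord_sq hβ (le_trans (by exact_mod_cast hi) hsp)
  refine ⟨g, hg, fun n hn Ω _ P _ X₀ ε₀ X ε hM hs => ?_⟩
  obtain ⟨⟨⟨hA', hB'⟩, hR'⟩, ⟨hmK, hm1⟩, hn1⟩ := hN n hn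
  have hυm := hpos (2 * m n)
  have hm1' : (1 : ℝ) ≤ m n := by exact_mod_cast hm1
  have hn1' : (1 : ℝ) ≤ n := by exact_mod_cast hn1
  have hAK : (m n : ℝ) ^ (2 * p) * m n ≤ |K| * n * υ (2 * m n) :=
    hA'.trans (by gcongr; exact le_abs_self K)
  have hBL : (m n : ℝ) ^ (2 * p) * m n ^ (2 * k - 1) * n ^ 2 ≤ |L| * n ^ k :=
    hB'.trans (by gcongr; exact le_abs_self L)
  -- The variance condition bounds n υ (2m) below by m/|K|, and m exceeds 2d|K| eventually, so the
  -- threshold n is large enough.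
  have hγ : 2 / (υ (2 * m n) / d) ≤ n := by
    have h1 : (m n : ℝ) ≤ |K| * n * υ (2 * m n) :=
      (le_mul_of_one_le_left (by linarith) (Real.one_le_rpow hm1' (by linarith))).trans hAK
    have hK0 : 0 < |K| := by
      by_contra h
      have : |K| = 0 := le_antisymm (not_lt.1 h) (abs_nonneg K)
      rw [this] at h1
      linarith
    rw [div_div_eq_mul_div, div_le_iff₀ hυm]
    refine le_of_mul_le_mul_left ?_ hK0
    calc |K| * (2 * d) = 2 * d * |K| := by ring
      _ ≤ _ := hmK
      _ ≤ _ := h1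
      _ = _ := by ring
  refine (derivRisk_le hM hs hυ hpos hsum hd hp hsp hη hk hn1 hβ hgc hγ hC₁ hC₂ hq₁ hq₂).trans
    (ENNReal.ofReal_le_ofReal ?_)
  refine (le_mul_rpow_of_bounds hp hsp hρ hm1 hn1 hk (div_pos hυm hd)
    (div_le_div_of_nonneg_right (hυ (Nat.zero_le _)) hd.le) (by positivity) (by positivity)
    (abs_nonneg L) hC₁.le hC₂.le hμ₁0 hμ₂0 (K := |K| * d) (hAK.trans (le_of_eq ?_)) hBL).trans ?_
  · field_simp
  · have hr : 0 < R * r n := lt_of_lt_of_le (by positivity) hR'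
    have hr' : 0 < r n := pos_of_mul_pos_right hr hR₀
    calc _ ≤ E * (R * r n) := mul_le_mul_of_nonneg_left hR' hE0
      _ = E * R * r n := by ring
      _ ≤ (E * R + 1) * r n := by gcongr; linarith

end Rates

/-! ### Polynomially and exponentially decreasing weights -/

section Weights

lemma polyWeight_eq (a : ℝ) (j : ℕ) : polyWeight a j = ((j : ℝ) + 1) ^ (-(2 * a)) := by
  rw [polyWeight]
  split_ifs with h
  · simp [h]
  · rfl

lemma polyWeight_pos (a : ℝ) (j : ℕ) : 0 < polyWeight a j := by
  rw [polyWeight_eq]; positivity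

lemma antitone_polyWeight {a : ℝ} (ha : 0 ≤ a) : Antitone (polyWeight a) := fun i j hij => by
  rw [polyWeight_eq, polyWeight_eq]
  exact Real.rpow_le_rpow_of_nonpos (by positivity) (by gcongr) (by linarith)

lemma summable_polyWeight {a : ℝ} (ha : 1 / 2 < a) : Summable (polyWeight a) := by
  have h := (summable_nat_add_iff 1).2
    (Real.summable_nat_rpow (p := -(2 * a)) |>.2 (by linarith))
  refine h.congr fun j => ?_
  rw [polyWeight_eq]
  push_cast
  rfl

lemma expWeight_pos (a : ℝ) (j : ℕ) : 0 < expWeight a j := by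
  rw [expWeight]; split_ifs <;> positivity

lemma expWeight_of_ne_zero (a : ℝ) {j : ℕ} (hj : j ≠ 0) :
    expWeight a j = Real.exp (-((j : ℝ) + 1) ^ (2 * a)) := if_neg hj

lemma antitone_expWeight {a : ℝ} (ha : 0 ≤ a) : Antitone (expWeight a) := fun i j hij => by
  rcases Nat.eq_zero_or_pos j with rfl | hj
  · rw [Nat.le_zero.1 hij]
  rw [expWeight_of_ne_zero a hj.ne']
  rcases Nat.eq_zero_or_pos i with rfl | hi
  · rw [expWeight, if_pos rfl, Real.exp_le_one_iff]
    have : 0 ≤ ((j : ℝ) + 1) ^ (2 * a) := by positivity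
    linarith
  · rw [expWeight_of_ne_zero a hi.ne']
    gcongr

/-- With x = (j+1)^(2a), exp(-x) is smaller than x^(-1/a) = (j+1)^(-2) asymptotically. -/
lemma summable_expWeight {a : ℝ} (ha : 0 < a) : Summable (expWeight a) := by
  have h1 : Tendsto (fun j : ℕ => ((j : ℝ) + 1) ^ (2 * a)) atTop atTop :=
    (tendsto_rpow_atTop (by linarith)).comp
      (tendsto_atTop_add_const_right _ _ tendsto_natCast_atTop_atTop)
  have h2 := ((isLittleO_exp_neg_mul_rpow_atTop one_pos (-a⁻¹)).comp_tendsto h1).isBigO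
  have h3 : Summable fun j : ℕ => (((j : ℝ) + 1) ^ (2 * a)) ^ (-a⁻¹) := by
    have h := (summable_nat_add_iff 1).2 (Real.summable_nat_rpow (p := -2) |>.2 (by norm_num))
    refine h.congr fun j => ?_
    rw [← Real.rpow_mul (by positivity)]
    push_cast
    congr 1
    field_simp
  refine summable_of_isBigO_nat h3 (IsBigO.trans (EventuallyEq.isBigO ?_) h2)
  filter_upwards [eventually_ge_atTop 1] with j hj
  rw [expWeight_of_ne_zero a (by omega), Function.comp_apply, neg_one_mul]

/-- Bounds for a sequence of dimensions of exact order `f n`. -/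
lemma exists_bounds_of_isTheta {m : ℕ → ℕ} {f : ℕ → ℝ}
    (hm : (fun n => (m n : ℝ)) =Θ[atTop] f) (hf : ∀ᶠ n in atTop, 0 ≤ f n) :
    ∃ c C : ℝ, 0 < c ∧ 0 < C ∧ ∀ᶠ n in atTop, c * f n ≤ m n ∧ (m n : ℝ) ≤ C * f n := by
  obtain ⟨C, hC, h1⟩ := hm.1.exists_pos
  obtain ⟨c, hc, h2⟩ := hm.2.exists_pos
  refine ⟨c⁻¹, C, inv_pos.2 hc, hC, ?_⟩
  filter_upwards [h1.bound, h2.bound, hf] with n h1 h2 h3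
  rw [Real.norm_of_nonneg h3, Real.norm_of_nonneg (Nat.cast_nonneg _)] at h1 h2
  exact ⟨(inv_mul_le_iff₀ hc).2 h2, h1⟩

lemma rpow_le_of_bounds {c M x e q t : ℝ} (hc : 0 < c) (hx : 0 < x) (hM : c * x ^ e ≤ M)
    (hq : q ≤ 0) (ht : e * q = t) : M ^ q ≤ c ^ q * x ^ t := by
  calc M ^ q ≤ (c * x ^ e) ^ q := Real.rpow_le_rpow_of_nonpos (by positivity) hM hq
    _ = c ^ q * x ^ t := by
      rw [Real.mul_rpow hc.le (by positivity), ← Real.rpow_mul hx.le, ht]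

lemma rpow_le_of_bounds' {C M x e q t : ℝ} (hC : 0 ≤ C) (hx : 0 < x) (hM0 : 0 ≤ M)
    (hM : M ≤ C * x ^ e) (hq : 0 ≤ q) (ht : e * q = t) : M ^ q ≤ C ^ q * x ^ t := by
  calc M ^ q ≤ (C * x ^ e) ^ q := Real.rpow_le_rpow hM0 hM hq
    _ = C ^ q * x ^ t := by
      rw [Real.mul_rpow hC (by positivity), ← Real.rpow_mul hx.le, ht]

/-- The claim is 2p+2k-1 ≤ (k-2)(2p+2a+1). The moment condition makes the right side at least 2k+4,
enough for p ≤ 5/2; for larger p the bounds k ≥ 4 and a > 1/2 suffice. -/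
lemma exponent_le_of_moment_condition {p a : ℝ} {k : ℕ} (hp : 0 < p) (ha : 1 / 2 < a)
    (hk : 4 ≤ k) (hka : 2 + 8 / (2 * p + 2 * a - 1) ≤ (k : ℝ)) :
    1 / (2 * p + 2 * a + 1) * (2 * p + (2 * k - 1)) ≤ k - 2 := by
  have hk' : (4 : ℝ) ≤ k := by exact_mod_cast hk
  have h0 : 0 < 2 * p + 2 * a - 1 := by linarith
  have h1 : 8 ≤ (k - 2) * (2 * p + 2 * a - 1) := by
    rw [← div_le_iff₀ h0]; linarith
  rw [one_div, inv_mul_le_iff₀ (by linarith)]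
  rcases le_or_gt p (5 / 2) with h | h
  · linarith
  · nlinarith

theorem uniformDerivRate_polyWeight {p ρ σ d η a : ℝ} {s k : ℕ} {m : ℕ → ℕ} (hp : 0 < p)
    (hsp : (s : ℝ) ≤ p) (hρ : 0 ≤ ρ) (hd : 0 < d) (hη : 0 ≤ η) (hk : 4 ≤ k) (ha : 1 / 2 < a)
    (hka : 2 + 8 / (2 * p + 2 * a - 1) ≤ (k : ℝ))
    (hm : (fun n => (m n : ℝ)) =Θ[atTop] fun n : ℕ => (n : ℝ) ^ (1 / (2 * p + 2 * a + 1))) :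
    UniformDerivRate.{u} (polyWeight a) p ρ σ d η s k m
      fun n => (n : ℝ) ^ (-((2 * p - 2 * s) / (2 * p + 2 * a + 1))) := by
  obtain ⟨c, C, hc, hC, hb⟩ := exists_bounds_of_isTheta hm
    (Eventually.of_forall fun n => by positivity)
  have hθ : 0 < 1 / (2 * p + 2 * a + 1) := by
    have : 0 < 2 * p + 2 * a + 1 := by linarith
    positivity
  have hmr : Tendsto (fun n => (m n : ℝ)) atTop atTop :=
    tendsto_atTop_mono' _ (hb.mono fun n h => h.1) <|
      ((tendsto_rpow_atTop hθ).comp tendsto_natCast_atTop_atTop).const_mul_atTop hc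
  have hmt : Tendsto m atTop atTop := tendsto_natCast_atTop_iff.1 hmr
  have hev := (hb.and (hmt.eventually_ge_atTop 1)).and (eventually_ge_atTop 1)
  refine uniformDerivRate_of_bounds (K := C ^ (2 * p + 2 * a + 1) * 3 ^ (2 * a))
    (L := C ^ (2 * p + (2 * k - 1))) (R := c ^ (2 * (s : ℝ) - 2 * p))
    (antitone_polyWeight (by linarith)) (polyWeight_pos a)
    (summable_polyWeight ha) hp.le hsp hρ hd hη (by omega) hmt (by positivity) ?_ ?_ ?_
  · filter_upwards [hev] with n ⟨⟨⟨_, h2⟩, h3⟩, h4⟩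
    have hn : (1 : ℝ) ≤ n := by exact_mod_cast h4
    have hm1 : (1 : ℝ) ≤ m n := by exact_mod_cast h3
    have h5 := rpow_le_of_bounds' (q := 2 * p + 2 * a + 1) (t := 1) hC.le (by linarith)
      (by linarith) h2 (by linarith) (one_div_mul_cancel (by linarith))
    rw [polyWeight_eq, Real.rpow_neg (by positivity), ← div_eq_mul_inv,
      le_div_iff₀ (by positivity)]
    calc (m n : ℝ) ^ (2 * p) * m n * (((2 * m n : ℕ) : ℝ) + 1) ^ (2 * a)
        ≤ (m n : ℝ) ^ (2 * p) * m n * (3 * m n) ^ (2 * a) := by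
          gcongr
          push_cast
          linarith
      _ = 3 ^ (2 * a) * (m n : ℝ) ^ (2 * p + 2 * a + 1) := by
          rw [Real.mul_rpow (by norm_num) (by linarith), Real.rpow_add (by linarith),
            Real.rpow_add (by linarith), Real.rpow_one]
          ring
      _ ≤ 3 ^ (2 * a) * (C ^ (2 * p + 2 * a + 1) * (n : ℝ) ^ (1 : ℝ)) := by gcongr
      _ = _ := by rw [Real.rpow_one]; ring
  · filter_upwards [hev] with n ⟨⟨⟨_, h2⟩, h3⟩, h4⟩
    have hn : (1 : ℝ) ≤ n := by exact_mod_cast h4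
    have hm1 : (1 : ℝ) ≤ m n := by exact_mod_cast h3
    have hk1 : (1 : ℝ) ≤ k := by exact_mod_cast (by omega : 1 ≤ k)
    have h5 := rpow_le_of_bounds' (q := 2 * p + (2 * k - 1)) hC.le (by linarith)
      (by linarith) h2 (by linarith) rfl
    calc (m n : ℝ) ^ (2 * p) * m n ^ (2 * k - 1) * n ^ 2
        = (m n : ℝ) ^ (2 * p + (2 * k - 1)) * n ^ 2 := by
          rw [Real.rpow_add (by linarith), ← Real.rpow_natCast _ (2 * k - 1),
            Nat.cast_sub (by omega)]
          push_cast
          rfl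
      _ ≤ C ^ (2 * p + (2 * k - 1)) * (n : ℝ) ^ ((k : ℝ) - 2) * n ^ 2 := by
          gcongr
          refine h5.trans ?_
          gcongr
          exact exponent_le_of_moment_condition hp ha hk hka
      _ = C ^ (2 * p + (2 * k - 1)) * n ^ k := by
          rw [mul_assoc, ← Real.rpow_natCast _ 2, ← Real.rpow_add (by linarith),
            ← Real.rpow_natCast _ k]
          norm_num
  · filter_upwards [hev] with n ⟨⟨⟨h2, _⟩, _⟩, h4⟩
    have hn : (1 : ℝ) ≤ n := by exact_mod_cast h4
    exact rpow_le_of_bounds hc (by linarith) h2 (by linarith) (by ring)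

theorem uniformDerivRate_expWeight {p ρ σ d η a : ℝ} {s k : ℕ} {m : ℕ → ℕ} (hp : 0 < p)
    (hsp : (s : ℝ) ≤ p) (hρ : 0 ≤ ρ) (hd : 0 < d) (hη : 0 ≤ η) (hk : 4 ≤ k) (ha : 0 < a)
    (hm : (fun n => (m n : ℝ)) =Θ[atTop] fun n : ℕ => Real.log n ^ (1 / (2 * a)))
    (hme : (fun n => (m n : ℝ) ^ (2 * p + 1) * Real.exp ((2 * (m n : ℝ) + 1) ^ (2 * a)))
      =O[atTop] fun n : ℕ => (n : ℝ)) :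
    UniformDerivRate.{u} (expWeight a) p ρ σ d η s k m
      fun n => Real.log n ^ (-((p - s) / a)) := by
  have hlog : Tendsto (fun n : ℕ => Real.log n) atTop atTop :=
    Real.tendsto_log_atTop.comp tendsto_natCast_atTop_atTop
  obtain ⟨c, C, hc, hC, hb⟩ := exists_bounds_of_isTheta hm
    ((hlog.eventually_ge_atTop 0).mono fun n h => Real.rpow_nonneg h _)
  have hmr : Tendsto (fun n => (m n : ℝ)) atTop atTop :=
    tendsto_atTop_mono' _ (hb.mono fun n h => h.1) <|
      ((tendsto_rpow_atTop (by positivity)).comp hlog).const_mul_atTop hc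
  have hmt : Tendsto m atTop atTop := tendsto_natCast_atTop_iff.1 hmr
  have hev := (hb.and (hmt.eventually_ge_atTop 1)).and
    ((eventually_ge_atTop 1).and (hlog.eventually_gt_atTop 0))
  obtain ⟨K, hK⟩ := hme.bound
  -- Powers of m are powers of log n, hence at most of order n. The remainder condition then only
  -- needs n · n² ≤ n^k, so k ≥ 4 is enough here.
  have hlo : ∀ᶠ n : ℕ in atTop,
      Real.log n ^ (1 / (2 * a) * (2 * p + (2 * k - 1))) ≤ (n : ℝ) := by
    have h := ((isLittleO_log_rpow_rpow_atTop (1 / (2 * a) * (2 * p + (2 * k - 1)))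
      one_pos).comp_tendsto tendsto_natCast_atTop_atTop).bound (c := 1) one_pos
    filter_upwards [h] with n h
    simp only [Function.comp_apply, Real.rpow_one, one_mul] at h
    exact (le_abs_self _).trans (h.trans_eq (abs_of_nonneg (Nat.cast_nonneg n)))
  refine uniformDerivRate_of_bounds (K := K) (L := C ^ (2 * p + (2 * k - 1)))
    (R := c ^ (2 * (s : ℝ) - 2 * p)) (antitone_expWeight ha.le) (expWeight_pos a)
    (summable_expWeight ha) hp.le hsp hρ hd hη (by omega) hmt (by positivity) ?_ ?_ ?_
  · filter_upwards [hev, hK] with n ⟨⟨_, h3⟩, _⟩ h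
    have hm1 : (1 : ℝ) ≤ m n := by exact_mod_cast h3
    rw [Real.norm_of_nonneg (by positivity), Real.norm_of_nonneg (by positivity),
      Real.rpow_add (by linarith), Real.rpow_one] at h
    rw [expWeight_of_ne_zero a (by omega), Real.exp_neg, ← div_eq_mul_inv,
      le_div_iff₀ (Real.exp_pos _)]
    push_cast
    exact h
  · filter_upwards [hev, hlo] with n ⟨⟨⟨_, h2⟩, h3⟩, h4, h5⟩ hl
    have hn : (1 : ℝ) ≤ n := by exact_mod_cast h4
    have hm1 : (1 : ℝ) ≤ m n := by exact_mod_cast h3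
    have hk1 : (1 : ℝ) ≤ k := by exact_mod_cast (by omega : 1 ≤ k)
    have h6 := rpow_le_of_bounds' (q := 2 * p + (2 * k - 1)) hC.le h5
      (by linarith) h2 (by linarith) rfl
    calc (m n : ℝ) ^ (2 * p) * m n ^ (2 * k - 1) * n ^ 2
        = (m n : ℝ) ^ (2 * p + (2 * k - 1)) * n ^ 2 := by
          rw [Real.rpow_add (by linarith), ← Real.rpow_natCast _ (2 * k - 1),
            Nat.cast_sub (by omega)]
          push_cast
          rfl
      _ ≤ C ^ (2 * p + (2 * k - 1)) * n * n ^ 2 := by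
          gcongr
          exact h6.trans (by gcongr)
      _ = C ^ (2 * p + (2 * k - 1)) * n ^ 3 := by ring
      _ ≤ C ^ (2 * p + (2 * k - 1)) * n ^ k := by
          gcongr
          omega
  · filter_upwards [hev] with n ⟨⟨⟨h2, _⟩, _⟩, _, h5⟩
    exact rpow_le_of_bounds hc h5 h2 (by linarith) (by field_simp; ring)

end Weights

end FunctionalLinearModel

end

theorem proposition6 (p ρ σ d η : ℝ) (s k : ℕ)
    (hp : 0 < p) (hsp : (s : ℝ) ≤ p) (hρ : 0 < ρ) (hσ : 0 < σ) (hd : 1 ≤ d) (hη : 1 ≤ η)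
    (hk : 4 ≤ k) :
    -- polynomial case
    (∀ a : ℝ, 1 / 2 < a → 2 + 8 / (2 * p + 2 * a - 1) ≤ (k : ℝ) →
      ∀ m : ℕ → ℕ,
        (fun n => (m n : ℝ)) =Θ[atTop] (fun n : ℕ => (n : ℝ) ^ (1 / (2 * p + 2 * a + 1))) →
        UniformDerivRate.{u} (polyWeight a) p ρ σ d η s k m
          (fun n => (n : ℝ) ^ (-((2 * p - 2 * s) / (2 * p + 2 * a + 1))))) ∧
    -- exponential case
    (∀ a : ℝ, 0 < a →
      ∀ m : ℕ → ℕ,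
        (fun n => (m n : ℝ)) =Θ[atTop] (fun n : ℕ => Real.log n ^ (1 / (2 * a))) →
        (fun n => (m n : ℝ) ^ (2 * p + 1) * Real.exp ((2 * (m n : ℝ) + 1) ^ (2 * a)))
          =O[atTop] (fun n : ℕ => (n : ℝ)) →
        UniformDerivRate.{u} (expWeight a) p ρ σ d η s k m
          (fun n => Real.log n ^ (-((p - s) / a)))) := by
  refine ⟨fun a ha hka m hm => ?_, fun a ha m hm hme => ?_⟩
  · exact uniformDerivRate_polyWeight hp hsp hρ.le (by linarith) (by linarith) hk ha hka hm
  · exact uniformDerivRate_expWeight hp hsp hρ.le (by linarith) (by linarith) hk ha hm hme
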